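/- Let $0\le p\le q$ be integers and let $\mathbb K=\mathbb R,\mathbb C$ or $\mathbb H$. Let $SW_{p,q}(\mathbb K)$ be the set of pairs $(K,L)$, where $K$ is a $p\times p$ matrix and $L$ a $p\times(q-p)$ matrix over $\mathbb K$, such that $\frac12(K+K^*)-LL^*$ is positive definite. Write $K=M+N$ with $M=M^*$, $N=-N^*$. Let $dM$, $dN$, $dL$ be the Lebesgue measures in the real coordinates of the diagonal and above-diagonal entries of $M$, of the diagonal and above-diagonal entries of $N$, and of all entries of $L$. For a square matrix $g$, let $[g]_j$ be its left upper $j\times j$ block. For a quaternionic $n\times n$ matrix $g$, $\det g:=(\det g_{\mathbb R})^{1/4}$, where $g_{\mathbb R}$ is the corresponding operator on $\mathbb H^n\simeq\mathbb R^{4n}$. For a complex matrix $R$ with $R+R^*$ positive definite and eigenvalues $\mu_1,\dots,\mu_n$ (with multiplicity), put $\det R^{\{s\|t\}}:=\exp\{s\sum_i\ln\mu_i\}\exp\{t\,\overline{\sum_i\ln\mu_i}\}$ with the principal branch of $\ln$. All other determinants below are positive numbers, and their complex powers are the usual ones. Let $\lambda_k,\sigma_k,\tau_k\in\mathbb C$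 for $1\le k\le p$, and $\lambda_{p+1}=\sigma_{p+1}=\tau_{p+1}=0$. (a) If $\operatorname{Re}\lambda_k>\frac{q+k}2-1$ and $\operatorname{Re}(\sigma_k-\lambda_k)>\frac{p-k}2$ for all $k$, then the following integral converges absolutely and $$\int_{SW_{p,q}(\mathbb R)}\prod_{j=1}^p\frac{\det[M-LL^*]_j^{\lambda_j-\lambda_{j+1}}}{\det[1+M+N]_j^{\sigma_j-\sigma_{j+1}}}\det(M-LL^*)^{-(p+q)/2}\,dM\,dN\,dL=\prod_{k=1}^p\pi^{k+(q-p)/2-1}\frac{\Gamma(\lambda_k-\frac{q+k}2+1)\,\Gamma(\sigma_k-\lambda_k-\frac{p-k}2)}{\Gamma(\sigma_k-p+k)}.$$ (b) If $\operatorname{Re}\lambda_k>q+k-1$ and $\operatorname{Re}(\sigma_k+\tau_k-\lambda_k)>p-k$ for all $k$, then the following integral converges absolutely and $$\int_{SW_{p,q}(\mathbb C)}\prod_{j=1}^p\frac{\det[M-LL^*]_j^{\lambda_j-\lambda_{j+1}}}{\det[1+M+N]_j^{\{\sigma_j-\sigma_{j+1}\|\tau_j-\tau_{j+1}\}}}\det(M-LL^*)^{-(p+q)}\,dM\,dN\,dL$$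 $$=\prod_{k=1}^p2^{2(p-k+1)-\sigma_k-\tau_k}\,\pi^{2k+(q-p)-1}\frac{\Gamma(\lambda_k-(q+k)+1)\,\Gamma(\sigma_k+\tau_k-\lambda_k-p+k)}{\Gamma(\sigma_k-p+k)\,\Gamma(\tau_k-p+k)},$$ where $1/\Gamma$ is $0$ at the poles of $\Gamma$. (c) If $\operatorname{Re}\lambda_k>2(q+k)-1$ and $\operatorname{Re}(\sigma_k-\lambda_k)>2(p-k)$ for all $k$, then the following integral converges absolutely and $$\int_{SW_{p,q}(\mathbb H)}\prod_{j=1}^p\frac{\det[M-LL^*]_j^{\lambda_j-\lambda_{j+1}}}{\det[1+M+N]_j^{\sigma_j-\sigma_{j+1}}}\det(M-LL^*)^{-2(p+q)}\,dM\,dN\,dL$$ $$=\prod_{k=1}^p2^{4(p-k+1)-\sigma_k}\,\pi^{4k+2(q-p)-2}\frac{\Gamma(\lambda_k-2(q+k)+1)\,\Gamma(\sigma_k-\lambda_k-2(p-k))}{\Gamma(\sigma_k/2-2(p-k))\,\Gamma(\sigma_k/2-2(p-k)-1)}.$$ -/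

import Mathlib

open Matrix MeasureTheory
open scoped ComplexOrder ComplexConjugate

noncomputable section

namespace SectionOfWedge

/-! Indices are zero-based: `j : Fin p` stands for the index `j + 1` of the usual numbering. -/

/-- The left upper block of size `j + 1` of a `p × p` matrix. -/
def lead {K : Type*} {p : ℕ} (g : Matrix (Fin p) (Fin p) K) (j : Fin p) :
    Matrix (Fin (j.val + 1)) (Fin (j.val + 1)) K :=
  g.submatrix (Fin.castLE (Nat.succ_le_of_lt j.isLt)) (Fin.castLE (Nat.succ_le_of_lt j.isLt))

/-- The difference of consecutive parameters, with the convention that the parameter after the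
last one is `0`. -/
def gap {p : ℕ} (a : Fin p → ℂ) (j : Fin p) : ℂ :=
  a j - if h : j.val + 1 < p then a ⟨j.val + 1, h⟩ else 0

/-! ### Determinants and their complex powers -/

/-- A quaternionic matrix as a real linear operator on `ℍⁿ ≃ ℝ⁴ⁿ`. -/
def quatOp {n : ℕ} (g : Matrix (Fin n) (Fin n) (Quaternion ℝ)) :
    (Fin n → Quaternion ℝ) →ₗ[ℝ] (Fin n → Quaternion ℝ) where
  toFun x := g *ᵥ x
  map_add' x y := Matrix.mulVec_add g x y
  map_smul' r x := Matrix.mulVec_smul g r x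

/-- The determinant of a quaternionic matrix: the fourth root of the determinant of the
corresponding real operator. -/
def quatDet {n : ℕ} (g : Matrix (Fin n) (Fin n) (Quaternion ℝ)) : ℝ :=
  (LinearMap.det (quatOp g)) ^ (1 / 4 : ℝ)

/-- `∑ ln μ` over the eigenvalues `μ` (with multiplicity) of a complex matrix; for a dissipative
matrix all of them lie in the right half-plane, and `ln` is the principal branch. -/
def logDet {n : ℕ} (R : Matrix (Fin n) (Fin n) ℂ) : ℂ :=
  (R.charpoly.roots.map Complex.log).sum

/-- `(det R) ^ s * (conj (det R)) ^ t` for a complex dissipative matrix `R`. -/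
def detPow {n : ℕ} (R : Matrix (Fin n) (Fin n) ℂ) (s t : ℂ) : ℂ :=
  Complex.exp (s * logDet R) * Complex.exp (t * conj (logDet R))

/-! ### The sections of wedges

Points are pairs `(K, L)` of a `p × p` and a `p × (q - p)` matrix such that
`(K + K*) / 2 - L L*` is positive definite. -/

/-- Positive definiteness of a quaternionic matrix: `T = T*` and `x T x* > 0` for every nonzero
row `x` (for hermitian `T` the quaternion `x T x*` is real). -/
def QuatPosDef {n : ℕ} (T : Matrix (Fin n) (Fin n) (Quaternion ℝ)) : Prop :=
  T.IsHermitian ∧ ∀ x : Fin n → Quaternion ℝ, x ≠ 0 → 0 < (x ⬝ᵥ (T *ᵥ star x)).re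

def SWReal (p q : ℕ) : Set (Matrix (Fin p) (Fin p) ℝ × Matrix (Fin p) (Fin (q - p)) ℝ) :=
  {x | ((1 / 2 : ℝ) • (x.1 + x.1ᴴ) - x.2 * x.2ᴴ).PosDef}

def SWComplex (p q : ℕ) : Set (Matrix (Fin p) (Fin p) ℂ × Matrix (Fin p) (Fin (q - p)) ℂ) :=
  {x | ((1 / 2 : ℝ) • (x.1 + x.1ᴴ) - x.2 * x.2ᴴ).PosDef}

def SWQuat (p q : ℕ) :
    Set (Matrix (Fin p) (Fin p) (Quaternion ℝ) × Matrix (Fin p) (Fin (q - p)) (Quaternion ℝ)) :=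
  {x | QuatPosDef ((1 / 2 : ℝ) • (x.1 + x.1ᴴ) - x.2 * x.2ᴴ)}

/-! ### Coordinates

`dM`, `dN`, `dL` are Lebesgue measures in the real coordinates of the diagonal and
above-diagonal entries of `M` and `N`, and of all entries of `L`. -/

/-- Pairs `(i, j)` with `i < j`. -/
abbrev Upper (p : ℕ) : Type := {ij : Fin p × Fin p // ij.1 < ij.2}

/-- The hermitian matrix with diagonal `d` and above-diagonal entries `o`. -/
def herm {K : Type*} [Ring K] [StarRing K] [Algebra ℝ K] {p : ℕ}
    (d : Fin p → ℝ) (o : Upper p → K) : Matrix (Fin p) (Fin p) K :=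
  Matrix.of fun i j =>
    if h : i < j then o ⟨(i, j), h⟩
    else if h : j < i then star (o ⟨(j, i), h⟩)
    else algebraMap ℝ K (d i)

/-- The matrix with diagonal `d`, above-diagonal entries `o` and `N i j = -star (N j i)` for
`i ≠ j`; it is skew-hermitian when the entries of `d` are purely imaginary. -/
def skew {K : Type*} [Ring K] [StarRing K] {p : ℕ}
    (d : Fin p → K) (o : Upper p → K) : Matrix (Fin p) (Fin p) K :=
  Matrix.of fun i j =>
    if h : i < j then o ⟨(i, j), h⟩
    else if h : j < i then -star (o ⟨(j, i), h⟩)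
    else d i

/-- The quaternion with given coordinates. -/
def quat (v : Fin 4 → ℝ) : Quaternion ℝ := ⟨v 0, v 1, v 2, v 3⟩

/-- The purely imaginary quaternion with given coordinates. -/
def quatIm (v : Fin 3 → ℝ) : Quaternion ℝ := ⟨0, v 0, v 1, v 2⟩

/-- Coordinates of a real triple `(M, N, L)`: the diagonal of `M`, the above-diagonal entries
of `M`, the above-diagonal entries of `N`, the entries of `L`. -/
abbrev CoordReal (p q : ℕ) : Type :=
  (Fin p → ℝ) × (Upper p → ℝ) × (Upper p → ℝ) × (Fin p → Fin (q - p) → ℝ)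

/-- Coordinates of a complex triple `(M, N, L)`: the diagonal of `M`, the above-diagonal entries
of `M`, the imaginary parts of the diagonal of `N`, the above-diagonal entries of `N`, the
entries of `L`. -/
abbrev CoordComplex (p q : ℕ) : Type :=
  (Fin p → ℝ) × (Upper p → ℂ) × (Fin p → ℝ) × (Upper p → ℂ) × (Fin p → Fin (q - p) → ℂ)

/-- Coordinates of a quaternionic triple `(M, N, L)`, in the same order as in the complex case. -/
abbrev CoordQuat (p q : ℕ) : Type :=
  (Fin p → ℝ) × (Upper p → Fin 4 → ℝ) × (Fin p → Fin 3 → ℝ) × (Upper p → Fin 4 → ℝ) ×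
    (Fin p → Fin (q - p) → Fin 4 → ℝ)

def MReal {p q : ℕ} (x : CoordReal p q) : Matrix (Fin p) (Fin p) ℝ := herm x.1 x.2.1
def NReal {p q : ℕ} (x : CoordReal p q) : Matrix (Fin p) (Fin p) ℝ := skew 0 x.2.2.1
def LReal {p q : ℕ} (x : CoordReal p q) : Matrix (Fin p) (Fin (q - p)) ℝ :=
  Matrix.of x.2.2.2

def MComplex {p q : ℕ} (x : CoordComplex p q) : Matrix (Fin p) (Fin p) ℂ := herm x.1 x.2.1
def NComplex {p q : ℕ} (x : CoordComplex p q) : Matrix (Fin p) (Fin p) ℂ :=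
  skew (fun i => (x.2.2.1 i : ℂ) * Complex.I) x.2.2.2.1
def LComplex {p q : ℕ} (x : CoordComplex p q) : Matrix (Fin p) (Fin (q - p)) ℂ :=
  Matrix.of x.2.2.2.2

def MQuat {p q : ℕ} (x : CoordQuat p q) : Matrix (Fin p) (Fin p) (Quaternion ℝ) :=
  herm x.1 (fun ij => quat (x.2.1 ij))
def NQuat {p q : ℕ} (x : CoordQuat p q) : Matrix (Fin p) (Fin p) (Quaternion ℝ) :=
  skew (fun i => quatIm (x.2.2.1 i)) (fun ij => quat (x.2.2.2.1 ij))
def LQuat {p q : ℕ} (x : CoordQuat p q) : Matrix (Fin p) (Fin (q - p)) (Quaternion ℝ) :=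
  Matrix.of fun i j => quat (x.2.2.2.2 i j)

/-- The domains of integration: the sections of wedges in coordinates. -/
def domReal (p q : ℕ) : Set (CoordReal p q) :=
  {x | (MReal x + NReal x, LReal x) ∈ SWReal p q}

def domComplex (p q : ℕ) : Set (CoordComplex p q) :=
  {x | (MComplex x + NComplex x, LComplex x) ∈ SWComplex p q}

def domQuat (p q : ℕ) : Set (CoordQuat p q) :=
  {x | (MQuat x + NQuat x, LQuat x) ∈ SWQuat p q}

/-! ### The integrands

All determinants of blocks of `M - L L*` that occur are positive on the domain, and so are, in
the real and quaternionic cases, those of blocks of the dissipative matrix `1 + M + N`. -/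

def integrandReal {p q : ℕ} (lam sig : Fin p → ℂ) (x : CoordReal p q) : ℂ :=
  (∏ j : Fin p,
    (((lead (MReal x - LReal x * (LReal x)ᴴ) j).det : ℝ) : ℂ) ^ gap lam j /
      (((lead (1 + MReal x + NReal x) j).det : ℝ) : ℂ) ^ gap sig j) *
  (((MReal x - LReal x * (LReal x)ᴴ).det : ℝ) : ℂ) ^ (-((p : ℂ) + q) / 2)

def integrandComplex {p q : ℕ} (lam sig tau : Fin p → ℂ) (x : CoordComplex p q) : ℂ :=
  (∏ j : Fin p,
    (lead (MComplex x - LComplex x * (LComplex x)ᴴ) j).det ^ gap lam j /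
      detPow (lead (1 + MComplex x + NComplex x) j) (gap sig j) (gap tau j)) *
  (MComplex x - LComplex x * (LComplex x)ᴴ).det ^ (-((p : ℂ) + q))

def integrandQuat {p q : ℕ} (lam sig : Fin p → ℂ) (x : CoordQuat p q) : ℂ :=
  (∏ j : Fin p,
    (quatDet (lead (MQuat x - LQuat x * (LQuat x)ᴴ) j) : ℂ) ^ gap lam j /
      (quatDet (lead (1 + MQuat x + NQuat x) j) : ℂ) ^ gap sig j) *
  (quatDet (MQuat x - LQuat x * (LQuat x)ᴴ) : ℂ) ^ (-2 * ((p : ℂ) + q))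

end SectionOfWedge

end

/-! Let d be the real dimension of 𝕂, r = q - p, T = M - LL* and R = 1 + M + N. Gaussian elimination
works over any of the three division rings once the hermitian part is positive definite (`Diss`),
and the determinant of a leading block is the product of its pivots (of their norms for
quaternions). By Abel summation the integrand becomes ∏ ρ_k^(λ_k - d(p+q)/2) χ_k(s_k), where ρ_k and
s_k are the pivots of T and R and χ_k is an inverse power; the domain becomes ρ_k > 0 for all k
(`diss_iff_piv`).

The heart of the proof is the integration over the last row and column (μ, m, ν, n, l) with all
other entries fixed. The last pivots are ρ = μ - |l|² - (m - Ll*)* T⁻¹ (m - Ll*) and s = 1 + μ + ν -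
(m - n)* R⁻¹ (m + n). With x = T⁻¹(m - Ll*) and y = R⁻¹(m + n) the squares complete (`re_schur_eq`):
Re s = 1 + ρ + |y|² + |l* - L*y|² + (x - y)* T (x - y). Passing to x and y and reducing T to the
identity costs only the factor ∏ (√ρ_k |s_k|)^d over the earlier pivots. Apart from it the
distribution of (ρ, s) does not depend on the fixed block (`lintegral_last`): it is `model`, the
image of Lebesgue measure under (y, l, x, v, ρ) ↦ (ρ, 1 + ρ + |y|² + |l|² + |x|² + v) with v purely
imaginary. Induction on the number of rows therefore turns the integral into a product of p
integrals over such models (`hasInt_prod_pivots`).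

In each factor the integral over v at real part A has the form C A^(-α), and the rest is a beta
integral over a half-line times a Euclidean space (`hasInt_beta`), obtained by writing a power as a
Laplace integral. Only the v-integral depends on the division ring. It is trivial over ℝ; over ℂ it
is the Cauchy beta integral (`hasInt_bipow`); over ℍ it is a radial integral over ℝ³, after which
the duplication formula for Γ gives the stated form. Over ℂ one also needs that the principal
logarithms of the eigenvalues and those of the pivots have the same sum (`logDet_eq_sum`), which
follows by continuity along the segment to the identity matrix. -/

noncomputable section

namespace SectionOfWedge

set_option linter.unusedSectionVars false

open scoped ENNReal Topology FourierTransform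

/-! ### Gaussian elimination over a division ring -/

section Elimination

variable {K : Type*} {p : ℕ}

/-- Append a last entry to a vector. -/
def snc {α : Type*} (v : Fin p → α) (a : α) : Fin (p + 1) → α := Fin.snoc (α := fun _ => α) v a

@[simp] lemma snc_castSucc {α : Type*} (v : Fin p → α) (a : α) (i : Fin p) :
    snc v a i.castSucc = v i := by simp [snc]

@[simp] lemma snc_last {α : Type*} (v : Fin p → α) (a : α) : snc v a (Fin.last p) = a := by
  simp [snc]

lemma eq_snc {α : Type*} (x : Fin (p + 1) → α) :
    x = snc (fun i => x i.castSucc) (x (Fin.last p)) := by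
  ext i; refine Fin.lastCases ?_ (fun i => ?_) i <;> simp

/-- The left upper block of size one less. -/
def minor (g : Matrix (Fin (p + 1)) (Fin (p + 1)) K) : Matrix (Fin p) (Fin p) K :=
  g.submatrix Fin.castSucc Fin.castSucc

def lastCol (g : Matrix (Fin (p + 1)) (Fin (p + 1)) K) : Fin p → K :=
  fun i => g i.castSucc (Fin.last p)

def lastRow (g : Matrix (Fin (p + 1)) (Fin (p + 1)) K) : Fin p → K :=
  fun j => g (Fin.last p) j.castSucc

/-- The solution `x` of `g x = b` given by Gaussian elimination. -/
def solve [DivisionRing K] : (p : ℕ) → Matrix (Fin p) (Fin p) K → (Fin p → K) → (Fin p → K)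
  | 0, _, b => b
  | p + 1, g, b =>
    let y := solve p (minor g) (lastCol g)
    let u := solve p (minor g) (fun i => b i.castSucc)
    -- The inverse is total, with `0⁻¹ = 0`; the result solves the system when no pivot vanishes.
    let z := (g (Fin.last p) (Fin.last p) - lastRow g ⬝ᵥ y)⁻¹ *
      (b (Fin.last p) - lastRow g ⬝ᵥ u)
    snc (fun i => u i - y i * z) z

/-- The Schur complement of the left upper block of size `p`: the last pivot. -/
def schur [DivisionRing K] (g : Matrix (Fin (p + 1)) (Fin (p + 1)) K) : K :=
  g (Fin.last p) (Fin.last p) - lastRow g ⬝ᵥ solve p (minor g) (lastCol g)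

/-- The pivots of a matrix. -/
def piv [DivisionRing K] (g : Matrix (Fin p) (Fin p) K) (k : Fin p) : K := schur (lead g k)

lemma piv_last [DivisionRing K] (g : Matrix (Fin (p + 1)) (Fin (p + 1)) K) :
    piv g (Fin.last p) = schur g := rfl

lemma piv_castSucc [DivisionRing K] (g : Matrix (Fin (p + 1)) (Fin (p + 1)) K) (k : Fin p) :
    piv g k.castSucc = piv (minor g) k := rfl

lemma snc_dotProduct_snc [NonUnitalNonAssocSemiring K] (v w : Fin p → K) (a b : K) :
    snc v a ⬝ᵥ snc w b = v ⬝ᵥ w + a * b := by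
  simp [dotProduct, Fin.sum_univ_castSucc]

lemma star_snc [Star K] (v : Fin p → K) (a : K) : star (snc v a) = snc (star v) (star a) := by
  ext i; refine Fin.lastCases ?_ (fun i => ?_) i <;> simp

lemma mulVec_snc [Ring K] (g : Matrix (Fin (p + 1)) (Fin (p + 1)) K) (v : Fin p → K)
    (a : K) :
    g *ᵥ snc v a = snc (minor g *ᵥ v + fun i => lastCol g i * a)
      (lastRow g ⬝ᵥ v + g (Fin.last p) (Fin.last p) * a) := by
  ext i
  refine Fin.lastCases ?_ (fun i => ?_) i <;>
    simp [mulVec, dotProduct, Fin.sum_univ_castSucc, minor, lastCol, lastRow]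

lemma solve_succ [DivisionRing K] (g : Matrix (Fin (p + 1)) (Fin (p + 1)) K) (v : Fin p → K)
    (a : K) :
    solve (p + 1) g (snc v a) =
      snc (fun i => solve p (minor g) v i - solve p (minor g) (lastCol g) i *
        ((schur g)⁻¹ * (a - lastRow g ⬝ᵥ solve p (minor g) v)))
        ((schur g)⁻¹ * (a - lastRow g ⬝ᵥ solve p (minor g) v)) := by
  simp [solve, schur]

lemma dotProduct_sub_mul [Ring K] (r u y : Fin p → K) (z : K) :
    r ⬝ᵥ (fun i => u i - y i * z) = r ⬝ᵥ u - (r ⬝ᵥ y) * z := by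
  simp [dotProduct, mul_sub, Finset.sum_sub_distrib, Finset.sum_mul, mul_assoc]

lemma mulVec_sub_mul [Ring K] (g : Matrix (Fin p) (Fin p) K) (u y : Fin p → K) (z : K) :
    g *ᵥ (fun i => u i - y i * z) = fun i => (g *ᵥ u) i - (g *ᵥ y) i * z := by
  ext i; exact dotProduct_sub_mul _ _ _ _

end Elimination

/-! ### Real parts -/

/-- The data which the real numbers, the complex numbers and the quaternions have in common. -/
class ReField (K : Type*) [NormedDivisionRing K] [NormedAlgebra ℝ K] [StarRing K] where
  re : K →L[ℝ] ℝ
  add_star : ∀ x : K, x + star x = algebraMap ℝ K (2 * re x)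
  star_mul_self : ∀ x : K, star x * x = algebraMap ℝ K (‖x‖ ^ 2)
  star_algebraMap : ∀ r : ℝ, star (algebraMap ℝ K r) = algebraMap ℝ K r

open ReField

section RealPart

variable {K : Type*} [NormedDivisionRing K] [NormedAlgebra ℝ K] [StarRing K] [ReField K]
variable {p : ℕ}

lemma re_star (x : K) : re (star x) = re x := by
  have h1 := add_star x
  have h2 := add_star (star x)
  rw [star_star, add_comm, h1] at h2
  have := (algebraMap ℝ K).injective h2
  linarith

@[simp] lemma re_algebraMap (r : ℝ) : re (algebraMap ℝ K r) = r := by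
  have h1 := add_star (algebraMap ℝ K r)
  rw [star_algebraMap, ← map_add] at h1
  have := (algebraMap ℝ K).injective h1
  linarith

lemma eq_algebraMap_re {x : K} (hx : star x = x) : x = algebraMap ℝ K (re x) := by
  have h1 := add_star x
  rw [hx, ← two_mul, map_mul, map_ofNat] at h1
  have h2 : (2 : K) ≠ 0 := by
    rw [← map_ofNat (algebraMap ℝ K)]
    exact (map_ne_zero _).2 two_ne_zero
  exact mul_left_cancel₀ h2 h1

lemma norm_star_eq (x : K) : ‖star x‖ = ‖x‖ := by
  by_cases hx : x = 0
  · simp [hx]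
  have h := congrArg norm (star_mul_self x)
  rw [norm_mul, norm_algebraMap', Real.norm_of_nonneg (by positivity), sq] at h
  exact mul_right_cancel₀ (norm_ne_zero_iff.2 hx) h

lemma mul_star_self_eq (x : K) : x * star x = algebraMap ℝ K (‖x‖ ^ 2) := by
  have h := star_mul_self (star x)
  rwa [star_star, norm_star_eq] at h

/-- The sum of the squares of the norms of the entries. -/
def nsq {n : ℕ} (x : Fin n → K) : ℝ := ∑ i, ‖x i‖ ^ 2

/-- The real part of `x* T x`. -/
def qf (T : Matrix (Fin p) (Fin p) K) (x : Fin p → K) : ℝ := re (star x ⬝ᵥ T *ᵥ x)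

lemma re_dot_comm (x y : Fin p → K) : re (star x ⬝ᵥ y) = re (star y ⬝ᵥ x) := by
  rw [star_dotProduct, re_star]

lemma star_dot_self (x : Fin p → K) : star x ⬝ᵥ x = algebraMap ℝ K (nsq x) := by
  simp [dotProduct, nsq, star_mul_self]

lemma re_star_dot_self (x : Fin p → K) : re (star x ⬝ᵥ x) = nsq x := by
  rw [star_dot_self, re_algebraMap]

lemma dot_star_self (x : Fin p → K) : x ⬝ᵥ star x = algebraMap ℝ K (nsq x) := by
  simp [dotProduct, nsq, mul_star_self_eq]

/-- Matrices with positive definite hermitian part. -/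
def Diss (g : Matrix (Fin p) (Fin p) K) : Prop := ∀ x, x ≠ 0 → 0 < qf g x

lemma snc_ne_zero_left {v : Fin p → K} (hv : v ≠ 0) (a : K) : snc v a ≠ 0 := by
  intro h
  exact hv (funext fun i => by simpa using congrFun h i.castSucc)

lemma snc_ne_zero_right (v : Fin p → K) {a : K} (ha : a ≠ 0) : snc v a ≠ 0 := by
  intro h
  exact ha (by simpa using congrFun h (Fin.last p))

lemma Diss.minor {g : Matrix (Fin (p + 1)) (Fin (p + 1)) K} (hg : Diss g) :
    Diss (minor g) := by
  intro x hx
  have := hg (snc x 0) (snc_ne_zero_left hx 0)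
  rw [qf, mulVec_snc, star_snc, snc_dotProduct_snc] at this
  simpa [qf, Pi.zero_def] using! this

/-- This test vector is sent to the last coordinate axis, so the form of `g` at it is the Schur
complement itself. This is the source of the sign and the non-vanishing of pivots. -/
lemma mulVec_snc_neg_solve {g : Matrix (Fin (p + 1)) (Fin (p + 1)) K}
    (h : SectionOfWedge.minor g *ᵥ solve p (SectionOfWedge.minor g) (lastCol g) = lastCol g) :
    g *ᵥ snc (-solve p (SectionOfWedge.minor g) (lastCol g)) 1 = snc 0 (schur g) := by
  rw [mulVec_snc, mulVec_neg, h, schur]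
  congr 1
  · ext i; simp
  · simp [sub_eq_neg_add]

/-- Elimination never divides by zero here: a vanishing Schur complement would make the test vector
of `mulVec_snc_neg_solve` a nonzero vector in the kernel of `g`. -/
lemma Diss.mulVec_solve {g : Matrix (Fin p) (Fin p) K} (hg : Diss g) (b : Fin p → K) :
    g *ᵥ solve p g b = b := by
  induction p with
  | zero => exact Subsingleton.elim _ _
  | succ p ih =>
    have h1 := ih hg.minor
    have hs : schur g ≠ 0 := by
      intro h0
      have h2 := mulVec_snc_neg_solve (h1 (lastCol g))
      rw [h0] at h2
      have h3 := hg _ (snc_ne_zero_right (-solve p (SectionOfWedge.minor g) (lastCol g))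
        (one_ne_zero (α := K)))
      rw [qf, h2, star_snc, snc_dotProduct_snc] at h3
      simp at h3
    rw [eq_snc b, solve_succ, mulVec_snc, mulVec_sub_mul, h1, h1, dotProduct_sub_mul]
    congr 1
    · ext i; simp
    · have : g (Fin.last p) (Fin.last p) = schur g +
          lastRow g ⬝ᵥ solve p (SectionOfWedge.minor g) (lastCol g) := by simp [schur]
      rw [this, add_mul, mul_inv_cancel_left₀ hs]
      abel

lemma Diss.re_schur_pos {g : Matrix (Fin (p + 1)) (Fin (p + 1)) K} (hg : Diss g) :
    0 < re (schur g) := by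
  have h2 := mulVec_snc_neg_solve (hg.minor.mulVec_solve (lastCol g))
  have h3 := hg _ (snc_ne_zero_right (-solve p (SectionOfWedge.minor g) (lastCol g))
    (one_ne_zero (α := K)))
  rw [qf, h2, star_snc, snc_dotProduct_snc] at h3
  simpa using h3

lemma Diss.schur_ne_zero {g : Matrix (Fin (p + 1)) (Fin (p + 1)) K} (hg : Diss g) :
    schur g ≠ 0 := fun h => by simpa [h] using hg.re_schur_pos

lemma Diss.re_piv_pos {g : Matrix (Fin p) (Fin p) K} (hg : Diss g) (k : Fin p) :
    0 < re (piv g k) := by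
  induction p with
  | zero => exact k.elim0
  | succ p ih =>
    refine Fin.lastCases ?_ (fun k => ?_) k
    · exact hg.re_schur_pos
    · exact ih hg.minor k

lemma Diss.lead {g : Matrix (Fin p) (Fin p) K} (hg : Diss g) (k : Fin p) :
    Diss (lead g k) := by
  induction p with
  | zero => exact k.elim0
  | succ p ih =>
    refine Fin.lastCases ?_ (fun k => ?_) k
    · exact hg
    · exact ih hg.minor k

lemma _root_.Matrix.IsHermitian.minor {T : Matrix (Fin (p + 1)) (Fin (p + 1)) K}
    (hT : T.IsHermitian) : (SectionOfWedge.minor T).IsHermitian := by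
  ext i j; exact hT.apply _ _

lemma _root_.Matrix.IsHermitian.lastRow_eq {T : Matrix (Fin (p + 1)) (Fin (p + 1)) K}
    (hT : T.IsHermitian) : lastRow T = star (lastCol T) := by
  ext i; exact (hT.apply _ _).symm

lemma _root_.Matrix.IsHermitian.star_dot_mulVec {T : Matrix (Fin p) (Fin p) K}
    (hT : T.IsHermitian) (x y : Fin p → K) : star (T *ᵥ x) ⬝ᵥ y = star x ⬝ᵥ (T *ᵥ y) := by
  rw [star_mulVec, hT.eq, dotProduct_mulVec]

lemma qf_add {T : Matrix (Fin p) (Fin p) K} (hT : T.IsHermitian) (x y : Fin p → K) :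
    qf T (x + y) = qf T x + 2 * re (star x ⬝ᵥ T *ᵥ y) + qf T y := by
  have : re (star y ⬝ᵥ T *ᵥ x) = re (star x ⬝ᵥ T *ᵥ y) := by
    rw [← hT.star_dot_mulVec, re_dot_comm]
  simp only [qf, mulVec_add, star_add, add_dotProduct, dotProduct_add, map_add, this]
  ring

lemma qf_sub {T : Matrix (Fin p) (Fin p) K} (hT : T.IsHermitian) (x y : Fin p → K) :
    qf T (x - y) = qf T x - 2 * re (star x ⬝ᵥ T *ᵥ y) + qf T y := by
  have : re (star y ⬝ᵥ T *ᵥ x) = re (star x ⬝ᵥ T *ᵥ y) := by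
    rw [← hT.star_dot_mulVec, re_dot_comm]
  simp only [qf, mulVec_sub, star_sub, sub_dotProduct, dotProduct_sub, map_sub, this]
  ring

lemma _root_.Matrix.IsHermitian.star_schur {T : Matrix (Fin (p + 1)) (Fin (p + 1)) K}
    (hT : T.IsHermitian) (h : Diss (SectionOfWedge.minor T)) : star (schur T) = schur T := by
  have h1 : star (lastRow T ⬝ᵥ solve p (SectionOfWedge.minor T) (lastCol T)) =
      lastRow T ⬝ᵥ solve p (SectionOfWedge.minor T) (lastCol T) := by
    have hc := h.mulVec_solve (lastCol T)
    set x := solve p (SectionOfWedge.minor T) (lastCol T)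
    rw [hT.lastRow_eq, ← hc, ← star_dotProduct, ← hT.minor.star_dot_mulVec]
  rw [schur, star_sub, hT.apply, h1]

/-- Completion of the square in the last variable. -/
lemma qf_snc {T : Matrix (Fin (p + 1)) (Fin (p + 1)) K} (hT : T.IsHermitian)
    (h : Diss (SectionOfWedge.minor T)) (v : Fin p → K) (a : K) :
    qf T (snc v a) = qf (SectionOfWedge.minor T)
      (v + fun i => solve p (SectionOfWedge.minor T) (lastCol T) i * a) +
      re (schur T) * ‖a‖ ^ 2 := by
  set x := solve p (SectionOfWedge.minor T) (lastCol T) with hx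
  have hc : lastCol T = SectionOfWedge.minor T *ᵥ x := (h.mulVec_solve _).symm
  have hsa : star (schur T) = schur T := by
    exact hT.star_schur h
  have hxa : (SectionOfWedge.minor T *ᵥ fun i => x i * a) = fun i => lastCol T i * a := by
    rw [hc]; ext i; simp [mulVec, dotProduct, Finset.sum_mul, mul_assoc]
  have hq : qf (SectionOfWedge.minor T) (fun i => x i * a) =
      re (star a * (lastRow T ⬝ᵥ x) * a) := by
    rw [qf, hxa, hT.lastRow_eq, hc, hT.minor.star_dot_mulVec]
    congr 1
    simp [dotProduct, Finset.sum_mul, Finset.mul_sum, mul_assoc]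
  have hl : re (schur T) * ‖a‖ ^ 2 = re (star a * schur T * a) := by
    rw [eq_algebraMap_re hsa, re_algebraMap, ← Algebra.commutes, mul_assoc, star_mul_self,
      ← map_mul, re_algebraMap]
  have hr : re (star a * (lastRow T ⬝ᵥ v)) =
      re (star v ⬝ᵥ fun i => lastCol T i * a) := by
    rw [re_dot_comm, hT.lastRow_eq]
    congr 1
    simp [dotProduct, Finset.mul_sum, mul_assoc]
  rw [qf_add hT.minor, hxa, hq, hl, schur, ← hx, qf, mulVec_snc, star_snc, snc_dotProduct_snc,
    dotProduct_add, mul_add]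
  simp only [map_add, mul_sub, sub_mul, map_sub, hr, qf, mul_assoc]
  ring

/-- After completion of the square both summands are nonnegative; the first is positive if the last
coordinate vanishes, the second if it does not. -/
lemma Diss.of_minor_schur {T : Matrix (Fin (p + 1)) (Fin (p + 1)) K} (hT : T.IsHermitian)
    (h : Diss (SectionOfWedge.minor T)) (hs : 0 < re (schur T)) : Diss T := by
  have h0 : ∀ w : Fin p → K, 0 ≤ qf (SectionOfWedge.minor T) w := by
    intro w
    by_cases hw : w = 0
    · simp [hw, qf]
    · exact (h w hw).le
  intro x hx
  rw [eq_snc x] at hx ⊢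
  rw [qf_snc hT h]
  by_cases ha : x (Fin.last p) = 0
  · rw [ha] at hx ⊢
    have hv : (fun i : Fin p => x i.castSucc) ≠ 0 := by
      intro hv
      rw [hv] at hx
      refine hx ?_
      ext i; refine Fin.lastCases ?_ (fun i => ?_) i <;> simp
    have := h _ hv
    simpa [show (fun _ : Fin p => (0 : K)) = 0 from rfl] using this
  · have := h0 ((fun i => x i.castSucc) +
      fun i => solve p (SectionOfWedge.minor T) (lastCol T) i * x (Fin.last p))
    have h2 : 0 < ‖x (Fin.last p)‖ ^ 2 := by positivity
    positivity

/-- Sylvester's criterion with pivots instead of minors. It makes the domain of integration a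
condition on each pivot separately. -/
lemma diss_iff_piv {T : Matrix (Fin p) (Fin p) K} (hT : T.IsHermitian) :
    Diss T ↔ ∀ k, 0 < re (piv T k) := by
  refine ⟨Diss.re_piv_pos, fun h => ?_⟩
  induction p with
  | zero => intro x hx; exact absurd (Subsingleton.elim _ _) hx
  | succ p ih =>
    exact Diss.of_minor_schur hT (ih hT.minor fun k => h k.castSucc) (h (Fin.last p))

end RealPart

/-! ### Splitting off the last coordinate of a vector. -/

lemma measurePreserving_snc {α : Type*} [MeasureSpace α] [SigmaFinite (volume : Measure α)]
    (p : ℕ) : MeasurePreserving (fun z : (Fin p → α) × α => snc z.1 z.2) := by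
  have h1 := (volume_preserving_piFinSuccAbove (fun _ : Fin (p + 1) => α) (Fin.last p)).symm
  have h2 : MeasurePreserving (Prod.swap : (Fin p → α) × α → α × (Fin p → α)) :=
    Measure.measurePreserving_swap
  convert! h1.comp h2 using 1
  ext z i
  refine Fin.lastCases ?_ (fun i => ?_) i <;>
    simp [MeasurableEquiv.piFinSuccAbove]

lemma lintegral_snc {α : Type*} [MeasureSpace α] [SigmaFinite (volume : Measure α)]
    {p : ℕ} {h : (Fin (p + 1) → α) → ℝ≥0∞} (hh : Measurable h) :
    ∫⁻ x, h x = ∫⁻ v : Fin p → α, ∫⁻ a : α, h (snc v a) := by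
  rw [← (measurePreserving_snc p).lintegral_comp hh, Measure.volume_eq_prod, lintegral_prod]
  exact (hh.comp (measurePreserving_snc p).measurable).aemeasurable

/-! ### Measurability of elimination and pivots. -/

section Measurability

variable {K : Type*} [NormedDivisionRing K] [NormedAlgebra ℝ K] [StarRing K] [ReField K]
variable [MeasurableSpace K] [BorelSpace K] [SecondCountableTopology K]
variable {p : ℕ} {α : Type*} [MeasurableSpace α]

lemma measurable_dotProduct {n : ℕ} {x y : α → Fin n → K} (hx : Measurable x)
    (hy : Measurable y) : Measurable fun a => x a ⬝ᵥ y a := by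
  unfold dotProduct
  fun_prop

/-- Continuity of the involution is not assumed in `ReField`; it comes from `star x = 2 re x - x`.
-/
lemma measurable_star_of_reField : Measurable (star : K → K) := by
  have : (star : K → K) = fun x => algebraMap ℝ K (2 * re x) - x := by
    ext x; rw [← add_star]; simp
  rw [this]
  have : Continuous fun x : K => algebraMap ℝ K (2 * re x) - x :=
    ((continuous_algebraMap ℝ K).comp (continuous_const.mul (re : K →L[ℝ] ℝ).continuous)).sub
      continuous_id
  exact this.measurable

lemma measurable_star_pi {n : ℕ} {x : α → Fin n → K} (hx : Measurable x) :
    Measurable fun a => star (x a) := by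
  refine measurable_pi_iff.2 fun i => ?_
  exact measurable_star_of_reField.comp ((measurable_pi_apply i).comp hx)

lemma measurable_mulVec {m n : ℕ} {g : α → Matrix (Fin m) (Fin n) K} {x : α → Fin n → K}
    (hg : ∀ i j, Measurable fun a => g a i j) (hx : Measurable x) :
    Measurable fun a => g a *ᵥ x a := by
  refine measurable_pi_iff.2 fun i => ?_
  exact measurable_dotProduct (measurable_pi_iff.2 fun j => hg i j) hx

lemma measurable_snc {β : Type*} [MeasurableSpace β] {x : α → Fin p → β} {z : α → β}
    (hx : Measurable x) (hz : Measurable z) : Measurable fun a => snc (x a) (z a) := by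
  refine measurable_pi_iff.2 fun i => ?_
  refine Fin.lastCases ?_ (fun i => ?_) i
  · simpa using hz
  · simpa using measurable_pi_iff.1 hx i

lemma measurable_solve {g : α → Matrix (Fin p) (Fin p) K} {b : α → Fin p → K}
    (hg : ∀ i j, Measurable fun a => g a i j) (hb : Measurable b) :
    Measurable fun a => solve p (g a) (b a) := by
  induction p with
  | zero => exact hb
  | succ p ih =>
    have hg' : ∀ i j, Measurable fun a => minor (g a) i j := fun i j => hg _ _
    have hr : Measurable fun a => lastRow (g a) := measurable_pi_iff.2 fun _ => hg _ _
    have hc : Measurable fun a => lastCol (g a) := measurable_pi_iff.2 fun _ => hg _ _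
    have hb' : Measurable fun a (i : Fin p) => b a i.castSucc :=
      measurable_pi_iff.2 fun i => measurable_pi_iff.1 hb _
    have hy := ih hg' hc
    have hu := ih hg' hb'
    have hz : Measurable fun a =>
        (g a (Fin.last p) (Fin.last p) - lastRow (g a) ⬝ᵥ solve p (minor (g a)) (lastCol (g a)))⁻¹ *
        (b a (Fin.last p) -
          lastRow (g a) ⬝ᵥ solve p (minor (g a)) (fun i : Fin p => b a i.castSucc)) :=
      ((hg _ _).sub (measurable_dotProduct hr hy)).inv.mul
        ((measurable_pi_iff.1 hb _).sub (measurable_dotProduct hr hu))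
    refine measurable_snc (measurable_pi_iff.2 fun i => ?_) hz
    exact (measurable_pi_iff.1 hu i).sub ((measurable_pi_iff.1 hy i).mul hz)

lemma measurable_schur {g : α → Matrix (Fin (p + 1)) (Fin (p + 1)) K}
    (hg : ∀ i j, Measurable fun a => g a i j) : Measurable fun a => schur (g a) :=
  (hg _ _).sub (measurable_dotProduct (measurable_pi_iff.2 fun _ => hg _ _)
    (measurable_solve (fun _ _ => hg _ _) (measurable_pi_iff.2 fun _ => hg _ _)))

lemma measurable_piv {g : α → Matrix (Fin p) (Fin p) K}
    (hg : ∀ i j, Measurable fun a => g a i j) (k : Fin p) : Measurable fun a => piv (g a) k :=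
  measurable_schur fun _ _ => hg _ _

lemma measurable_re : Measurable (re : K → ℝ) := (re : K →L[ℝ] ℝ).continuous.measurable

lemma measurable_qf (T : Matrix (Fin p) (Fin p) K) {x : α → Fin p → K} (hx : Measurable x) :
    Measurable fun a => qf T (x a) :=
  measurable_re.comp (measurable_dotProduct (measurable_star_pi hx)
    (measurable_mulVec (fun _ _ => measurable_const) hx))

lemma measurable_nsq {n : ℕ} {x : α → Fin n → K} (hx : Measurable x) :
    Measurable fun a => nsq (x a) := by
  unfold nsq
  fun_prop

end Measurability

/-! ### Haar measure under linear substitutions over a division ring. -/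

section Haar

variable {K : Type*} [NormedDivisionRing K] [NormedAlgebra ℝ K] [StarRing K] [ReField K]
variable [MeasureSpace K] [BorelSpace K] [SecondCountableTopology K] [FiniteDimensional ℝ K]
variable [(volume : Measure K).IsAddHaarMeasure]
variable {p : ℕ}

/-- Left multiplication by `s ≠ 0` maps the unit ball onto the ball of radius `‖s‖`; comparing the
two volumes gives the determinant without a basis. -/
lemma abs_det_mulLeft (s : K) :
    |LinearMap.det (LinearMap.mulLeft ℝ s)| = ‖s‖ ^ Module.finrank ℝ K := by
  by_cases hs : s = 0
  · have h0 : Module.finrank ℝ K ≠ 0 := Module.finrank_pos.ne'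
    have : LinearMap.mulLeft ℝ s = 0 := by ext; simp [hs]
    rw [this, LinearMap.det_zero, hs]
    simp [h0]
  have h1 := Measure.addHaar_image_linearMap (volume : Measure K) (LinearMap.mulLeft ℝ s)
    (Metric.ball 0 1)
  have h2 : (LinearMap.mulLeft ℝ s) '' (Metric.ball 0 1) = Metric.ball 0 ‖s‖ := by
    ext x
    simp only [Set.mem_image, Metric.mem_ball, dist_zero_right, LinearMap.mulLeft_apply]
    constructor
    · rintro ⟨y, hy, rfl⟩
      rw [norm_mul]
      exact mul_lt_of_lt_one_right (norm_pos_iff.2 hs) hy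
    · intro hx
      refine ⟨s⁻¹ * x, ?_, mul_inv_cancel_left₀ hs x⟩
      rw [norm_mul, norm_inv, inv_mul_lt_one₀ (norm_pos_iff.2 hs)]
      exact hx
  rw [h2, Measure.addHaar_ball _ _ (norm_nonneg s)] at h1
  have h3 := (ENNReal.mul_left_inj (Metric.measure_ball_pos volume (0 : K) one_pos).ne'
    measure_ball_lt_top.ne).1 h1
  rw [ENNReal.ofReal_eq_ofReal_iff (by positivity) (abs_nonneg _)] at h3
  exact h3.symm

lemma lintegral_inv_mul {s : K} (hs : s ≠ 0) {h : K → ℝ≥0∞} (hh : Measurable h) :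
    ∫⁻ a, h (s⁻¹ * a) = ENNReal.ofReal (‖s‖ ^ Module.finrank ℝ K) * ∫⁻ a, h a := by
  have hd : |LinearMap.det (LinearMap.mulLeft ℝ s⁻¹)| = (‖s‖ ^ Module.finrank ℝ K)⁻¹ := by
    rw [abs_det_mulLeft, norm_inv, inv_pow]
  have h0 : LinearMap.det (LinearMap.mulLeft ℝ s⁻¹) ≠ 0 := by
    rw [← abs_pos, hd]
    have := norm_pos_iff.2 hs
    positivity
  have h1 := Measure.map_linearMap_addHaar_eq_smul_addHaar (volume : Measure K) h0
  have h2 : Measurable (LinearMap.mulLeft ℝ s⁻¹ : K → K) := measurable_const_mul _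
  rw [abs_inv, hd, inv_inv] at h1
  rw [← smul_eq_mul, ← lintegral_smul_measure, ← h1, lintegral_map hh h2]
  rfl

/-- The Haar measure is multiplied by the product of the norms of the pivots. -/
lemma lintegral_solve {g : Matrix (Fin p) (Fin p) K} (hg : Diss g) {h : (Fin p → K) → ℝ≥0∞}
    (hh : Measurable h) :
    ∫⁻ b, h (solve p g b) =
      ENNReal.ofReal (∏ k, ‖piv g k‖ ^ Module.finrank ℝ K) * ∫⁻ y, h y := by
  induction p with
  | zero => simp [solve]
  | succ p ih =>
    have hsm : Measurable fun v : Fin p → K => solve p (minor g) v :=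
      measurable_solve (fun _ _ => measurable_const) measurable_id
    have hm : Measurable fun b => h (solve (p + 1) g b) :=
      hh.comp (measurable_solve (fun _ _ => measurable_const) measurable_id)
    set y := solve p (minor g) (lastCol g) with hy
    have hF : Measurable fun w : (Fin p → K) × K => h (snc (fun i => w.1 i - y i * w.2) w.2) := by
      refine hh.comp (measurable_snc ?_ measurable_snd)
      fun_prop
    have hS := hg.schur_ne_zero
    calc ∫⁻ b, h (solve (p + 1) g b)
        = ∫⁻ v : Fin p → K, ∫⁻ a : K,
            (fun z => h (snc (fun i => solve p (minor g) v i - y i * z) z))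
              ((schur g)⁻¹ * (a - lastRow g ⬝ᵥ solve p (minor g) v)) := by
          rw [lintegral_snc hm]; simp only [solve_succ, ← hy]
      _ = ∫⁻ v : Fin p → K, ENNReal.ofReal (‖schur g‖ ^ Module.finrank ℝ K) *
            ∫⁻ z : K, h (snc (fun i => solve p (minor g) v i - y i * z) z) := by
          refine lintegral_congr fun v => ?_
          rw [lintegral_sub_right_eq_self (fun a =>
            (fun z => h (snc (fun i => solve p (minor g) v i - y i * z) z)) ((schur g)⁻¹ * a)),
            lintegral_inv_mul hS (h := fun z =>
              h (snc (fun i => solve p (minor g) v i - y i * z) z))]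
          exact hF.comp (measurable_prodMk_left (x := solve p (minor g) v))
      _ = ENNReal.ofReal (‖schur g‖ ^ Module.finrank ℝ K) *
            ∫⁻ v : Fin p → K, (fun u => ∫⁻ z : K, h (snc (fun i => u i - y i * z) z))
              (solve p (minor g) v) := by
          rw [lintegral_const_mul']
          exact ENNReal.ofReal_ne_top
      _ = ENNReal.ofReal (‖schur g‖ ^ Module.finrank ℝ K) *
            (ENNReal.ofReal (∏ k, ‖piv (minor g) k‖ ^ Module.finrank ℝ K) *
            ∫⁻ u : Fin p → K, ∫⁻ z : K, h (snc (fun i => u i - y i * z) z)) := by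
          rw [ih hg.minor (hF.lintegral_prod_right')]
      _ = ENNReal.ofReal (‖schur g‖ ^ Module.finrank ℝ K) *
            (ENNReal.ofReal (∏ k, ‖piv (minor g) k‖ ^ Module.finrank ℝ K) *
            ∫⁻ u : Fin p → K, ∫⁻ z : K, h (snc u z)) := by
          congr 2
          -- For a fixed last coordinate `z` the shear by `y z` is a translation of the remaining
          -- coordinates.
          rw [lintegral_lintegral_swap hF.aemeasurable,
            lintegral_lintegral_swap (f := fun (u : Fin p → K) z => h (snc u z))
              (hh.comp (measurable_snc measurable_fst measurable_snd)).aemeasurable]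
          refine lintegral_congr fun z => ?_
          exact lintegral_sub_right_eq_self (fun u => h (snc u z)) (fun i => y i * z)
      _ = _ := by
          rw [lintegral_snc hh, ← mul_assoc, ← ENNReal.ofReal_mul (by positivity),
            Fin.prod_univ_castSucc, mul_comm (‖schur g‖ ^ _)]
          rfl

/-- Integration of a function of a positive definite quadratic form. -/
lemma lintegral_qf {T : Matrix (Fin p) (Fin p) K} (hT : T.IsHermitian) (hd : Diss T)
    {H : ℝ → ℝ≥0∞} (hH : Measurable H) :
    ∫⁻ x, H (qf T x) =
      ENNReal.ofReal (∏ k, (Real.sqrt (re (piv T k)) ^ Module.finrank ℝ K)⁻¹) *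
        ∫⁻ x : Fin p → K, H (nsq x) := by
  induction p generalizing H with
  | zero => simp [qf, nsq, dotProduct]
  | succ p ih =>
    set y := solve p (minor T) (lastCol T) with hy
    have hS := hd.re_schur_pos
    set r := re (schur T) with hr
    have hr0 : 0 < Real.sqrt r := Real.sqrt_pos.2 hS
    have hF : Measurable fun w : (Fin p → K) × K =>
        H (qf (minor T) (w.1 + fun i => y i * w.2) + r * ‖w.2‖ ^ 2) := by
      refine hH.comp (.add (measurable_qf _ ?_) (by fun_prop))
      fun_prop
    -- Rescaling the last coordinate by `√r`, regarded as an element of `K`, turns `r‖a‖²` into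
    -- `‖a‖²`.
    have hs0 : algebraMap ℝ K (Real.sqrt r)⁻¹ ≠ 0 := (map_ne_zero _).2 (inv_ne_zero hr0.ne')
    calc ∫⁻ x, H (qf T x)
        = ∫⁻ v : Fin p → K, ∫⁻ a : K,
            H (qf (minor T) (v + fun i => y i * a) + r * ‖a‖ ^ 2) := by
          rw [lintegral_snc (h := fun x => H (qf T x))
            (hH.comp (measurable_qf _ measurable_id))]
          simp only [qf_snc hT hd.minor, ← hy, ← hr]
      _ = ∫⁻ a : K, ∫⁻ v : Fin p → K, H (qf (minor T) v + r * ‖a‖ ^ 2) := by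
          rw [lintegral_lintegral_swap hF.aemeasurable]
          refine lintegral_congr fun a => ?_
          exact lintegral_add_right_eq_self (fun v => H (qf (minor T) v + r * ‖a‖ ^ 2)) _
      _ = ENNReal.ofReal (∏ k, (Real.sqrt (re (piv (minor T) k)) ^ Module.finrank ℝ K)⁻¹) *
            ∫⁻ a : K, ∫⁻ v : Fin p → K, H (nsq v + r * ‖a‖ ^ 2) := by
          rw [← lintegral_const_mul' _ _ ENNReal.ofReal_ne_top]
          refine lintegral_congr fun a => ?_
          exact ih hT.minor hd.minor (H := fun t => H (t + r * ‖a‖ ^ 2)) (by fun_prop)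
      _ = ENNReal.ofReal (∏ k, (Real.sqrt (re (piv (minor T) k)) ^ Module.finrank ℝ K)⁻¹) *
            ∫⁻ v : Fin p → K, ∫⁻ a : K, H (nsq v + ‖(algebraMap ℝ K (Real.sqrt r)⁻¹)⁻¹ * a‖ ^ 2) := by
          rw [lintegral_lintegral_swap (f := fun (v : Fin p → K) (a : K) =>
            H (nsq v + ‖(algebraMap ℝ K (Real.sqrt r)⁻¹)⁻¹ * a‖ ^ 2))]
          · congr 1
            refine lintegral_congr fun a => lintegral_congr fun v => ?_
            rw [norm_mul, norm_inv, norm_algebraMap', mul_pow, norm_inv, inv_inv,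
              Real.norm_of_nonneg hr0.le, Real.sq_sqrt hS.le]
          · exact (hH.comp (.add (measurable_nsq measurable_fst) (by fun_prop))).aemeasurable
      _ = ENNReal.ofReal (∏ k, (Real.sqrt (re (piv (minor T) k)) ^ Module.finrank ℝ K)⁻¹) *
            ∫⁻ v : Fin p → K, ENNReal.ofReal ((Real.sqrt r ^ Module.finrank ℝ K)⁻¹) *
              ∫⁻ a : K, H (nsq v + ‖a‖ ^ 2) := by
          congr 1
          refine lintegral_congr fun v => ?_
          rw [lintegral_inv_mul hs0 (h := fun a => H (nsq v + ‖a‖ ^ 2)) (by fun_prop),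
            norm_algebraMap', norm_inv, inv_pow, Real.norm_of_nonneg hr0.le]
      _ = _ := by
          rw [lintegral_const_mul' _ _ ENNReal.ofReal_ne_top,
            lintegral_snc (h := fun x => H (nsq x)) (hH.comp (measurable_nsq measurable_id)),
            ← mul_assoc, ← ENNReal.ofReal_mul
              (Finset.prod_nonneg fun k _ => inv_nonneg.2 (pow_nonneg (Real.sqrt_nonneg _) _)),
            Fin.prod_univ_castSucc]
          simp only [nsq, Fin.sum_univ_castSucc, snc_castSucc, snc_last]
          rfl

end Haar

/-! ### The fibre over a fixed leading block. -/

/-- Coordinates on the purely imaginary elements. -/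
class ImCoord (K F : Type*) [NormedDivisionRing K] [NormedAlgebra ℝ K] [StarRing K] [ReField K]
    [MeasurableSpace K] [AddCommGroup F] [MeasurableSpace F] where
  emb : F →+ K
  im : K → F
  measurable_emb : Measurable emb
  re_emb : ∀ f, re (emb f) = 0
  re_add_im : ∀ x : K, algebraMap ℝ K (re x) + emb (im x) = x

section Fibre

variable {K : Type*} [NormedDivisionRing K] [NormedAlgebra ℝ K] [StarRing K] [ReField K]
variable [MeasureSpace K] [BorelSpace K] [SecondCountableTopology K] [FiniteDimensional ℝ K]
variable [(volume : Measure K).IsAddHaarMeasure]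
variable {F : Type*} [AddCommGroup F] [MeasureSpace F] [MeasurableAdd₂ F] [ImCoord K F]
variable [SigmaFinite (volume : Measure F)] [(volume : Measure F).IsAddLeftInvariant]
variable {p r : ℕ}

lemma nsq_star {n : ℕ} (x : Fin n → K) : nsq (star x) = nsq x := by
  simp [nsq, norm_star_eq]

lemma nsq_sub {n : ℕ} (x y : Fin n → K) :
    nsq (x - y) = nsq x - 2 * re (star x ⬝ᵥ y) + nsq y := by
  simp only [← re_star_dot_self, star_sub, sub_dotProduct, dotProduct_sub, map_sub]
  rw [re_dot_comm y x]
  ring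

lemma re_skew {N : Matrix (Fin p) (Fin p) K} (hN : Nᴴ = -N) (y : Fin p → K) :
    re (star y ⬝ᵥ N *ᵥ y) = 0 := by
  have h : re (star y ⬝ᵥ N *ᵥ y) = - re (star y ⬝ᵥ N *ᵥ y) := by
    conv_lhs => rw [re_dot_comm, star_mulVec, hN, ← dotProduct_mulVec, neg_mulVec,
      dotProduct_neg, map_neg]
  linarith

lemma qf_mul_conjTranspose (L : Matrix (Fin p) (Fin r) K) (y : Fin p → K) :
    qf (L * Lᴴ) y = nsq (Lᴴ *ᵥ y) := by
  rw [qf, ← re_star_dot_self, star_mulVec, conjTranspose_conjTranspose, ← mulVec_mulVec,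
    dotProduct_mulVec]

/-- Completion of the square in the Schur complement of `1 + M + N`. -/
lemma re_schur_eq {T N : Matrix (Fin p) (Fin p) K} {L : Matrix (Fin p) (Fin r) K}
    (hT : T.IsHermitian) (hN : Nᴴ = -N) {m n x y : Fin p → K} {l : Fin r → K}
    (hx : T *ᵥ x = m - L *ᵥ star l) (hy : (1 + (T + L * Lᴴ) + N) *ᵥ y = m + n) :
    (nsq l + re (star (m - L *ᵥ star l) ⬝ᵥ x)) - re ((star m - star n) ⬝ᵥ y) =
      nsq y + nsq (star l - Lᴴ *ᵥ y) + qf T (x - y) := by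
  have hm : m = T *ᵥ x + L *ᵥ star l := by rw [hx]; abel
  -- The hypotheses control only `m` and `m + n`, so the row `m* - n*` is expressed through these
  -- two.
  have hn : star m - star n = (2 : ℕ) • star m - star (m + n) := by rw [star_add]; abel
  have h1 : re (star (m + n) ⬝ᵥ y) = nsq y + (qf T y + nsq (Lᴴ *ᵥ y)) := by
    rw [← hy, re_dot_comm, add_mulVec, add_mulVec, add_mulVec, one_mulVec]
    simp only [dotProduct_add, map_add, re_skew hN, re_star_dot_self]
    rw [← qf_mul_conjTranspose]
    simp [qf]
  have h2 : re (star m ⬝ᵥ y) = re (star x ⬝ᵥ T *ᵥ y) + re (star (star l) ⬝ᵥ Lᴴ *ᵥ y) := by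
    rw [hm, star_add, add_dotProduct, map_add, hT.star_dot_mulVec, star_mulVec,
      ← dotProduct_mulVec]
  rw [← hx, hn, sub_dotProduct, smul_dotProduct, map_sub, map_nsmul, h1, h2, qf_sub hT, nsq_sub,
    nsq_star, hT.star_dot_mulVec]
  simp only [qf, nsmul_eq_mul, Nat.cast_ofNat]
  ring

/-- The order of integration serves `lintegral_last`: with components μ, m, v, n, l, the inner
variables μ and v are removed by translations before n and m are substituted. -/
lemma lintegral_five {A B C D E : Type*} [MeasureSpace A] [MeasureSpace B] [MeasureSpace C]
    [MeasureSpace D] [MeasureSpace E] [SigmaFinite (volume : Measure A)]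
    [SigmaFinite (volume : Measure B)] [SigmaFinite (volume : Measure C)]
    [SigmaFinite (volume : Measure D)] [SigmaFinite (volume : Measure E)]
    {f : A × B × C × D × E → ℝ≥0∞} (hf : Measurable f) :
    ∫⁻ z, f z = ∫⁻ b, ∫⁻ d, ∫⁻ e, ∫⁻ c, ∫⁻ a, f (a, b, c, d, e) := by
  rw [Measure.volume_eq_prod, lintegral_prod_symm _ hf.aemeasurable]
  have h1 : Measurable fun y => ∫⁻ a, f (a, y) := hf.lintegral_prod_left'
  rw [Measure.volume_eq_prod, lintegral_prod _ h1.aemeasurable]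
  refine lintegral_congr fun b => ?_
  have h2 : Measurable fun y => ∫⁻ a, f (a, b, y) := h1.comp measurable_prodMk_left
  rw [Measure.volume_eq_prod, lintegral_prod_symm _ h2.aemeasurable]
  have h3 : Measurable fun y => ∫⁻ c, ∫⁻ a, f (a, b, c, y) := h2.lintegral_prod_left'
  rw [Measure.volume_eq_prod, lintegral_prod _ h3.aemeasurable]

/-- The parameters of the last pivots of `M - L L*` and `1 + M + N`. -/
def modelMap (K F : Type*) [NormedDivisionRing K] [NormedAlgebra ℝ K] [StarRing K] [ReField K]
    [MeasurableSpace K] [AddCommGroup F] [MeasurableSpace F] [ImCoord K F] (p r : ℕ)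
    (w : (Fin p → K) × (Fin r → K) × (Fin p → K) × F × ℝ) : ℝ × K :=
  (w.2.2.2.2, algebraMap ℝ K (1 + w.2.2.2.2 + (nsq w.1 + nsq w.2.1 + nsq w.2.2.1)) +
    ImCoord.emb w.2.2.2.1)

lemma measurable_algebraMap : Measurable (algebraMap ℝ K) :=
  (continuous_algebraMap ℝ K).measurable

lemma measurable_modelMap : Measurable (modelMap K F p r) := by
  have h1 := measurable_algebraMap (K := K)
  have h2 := ImCoord.measurable_emb (K := K) (F := F)
  refine Measurable.prodMk (by fun_prop) (.add (h1.comp ?_) (h2.comp (by fun_prop)))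
  exact .add (by fun_prop) (.add (.add (measurable_nsq (by fun_prop))
    (measurable_nsq (by fun_prop))) (measurable_nsq (by fun_prop)))

/-- The distribution of the last pivots of `M - L L*` and `1 + M + N`, up to a factor. -/
def model (K F : Type*) [NormedDivisionRing K] [NormedAlgebra ℝ K] [StarRing K] [ReField K]
    [MeasureSpace K] [AddCommGroup F] [MeasureSpace F] [ImCoord K F] (p r : ℕ) :
    Measure (ℝ × K) :=
  Measure.map (modelMap K F p r) volume

instance : SFinite (model K F p r) := by
  have h1 : SFinite (volume : Measure (F × ℝ)) := by
    rw [Measure.volume_eq_prod]; infer_instance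
  have h2 : SFinite (volume : Measure ((Fin p → K) × F × ℝ)) := by
    rw [Measure.volume_eq_prod]; infer_instance
  have h3 : SFinite (volume : Measure ((Fin r → K) × (Fin p → K) × F × ℝ)) := by
    rw [Measure.volume_eq_prod]; infer_instance
  have h4 : SFinite (volume : Measure ((Fin p → K) × (Fin r → K) × (Fin p → K) × F × ℝ)) := by
    rw [Measure.volume_eq_prod]; infer_instance
  unfold model
  infer_instance

lemma lintegral_model {h : ℝ × K → ℝ≥0∞} (hh : Measurable h) :
    ∫⁻ w, h w ∂(model K F p r) = ∫⁻ y : Fin p → K, ∫⁻ l : Fin r → K, ∫⁻ x : Fin p → K,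
      ∫⁻ v : F, ∫⁻ ρ : ℝ, h (ρ, algebraMap ℝ K (1 + ρ + (nsq y + nsq l + nsq x)) +
        ImCoord.emb v) := by
  have h0 : Measurable fun w => h (modelMap K F p r w) := hh.comp measurable_modelMap
  rw [model, lintegral_map hh measurable_modelMap, Measure.volume_eq_prod,
    lintegral_prod _ h0.aemeasurable]
  refine lintegral_congr fun y => ?_
  have h1 : Measurable fun w => h (modelMap K F p r (y, w)) := h0.comp measurable_prodMk_left
  rw [Measure.volume_eq_prod, lintegral_prod _ h1.aemeasurable]
  refine lintegral_congr fun l => ?_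
  have h2 : Measurable fun w => h (modelMap K F p r (y, l, w)) :=
    h1.comp measurable_prodMk_left
  rw [Measure.volume_eq_prod, lintegral_prod _ h2.aemeasurable]
  refine lintegral_congr fun x => ?_
  have h3 : Measurable fun w => h (modelMap K F p r (y, l, x, w)) :=
    h2.comp measurable_prodMk_left
  rw [Measure.volume_eq_prod, lintegral_prod _ h3.aemeasurable]
  rfl

/-- The last pivot of `M - L L*` in terms of the last rows and columns. -/
def lastRho (T : Matrix (Fin p) (Fin p) K) (L : Matrix (Fin p) (Fin r) K)
    (z : ℝ × (Fin p → K) × F × (Fin p → K) × (Fin r → K)) : ℝ :=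
  z.1 - (nsq z.2.2.2.2 + re (star (z.2.1 - L *ᵥ star z.2.2.2.2) ⬝ᵥ
    solve p T (z.2.1 - L *ᵥ star z.2.2.2.2)))

/-- The last pivot of `1 + M + N` in terms of the last rows and columns. -/
def lastS (R : Matrix (Fin p) (Fin p) K)
    (z : ℝ × (Fin p → K) × F × (Fin p → K) × (Fin r → K)) : K :=
  1 + algebraMap ℝ K z.1 + ImCoord.emb z.2.2.1 -
    (star z.2.1 - star z.2.2.2.1) ⬝ᵥ solve p R (z.2.1 + z.2.2.2.1)

lemma measurable_lastRho (T : Matrix (Fin p) (Fin p) K) (L : Matrix (Fin p) (Fin r) K) :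
    Measurable (lastRho (F := F) T L) := by
  have ht : Measurable fun z : ℝ × (Fin p → K) × F × (Fin p → K) × (Fin r → K) =>
      z.2.1 - L *ᵥ star z.2.2.2.2 :=
    .sub (by fun_prop) (measurable_mulVec (fun _ _ => measurable_const)
      (measurable_star_pi (by fun_prop)))
  exact .sub measurable_fst (.add (measurable_nsq (by fun_prop)) (measurable_re.comp
    (measurable_dotProduct (measurable_star_pi ht)
      (measurable_solve (fun _ _ => measurable_const) ht))))

lemma measurable_lastS (R : Matrix (Fin p) (Fin p) K) :
    Measurable (lastS (F := F) (r := r) R) := by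
  have h1 := measurable_algebraMap (K := K)
  have h2 := ImCoord.measurable_emb (K := K) (F := F)
  refine .sub (.add (.add measurable_const (h1.comp (by fun_prop))) (h2.comp (by fun_prop)))
    (measurable_dotProduct (.sub (measurable_star_pi (by fun_prop))
      (measurable_star_pi (by fun_prop))) (measurable_solve (fun _ _ => measurable_const) ?_))
  fun_prop

variable (K) in
/-- The density of the pivots of the left upper block. -/
def weight (w : ℝ × K) : ℝ := (Real.sqrt w.1 * ‖w.2‖) ^ Module.finrank ℝ K

lemma piv_eq_re {T : Matrix (Fin p) (Fin p) K} (hT : T.IsHermitian) (hd : Diss T) (k : Fin p) :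
    piv T k = algebraMap ℝ K (re (piv T k)) := by
  induction p with
  | zero => exact k.elim0
  | succ p ih =>
    refine Fin.lastCases ?_ (fun k => ?_) k
    · exact eq_algebraMap_re (hT.star_schur hd.minor)
    · exact ih hT.minor hd.minor k

/-- The form of `N` has no real part, and `1` and `L L*` only add nonnegative terms to the form of
`T`. -/
lemma diss_of_hermitian {T N : Matrix (Fin p) (Fin p) K} (L : Matrix (Fin p) (Fin r) K)
    (hd : Diss T) (hN : Nᴴ = -N) :
    Diss (1 + (T + L * Lᴴ) + N) := by
  intro y hy
  have h1 := hd y hy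
  have h2 := qf_mul_conjTranspose L y
  have h3 : 0 ≤ nsq (Lᴴ *ᵥ y) := Finset.sum_nonneg fun _ _ => by positivity
  have h4 : 0 ≤ nsq y := Finset.sum_nonneg fun _ _ => by positivity
  have h5 := re_skew hN y
  simp only [qf] at h1 h2 ⊢
  simp only [add_mulVec, one_mulVec, dotProduct_add, map_add, h5, h2, re_star_dot_self]
  linarith

/-- Integration over the last row and column. -/
theorem lintegral_last {T N : Matrix (Fin p) (Fin p) K} {L : Matrix (Fin p) (Fin r) K}
    (hT : T.IsHermitian) (hd : Diss T) (hN : Nᴴ = -N) {h : ℝ × K → ℝ≥0∞} (hh : Measurable h) :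
    ∫⁻ z, h (lastRho (F := F) T L z, lastS (1 + (T + L * Lᴴ) + N) z) =
      ENNReal.ofReal (∏ k, weight K (re (piv T k), piv (1 + (T + L * Lᴴ) + N) k)) *
        ∫⁻ w, h w ∂(model K F p r) := by
  set R := 1 + (T + L * Lᴴ) + N with hR
  have hdR : Diss R := diss_of_hermitian L hd hN
  have hma := measurable_algebraMap (K := K)
  have hme := ImCoord.measurable_emb (K := K) (F := F)
  have hmT : Measurable (solve p T) :=
    measurable_solve (fun _ _ => measurable_const) measurable_id
  have hmR : Measurable (solve p R) :=
    measurable_solve (fun _ _ => measurable_const) measurable_id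
  have hmL : Measurable fun l : Fin r → K => L *ᵥ star l :=
    measurable_mulVec (fun _ _ => measurable_const) (measurable_star_pi measurable_id)
  have hmq : Measurable (qf T) := measurable_qf T measurable_id
  have hmn : ∀ n, Measurable (nsq : (Fin n → K) → ℝ) := fun n => measurable_nsq measurable_id
  have hms : ∀ n, Measurable (star : (Fin n → K) → (Fin n → K)) := fun n =>
    measurable_star_pi measurable_id
  -- `H q` is what remains of `h` after integration over ρ and the imaginary part, when the last
  -- pivot of `R` has real part `1 + ρ + q`.
  obtain ⟨H, hH⟩ : ∃ H : ℝ → ℝ≥0∞, ∀ q, H q = ∫⁻ v : F, ∫⁻ ρ : ℝ,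
    h (ρ, algebraMap ℝ K (1 + ρ + q) + ImCoord.emb v) := ⟨_, fun _ => rfl⟩
  have hHm : Measurable H := by
    rw [funext hH]
    have h3 : Measurable fun w : (ℝ × F) × ℝ =>
        h (w.2, algebraMap ℝ K (1 + w.2 + w.1.1) + ImCoord.emb w.1.2) := by fun_prop
    have h4 : Measurable fun w : ℝ × F => ∫⁻ ρ : ℝ,
        h (ρ, algebraMap ℝ K (1 + ρ + w.1) + ImCoord.emb w.2) := h3.lintegral_prod_right'
    exact h4.lintegral_prod_right'
  -- The sum of squares provided by `re_schur_eq`.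
  obtain ⟨Q, hQ⟩ : ∃ Q : (Fin p → K) → (Fin r → K) → (Fin p → K) → ℝ, ∀ y l x, Q y l x =
    nsq y + nsq (star l - Lᴴ *ᵥ y) + qf T (x - y) := ⟨_, fun _ _ _ => rfl⟩
  have hmLy : Measurable fun y : Fin p → K => Lᴴ *ᵥ y :=
    measurable_mulVec (fun _ _ => measurable_const) measurable_id
  have hQm : Measurable fun w : (Fin p → K) × (Fin r → K) × (Fin p → K) =>
      H (Q w.1 w.2.1 w.2.2) := by
    simp only [hQ]
    refine hHm.comp (.add (.add (measurable_nsq (by fun_prop)) (measurable_nsq ?_))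
      (measurable_qf _ (by fun_prop)))
    exact .sub (measurable_star_pi (by fun_prop)) (hmLy.comp (by fun_prop))
  have step1 : ∀ m n l, ∫⁻ v : F, ∫⁻ μ : ℝ, h (lastRho T L (μ, m, v, n, l),
      lastS R (μ, m, v, n, l)) = H (Q (solve p R (m + n)) l (solve p T (m - L *ᵥ star l))) := by
    intro m n l
    set A := nsq l + re (star (m - L *ᵥ star l) ⬝ᵥ solve p T (m - L *ᵥ star l)) with hA
    set c := (star m - star n) ⬝ᵥ solve p R (m + n) with hc
    have hAB : A - re c = Q (solve p R (m + n)) l (solve p T (m - L *ᵥ star l)) := by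
      rw [hQ]
      exact re_schur_eq hT hN (hd.mulVec_solve _) (hdR.mulVec_solve _)
    rw [← hAB, hH]
    symm
    -- Translating `v` absorbs the imaginary part of `c`, and translating `μ` absorbs `A`; what
    -- survives is `A - re c`.
    rw [← lintegral_add_right_eq_self _ (ImCoord.im (F := F) (-c))]
    refine lintegral_congr fun v => ?_
    rw [← lintegral_sub_right_eq_self _ A]
    refine lintegral_congr fun μ => ?_
    congr 1
    refine Prod.ext (by simp only [lastRho, hA]) ?_
    have h6 := ImCoord.re_add_im (F := F) (-c)
    generalize ImCoord.im (F := F) (-c) = j at h6 ⊢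
    simp only [lastS]
    rw [map_add (ImCoord.emb : F →+ K), sub_eq_add_neg _ ((star m - star n) ⬝ᵥ _), ← hc,
      ← h6, map_neg re]
    rw [show 1 + (μ - A) + (A - re c) = 1 + μ + - re c by ring]
    simp only [map_add, map_one]
    abel
  have hG : Measurable fun w : (Fin p → K) × (Fin p → K) =>
      ∫⁻ l : Fin r → K, H (Q w.2 l (solve p T (w.1 - L *ᵥ star l))) := by
    have : Measurable fun w : ((Fin p → K) × (Fin p → K)) × (Fin r → K) =>
        H (Q w.1.2 w.2 (solve p T (w.1.1 - L *ᵥ star w.2))) := by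
      have h8 : Measurable fun w : ((Fin p → K) × (Fin p → K)) × (Fin r → K) =>
          solve p T (w.1.1 - L *ᵥ star w.2) :=
        hmT.comp (.sub (by fun_prop) (hmL.comp measurable_snd))
      exact hQm.comp (.prodMk (measurable_snd.comp measurable_fst) (.prodMk measurable_snd h8))
    exact this.lintegral_prod_right'
  have hpT : ∀ k, ‖piv T k‖ = re (piv T k) := fun k => by
    rw [piv_eq_re hT hd k, norm_algebraMap', re_algebraMap,
      Real.norm_of_nonneg (hd.re_piv_pos k).le]
  calc ∫⁻ z, h (lastRho (F := F) T L z, lastS R z)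
      = ∫⁻ m, ∫⁻ n, ∫⁻ l, H (Q (solve p R (m + n)) l (solve p T (m - L *ᵥ star l))) := by
        rw [lintegral_five (f := fun z => h (lastRho (F := F) T L z, lastS R z)) (hh.comp ((measurable_lastRho T L).prodMk (measurable_lastS R)))]
        simp only [step1]
    _ = ∫⁻ m, ENNReal.ofReal (∏ k, ‖piv R k‖ ^ Module.finrank ℝ K) *
          ∫⁻ y, ∫⁻ l, H (Q y l (solve p T (m - L *ᵥ star l))) := by
        refine lintegral_congr fun m => ?_
        have h7 : Measurable fun y =>
            ∫⁻ l : Fin r → K, H (Q y l (solve p T (m - L *ᵥ star l))) :=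
          hG.comp (measurable_prodMk_left (x := m))
        -- For fixed `m` the variable `m + n` is a translate of `n`; passing to `y = R⁻¹(m + n)`
        -- then produces the pivots of `R`.
        rw [lintegral_add_left_eq_self (fun n =>
          ∫⁻ l, H (Q (solve p R n) l (solve p T (m - L *ᵥ star l)))) m,
          ← lintegral_solve hdR h7]
    _ = ENNReal.ofReal (∏ k, ‖piv R k‖ ^ Module.finrank ℝ K) *
          ∫⁻ y, ∫⁻ l, ∫⁻ m, H (Q y l (solve p T (m - L *ᵥ star l))) := by
        rw [lintegral_const_mul' _ _ ENNReal.ofReal_ne_top,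
          lintegral_lintegral_swap hG.aemeasurable]
        congr 1
        refine lintegral_congr fun y => ?_
        rw [lintegral_lintegral_swap]
        refine Measurable.aemeasurable ?_
        exact hQm.comp (.prodMk measurable_const (.prodMk (by fun_prop) (hmT.comp
          (.sub (by fun_prop) (hmL.comp measurable_snd)))))
    _ = ENNReal.ofReal (∏ k, ‖piv R k‖ ^ Module.finrank ℝ K) *
          ∫⁻ y, ∫⁻ l, ENNReal.ofReal (∏ k, ‖piv T k‖ ^ Module.finrank ℝ K) *
            (ENNReal.ofReal (∏ k, (Real.sqrt (re (piv T k)) ^ Module.finrank ℝ K)⁻¹) *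
            ∫⁻ x : Fin p → K, H (nsq y + nsq (star l - Lᴴ *ᵥ y) + nsq x)) := by
        congr 1
        refine lintegral_congr fun y => lintegral_congr fun l => ?_
        rw [lintegral_sub_right_eq_self (fun m => H (Q y l (solve p T m))),
          lintegral_solve hd (h := fun x => H (Q y l x))]
        · congr 1
          rw [← lintegral_qf hT hd (H := fun q => H (nsq y + nsq (star l - Lᴴ *ᵥ y) + q))
            (by fun_prop)]
          simp only [hQ]
          exact lintegral_sub_right_eq_self (fun x =>
            H (nsq y + nsq (star l - Lᴴ *ᵥ y) + qf T x)) y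
        · exact hQm.comp (.prodMk measurable_const (.prodMk measurable_const measurable_id))
    _ = ENNReal.ofReal (∏ k, ‖piv R k‖ ^ Module.finrank ℝ K) *
          (ENNReal.ofReal (∏ k, ‖piv T k‖ ^ Module.finrank ℝ K) *
            (ENNReal.ofReal (∏ k, (Real.sqrt (re (piv T k)) ^ Module.finrank ℝ K)⁻¹) *
            ∫⁻ y : Fin p → K, ∫⁻ l : Fin r → K, ∫⁻ x : Fin p → K,
              H (nsq y + nsq l + nsq x))) := by
        simp only [lintegral_const_mul' _ _ ENNReal.ofReal_ne_top]
        congr 3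
        refine lintegral_congr fun y => ?_
        -- For fixed `y` the vector `L* y` is a mere shift of `l`.
        rw [← lintegral_sub_right_eq_self (μ := volume)
          (fun l : Fin r → K => ∫⁻ x, H (nsq y + nsq l + nsq x)) (star (Lᴴ *ᵥ y))]
        refine lintegral_congr fun l => ?_
        rw [← nsq_star (l - _), star_sub, star_star]
    _ = _ := by
        simp only [hH]
        rw [lintegral_model hh, ← mul_assoc, ← mul_assoc]
        congr 1
        rw [← ENNReal.ofReal_mul (by positivity), ← ENNReal.ofReal_mul (by positivity),
          ← Finset.prod_mul_distrib, ← Finset.prod_mul_distrib]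
        congr 1
        -- The substitution for `m` contributes `ρ^d` and the reduction of the form of `T`
        -- contributes `ρ^(-d/2)`; their product is `(√ρ)^d`.
        refine Finset.prod_congr rfl fun k _ => ?_
        have h8 := hd.re_piv_pos k
        have h9 := Real.sqrt_pos.2 h8
        rw [hpT, weight, ← inv_pow, ← mul_pow, ← mul_pow]
        congr 1
        simp only
        have h10 := Real.mul_self_sqrt h8.le
        field_simp
        rw [Real.sq_sqrt h8.le]

end Fibre

/-! ### Integrals together with convergence -/

/-- The integral of `f` converges absolutely and equals `I`. -/
def HasInt {α : Type*} [MeasurableSpace α] (f : α → ℂ) (μ : Measure α) (I : ℂ) : Prop :=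
  Integrable f μ ∧ ∫ x, f x ∂μ = I

lemma hasInt_comp {α β : Type*} [MeasurableSpace α] [MeasurableSpace β] {μ : Measure α}
    {ν : Measure β} {φ : α → β} (hφ : MeasurePreserving φ μ ν) {f : β → ℂ}
    (hf : AEStronglyMeasurable f ν) {I : ℂ} :
    HasInt (fun x => f (φ x)) μ I ↔ HasInt f ν I := by
  have h1 := hφ.integrable_comp hf
  have h2 : ∫ x, f x ∂ν = ∫ x, f (φ x) ∂μ := by
    rw [← hφ.map_eq] at hf ⊢
    exact integral_map hφ.measurable.aemeasurable hf
  unfold HasInt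
  rw [h2, ← h1]
  rfl

lemma hasInt_congr {α : Type*} [MeasurableSpace α] {μ : Measure α} {f g : α → ℂ}
    (h : ∀ x, f x = g x) {I : ℂ} : HasInt f μ I ↔ HasInt g μ I := by
  rw [funext h]

/-- This moves the positivity conditions between the domain and the integrand, so that the induction
can run over whole coordinate spaces. -/
lemma hasInt_restrict {α : Type*} [MeasurableSpace α] {μ : Measure α} {f : α → ℂ} {D : Set α}
    (hf : ∀ x, x ∉ D → f x = 0) {I : ℂ} : HasInt f (μ.restrict D) I ↔ HasInt f μ I := by
  have h1 : IntegrableOn f D μ ↔ Integrable f μ :=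
    integrableOn_iff_integrable_of_support_subset fun x hx => by
      by_contra h
      exact hx (hf x h)
  unfold HasInt
  rw [setIntegral_eq_integral_of_forall_compl_eq_zero hf]
  exact and_congr_left fun _ => h1

/-- Integration over the fibres of a projection on which the measure is a multiple of a fixed
measure. -/
lemma hasInt_fibre {X Z W : Type*} [MeasurableSpace X] [MeasurableSpace Z] [MeasurableSpace W]
    {μ : Measure X} {ν : Measure Z} {κ : Measure W} [SigmaFinite μ] [SigmaFinite ν] [SFinite κ]
    {ψ : X × Z → W} (hψ : Measurable ψ) {D : Set X} (hD : MeasurableSet D) {c : X → ℝ}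
    (hc : Measurable c) (hc0 : ∀ x, 0 ≤ c x)
    (H : ∀ x ∈ D, ∀ h : W → ℝ≥0∞, Measurable h →
      ∫⁻ z, h (ψ (x, z)) ∂ν = ENNReal.ofReal (c x) * ∫⁻ w, h w ∂κ)
    {G : X → ℂ} {h : W → ℂ} (hG : Measurable G) (hh : Measurable h)
    (hG0 : ∀ x, x ∉ D → G x = 0) {I J : ℂ} (hI : HasInt (fun x => G x * c x) μ I)
    (hJ : HasInt h κ J) :
    HasInt (fun w : X × Z => G w.1 * h (ψ w)) (μ.prod ν) (I * J) := by
  have hΦ : Measurable fun w : X × Z => (w.1, ψ w) := measurable_fst.prodMk hψ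
  have hco : Measurable fun x => ENNReal.ofReal (c x) := hc.ennreal_ofReal
  -- Applying `H` to indicators of sections shows that the image is a product measure with density
  -- `c` on the base. Hence the integral factors, although `ψ` depends on the base point.
  have hmap : Measure.map (fun w : X × Z => (w.1, ψ w)) ((μ.restrict D).prod ν) =
      ((μ.restrict D).withDensity fun x => ENNReal.ofReal (c x)).prod κ := by
    ext s hs
    rw [Measure.map_apply hΦ hs, Measure.prod_apply (hΦ hs), Measure.prod_apply hs,
      lintegral_withDensity_eq_lintegral_mul _ hco (measurable_measure_prodMk_left hs)]
    refine setLIntegral_congr_fun hD fun x hx => ?_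
    have hs' : MeasurableSet (Prod.mk x ⁻¹' s) := measurable_prodMk_left hs
    have h1 := H x hx ((Prod.mk x ⁻¹' s).indicator 1) (measurable_one.indicator hs')
    rw [lintegral_indicator_one hs'] at h1
    rw [Pi.mul_apply, ← h1, ← lintegral_indicator_one (measurable_prodMk_left (hΦ hs))]
    rfl
  have hI' := (hasInt_restrict (μ := μ) (f := fun x => G x * c x) (D := D) (I := I)
    fun x hx => by simp [hG0 x hx]).2 hI
  have hI'' : HasInt G ((μ.restrict D).withDensity fun x => ENNReal.ofReal (c x)) I := by
    have e : ∀ x, (ENNReal.ofReal (c x)).toReal • G x = G x * c x := fun x => by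
      rw [ENNReal.toReal_ofReal (hc0 x), Complex.real_smul, mul_comm]
    refine ⟨?_, ?_⟩
    · rw [integrable_withDensity_iff_integrable_smul' hco (by simp)]
      simpa only [e] using hI'.1
    · rw [integral_withDensity_eq_integral_toReal_smul hco (by simp)]
      simpa only [e] using hI'.2
  have hprod : HasInt (fun w : X × W => G w.1 * h w.2)
      (((μ.restrict D).withDensity fun x => ENNReal.ofReal (c x)).prod κ) (I * J) :=
    ⟨hI''.1.mul_prod hJ.1, by rw [integral_prod_mul, hI''.2, hJ.2]⟩
  have hmeas : Measurable fun w : X × W => G w.1 * h w.2 := by fun_prop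
  have h2 := (hasInt_comp ⟨hΦ, hmap⟩ hmeas.aestronglyMeasurable).2 hprod
  have h3 : (μ.restrict D).prod ν = (μ.prod ν).restrict (D ×ˢ Set.univ) := by
    rw [← Measure.prod_restrict, Measure.restrict_univ]
  rw [h3] at h2
  refine (hasInt_restrict fun w hw => ?_).1 h2
  have : w.1 ∉ D := fun h => hw ⟨h, trivial⟩
  simp [hG0 _ this]

/-! ### Measures on the coordinates -/

/-- The pairs `i < j` of indices with `j` not the last one, and those with `j` the last one. -/
def upperSplit (p : ℕ) : Upper p ⊕ Fin p ≃ Upper (p + 1) where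
  toFun := Sum.elim
    (fun ij => ⟨(ij.1.1.castSucc, ij.1.2.castSucc), Fin.castSucc_lt_castSucc_iff.2 ij.2⟩)
    (fun i => ⟨(i.castSucc, Fin.last p), Fin.castSucc_lt_last i⟩)
  invFun ij :=
    if h : ij.1.2 = Fin.last p then
      Sum.inr (ij.1.1.castPred (ne_of_lt (lt_of_lt_of_le ij.2 (Fin.le_last _))))
    else
      Sum.inl ⟨(ij.1.1.castPred (ne_of_lt (lt_of_lt_of_le ij.2 (Fin.le_last _))),
        ij.1.2.castPred h), by
          have := ij.2
          rw [Fin.lt_def] at this ⊢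
          simpa using this⟩
  left_inv x := by
    rcases x with ⟨⟨i, j⟩, h⟩ | i
    · simp [Fin.castSucc_ne_last]
    · simp
  right_inv x := by
    obtain ⟨⟨i, j⟩, h⟩ := x
    by_cases hj : j = Fin.last p
    · subst hj; simp
    · simp [hj]

/-- Append a last column to the entries above the diagonal. -/
def joinUpper {α : Type*} {p : ℕ} (o : Upper p → α) (v : Fin p → α) : Upper (p + 1) → α :=
  fun ij => Sum.elim o v ((upperSplit p).symm ij)

lemma joinUpper_castSucc {α : Type*} {p : ℕ} (o : Upper p → α) (v : Fin p → α) {i j : Fin p}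
    (h : i < j) (h' : i.castSucc < j.castSucc) :
    joinUpper o v ⟨(i.castSucc, j.castSucc), h'⟩ = o ⟨(i, j), h⟩ := by
  have : (⟨(i.castSucc, j.castSucc), h'⟩ : Upper (p + 1)) =
      upperSplit p (Sum.inl ⟨(i, j), h⟩) := rfl
  rw [joinUpper, this, Equiv.symm_apply_apply, Sum.elim_inl]

lemma joinUpper_last {α : Type*} {p : ℕ} (o : Upper p → α) (v : Fin p → α) (i : Fin p)
    (h : i.castSucc < Fin.last p) :
    joinUpper o v ⟨(i.castSucc, Fin.last p), h⟩ = v i := by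
  have : (⟨(i.castSucc, Fin.last p), h⟩ : Upper (p + 1)) = upperSplit p (Sum.inr i) := rfl
  rw [joinUpper, this, Equiv.symm_apply_apply, Sum.elim_inr]

lemma measurePreserving_joinUpper {α : Type*} [MeasureSpace α]
    [SigmaFinite (volume : Measure α)] (p : ℕ) :
    MeasurePreserving (fun z : (Upper p → α) × (Fin p → α) => joinUpper z.1 z.2) := by
  have h1 := volume_measurePreserving_sumPiEquivProdPi_symm
    (fun _ : Upper p ⊕ Fin p => α)
  have h2 := volume_measurePreserving_piCongrLeft (fun _ : Upper (p + 1) => α) (upperSplit p)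
  convert! h2.comp h1 using 1
  ext z ij
  obtain ⟨x, rfl⟩ := (upperSplit p).surjective ij
  simp only [Function.comp, MeasurableEquiv.coe_piCongrLeft, Equiv.piCongrLeft_apply_apply,
    joinUpper, Equiv.symm_apply_apply]
  rcases x with x | x <;> rfl

lemma measurePreserving_prodProdProdComm {α β γ δ : Type*} [MeasureSpace α] [MeasureSpace β]
    [MeasureSpace γ] [MeasureSpace δ] [SigmaFinite (volume : Measure α)]
    [SigmaFinite (volume : Measure β)] [SigmaFinite (volume : Measure γ)]
    [SigmaFinite (volume : Measure δ)] :
    MeasurePreserving (fun w : (α × β) × (γ × δ) => ((w.1.1, w.2.1), (w.1.2, w.2.2))) := by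
  have a1 : MeasurePreserving (fun w : (α × β) × (γ × δ) => (w.1.1, (w.1.2, (w.2.1, w.2.2)))) :=
    volume_preserving_prodAssoc (α₁ := α) (β₁ := β) (γ₁ := γ × δ)
  have a2 : MeasurePreserving (fun w : β × (γ × δ) => ((w.1, w.2.1), w.2.2)) :=
    (volume_preserving_prodAssoc (α₁ := β) (β₁ := γ) (γ₁ := δ)).symm
  have a3 : MeasurePreserving (Prod.swap : β × γ → γ × β) := Measure.measurePreserving_swap
  have a4 : MeasurePreserving (Prod.map Prod.swap id : (β × γ) × δ → (γ × β) × δ) :=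
    a3.prod (MeasurePreserving.id _)
  have a5 : MeasurePreserving (fun w : (γ × β) × δ => (w.1.1, (w.1.2, w.2))) :=
    volume_preserving_prodAssoc (α₁ := γ) (β₁ := β) (γ₁ := δ)
  have a6 : MeasurePreserving (Prod.map id ((fun w : (γ × β) × δ => (w.1.1, (w.1.2, w.2))) ∘
      (Prod.map Prod.swap id : (β × γ) × δ → (γ × β) × δ) ∘
      (fun w : β × (γ × δ) => ((w.1, w.2.1), w.2.2))) : α × _ → α × _) :=
    (MeasurePreserving.id _).prod (a5.comp (a4.comp a2))
  have a7 : MeasurePreserving (fun w : α × (γ × (β × δ)) => ((w.1, w.2.1), w.2.2)) :=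
    (volume_preserving_prodAssoc (α₁ := α) (β₁ := γ) (γ₁ := β × δ)).symm
  exact a7.comp (a6.comp a1)

/-- Iterated along a nested product, this joins the old and the new coordinates one component at a
time. -/
lemma measurePreserving_zip {α β γ δ A B : Type*} [MeasureSpace α] [MeasureSpace β]
    [MeasureSpace γ] [MeasureSpace δ] [MeasureSpace A] [MeasureSpace B]
    [SigmaFinite (volume : Measure α)]
    [SigmaFinite (volume : Measure β)] [SigmaFinite (volume : Measure γ)]
    [SigmaFinite (volume : Measure δ)] [SigmaFinite (volume : Measure A)]
    [SigmaFinite (volume : Measure B)] {f : α × γ → A} {g : β × δ → B}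
    (hf : MeasurePreserving f) (hg : MeasurePreserving g) :
    MeasurePreserving (fun w : (α × β) × (γ × δ) => (f (w.1.1, w.2.1), g (w.1.2, w.2.2))) :=
  (hf.prod hg).comp measurePreserving_prodProdProdComm

lemma sigmaFinite_prod_five {A B C D E : Type*} [MeasureSpace A] [MeasureSpace B]
    [MeasureSpace C] [MeasureSpace D] [MeasureSpace E] [SigmaFinite (volume : Measure A)]
    [SigmaFinite (volume : Measure B)] [SigmaFinite (volume : Measure C)]
    [SigmaFinite (volume : Measure D)] [SigmaFinite (volume : Measure E)] :
    SigmaFinite (volume : Measure (A × B × C × D × E)) := inferInstance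

/-! ### Induction over the number of rows -/

/-- The components are the diagonal and the above-diagonal entries of M, the imaginary coordinates
of the diagonal of N, the above-diagonal entries of N, and the rows of L; `r` stands for q - p. -/
abbrev Coord (K F : Type*) (p r : ℕ) : Type _ :=
  (Fin p → ℝ) × (Upper p → K) × (Fin p → F) × (Upper p → K) × (Fin p → Fin r → K)

/-- What one more row and column adds, in the same order: μ, m, ν, n, l. -/
abbrev LastCoord (K F : Type*) (p r : ℕ) : Type _ :=
  ℝ × (Fin p → K) × F × (Fin p → K) × (Fin r → K)

def joinCoord {K F : Type*} {p r : ℕ} (w : Coord K F p r × LastCoord K F p r) :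
    Coord K F (p + 1) r :=
  (snc w.1.1 w.2.1, joinUpper w.1.2.1 w.2.2.1, snc w.1.2.2.1 w.2.2.2.1,
    joinUpper w.1.2.2.2.1 w.2.2.2.2.1, snc w.1.2.2.2.2 w.2.2.2.2.2)

lemma measurePreserving_joinCoord (K F : Type*) [MeasureSpace K] [MeasureSpace F]
    [SigmaFinite (volume : Measure K)] [SigmaFinite (volume : Measure F)] (p r : ℕ) :
    MeasurePreserving (joinCoord : Coord K F p r × LastCoord K F p r → Coord K F (p + 1) r) :=
  measurePreserving_zip (measurePreserving_snc p) <|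
    measurePreserving_zip (measurePreserving_joinUpper p) <|
    measurePreserving_zip (measurePreserving_snc p) <|
    measurePreserving_zip (measurePreserving_joinUpper p) (measurePreserving_snc p)

/-! ### Pivots as functions of the coordinates, and the factorization of the integral. -/

section Coordinates

variable {K : Type*} [NormedDivisionRing K] [NormedAlgebra ℝ K] [StarRing K] [ReField K]
variable [MeasureSpace K] [BorelSpace K] [SecondCountableTopology K] [FiniteDimensional ℝ K]
variable [(volume : Measure K).IsAddHaarMeasure]
variable {F : Type*} [AddCommGroup F] [MeasureSpace F] [MeasurableAdd₂ F] [ImCoord K F]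
variable [SigmaFinite (volume : Measure F)] [(volume : Measure F).IsAddLeftInvariant]
variable {p r : ℕ}

def coordM (x : Coord K F p r) : Matrix (Fin p) (Fin p) K := herm x.1 x.2.1

def coordN (x : Coord K F p r) : Matrix (Fin p) (Fin p) K :=
  skew (fun i => ImCoord.emb (x.2.2.1 i)) x.2.2.2.1

def coordL (x : Coord K F p r) : Matrix (Fin p) (Fin r) K := Matrix.of x.2.2.2.2

def coordT (x : Coord K F p r) : Matrix (Fin p) (Fin p) K :=
  coordM x - coordL x * (coordL x)ᴴ

def coordR (x : Coord K F p r) : Matrix (Fin p) (Fin p) K := 1 + coordM x + coordN x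

lemma star_emb (f : F) : star (ImCoord.emb f : K) = -ImCoord.emb f := by
  have := add_star (ImCoord.emb f : K)
  rw [ImCoord.re_emb, mul_zero, map_zero] at this
  exact eq_neg_of_add_eq_zero_right this

lemma herm_isHermitian (d : Fin p → ℝ) (o : Upper p → K) : (herm d o).IsHermitian := by
  ext i j
  rcases lt_trichotomy i j with h | rfl | h
  · simp [herm, h, h.not_gt]
  · simp [herm, star_algebraMap]
  · simp [herm, h, h.not_gt]

lemma skew_conjTranspose {d : Fin p → K} (hd : ∀ i, star (d i) = -d i) (o : Upper p → K) :
    (skew d o)ᴴ = -skew d o := by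
  ext i j
  rcases lt_trichotomy i j with h | rfl | h
  · simp [skew, h, h.not_gt]
  · simp [skew, hd]
  · simp [skew, h, h.not_gt]

lemma coordT_isHermitian (x : Coord K F p r) : (coordT x).IsHermitian :=
  (herm_isHermitian _ _).sub (isHermitian_mul_conjTranspose_self _)

lemma coordN_conjTranspose (x : Coord K F p r) : (coordN x)ᴴ = -coordN x :=
  skew_conjTranspose (fun _ => star_emb _) _

lemma coordR_eq (x : Coord K F p r) :
    coordR x = 1 + (coordT x + coordL x * (coordL x)ᴴ) + coordN x := by
  rw [coordT, sub_add_cancel, coordR]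

lemma minor_coordT (x : Coord K F p r) (z : LastCoord K F p r) :
    minor (coordT (joinCoord (x, z))) = coordT x := by
  ext i j
  have h1 : coordM (joinCoord (x, z)) i.castSucc j.castSucc = coordM x i j := by
    rcases lt_trichotomy i j with h | rfl | h
    · simp [coordM, herm, joinCoord, h, joinUpper_castSucc _ _ h]
    · simp [coordM, herm, joinCoord]
    · simp [coordM, herm, joinCoord, h, h.not_gt, joinUpper_castSucc _ _ h]
  simp only [minor, coordT, submatrix_apply, Matrix.sub_apply, h1]
  congr 1
  simp [mul_apply, coordL, joinCoord]

lemma minor_coordR (x : Coord K F p r) (z : LastCoord K F p r) :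
    minor (coordR (joinCoord (x, z))) = coordR x := by
  ext i j
  have h0 : (1 : Matrix (Fin (p + 1)) (Fin (p + 1)) K) i.castSucc j.castSucc =
      (1 : Matrix (Fin p) (Fin p) K) i j := by
    simp [one_apply]
  rcases lt_trichotomy i j with h | rfl | h
  · simp [minor, coordR, h0, coordN, coordM, herm, skew, joinCoord, h, joinUpper_castSucc _ _ h]
  · simp [minor, coordR, coordN, coordM, herm, skew, joinCoord]
  · simp [minor, coordR, h0, coordN, coordM, herm, skew, joinCoord, h, h.not_gt,
      joinUpper_castSucc _ _ h]

lemma re_schur_coordT (x : Coord K F p r) (z : LastCoord K F p r) :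
    re (schur (coordT (joinCoord (x, z)))) = lastRho (coordT x) (coordL x) z := by
  have h1 : lastCol (coordT (joinCoord (x, z))) = z.2.1 - coordL x *ᵥ star z.2.2.2.2 := by
    ext i
    simp [lastCol, coordT, coordM, herm, joinCoord, joinUpper_last, mul_apply, coordL, mulVec,
      dotProduct]
  have h2 : coordT (joinCoord (x, z)) (Fin.last p) (Fin.last p) =
      algebraMap ℝ K z.1 - algebraMap ℝ K (nsq z.2.2.2.2) := by
    rw [← dot_star_self]
    simp [coordT, coordM, herm, joinCoord, mul_apply, coordL, dotProduct]
  rw [schur, (coordT_isHermitian _).lastRow_eq, minor_coordT, h1, h2, lastRho]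
  simp only [map_sub, re_algebraMap]
  ring

lemma schur_coordR (x : Coord K F p r) (z : LastCoord K F p r) :
    schur (coordR (joinCoord (x, z))) = lastS (coordR x) z := by
  have h0 : ∀ i : Fin p, (1 : Matrix (Fin (p + 1)) (Fin (p + 1)) K) i.castSucc (Fin.last p) = 0 :=
    fun i => one_apply_ne (Fin.castSucc_ne_last i)
  have h0' : ∀ i : Fin p, (1 : Matrix (Fin (p + 1)) (Fin (p + 1)) K) (Fin.last p) i.castSucc = 0 :=
    fun i => one_apply_ne (Fin.castSucc_ne_last i).symm
  have h1 : lastCol (coordR (joinCoord (x, z))) = z.2.1 + z.2.2.2.1 := by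
    ext i
    simp [lastCol, coordR, coordM, coordN, herm, skew, joinCoord, joinUpper_last, h0]
  have h3 : lastRow (coordR (joinCoord (x, z))) = star z.2.1 - star z.2.2.2.1 := by
    ext i
    have : ¬ Fin.last p < i.castSucc := (Fin.castSucc_lt_last i).not_gt
    simp [lastRow, coordR, coordM, coordN, herm, skew, joinCoord, joinUpper_last, h0', this,
      Fin.castSucc_lt_last, sub_eq_add_neg]
  have h2 : coordR (joinCoord (x, z)) (Fin.last p) (Fin.last p) =
      1 + algebraMap ℝ K z.1 + ImCoord.emb z.2.2.1 := by
    simp [coordR, coordM, coordN, herm, skew, joinCoord]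
  rw [schur, minor_coordR, h1, h2, h3, lastS]

lemma measurable_herm {α : Type*} [MeasurableSpace α] {d : α → Fin p → ℝ} {o : α → Upper p → K}
    (hd : Measurable d) (ho : Measurable o) (i j : Fin p) :
    Measurable fun a => herm (d a) (o a) i j := by
  simp only [herm, of_apply]
  split_ifs
  · fun_prop
  · exact measurable_star_of_reField.comp (by fun_prop)
  · exact measurable_algebraMap.comp (by fun_prop)

lemma measurable_skew {α : Type*} [MeasurableSpace α] {d : α → Fin p → K} {o : α → Upper p → K}
    (hd : Measurable d) (ho : Measurable o) (i j : Fin p) :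
    Measurable fun a => skew (d a) (o a) i j := by
  simp only [skew, of_apply]
  split_ifs
  · fun_prop
  · exact (measurable_star_of_reField.comp (by fun_prop)).neg
  · fun_prop

lemma measurable_coordT (i j : Fin p) : Measurable fun x : Coord K F p r => coordT x i j := by
  simp only [coordT, Matrix.sub_apply, mul_apply]
  refine .sub (measurable_herm (by fun_prop) (by fun_prop) _ _)
    (Finset.measurable_sum _ fun k _ => .mul ?_ (measurable_star_of_reField.comp ?_))
  · simp only [coordL, of_apply]; fun_prop
  · simp only [coordL, transpose_apply, of_apply]; fun_prop

lemma measurable_coordR (i j : Fin p) : Measurable fun x : Coord K F p r => coordR x i j := by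
  simp only [coordR, Matrix.add_apply]
  refine .add (.add measurable_const (measurable_herm (by fun_prop) (by fun_prop) _ _))
    (measurable_skew (measurable_pi_iff.2 fun k => ?_) (by fun_prop) _ _)
  exact ImCoord.measurable_emb.comp (by fun_prop)

/-- The pivots of `M - L L*` and `1 + M + N`. -/
def pivots (x : Coord K F p r) (k : Fin p) : ℝ × K := (re (piv (coordT x) k), piv (coordR x) k)

lemma measurable_pivots (k : Fin p) : Measurable fun x : Coord K F p r => pivots x k :=
  (measurable_re.comp (measurable_piv measurable_coordT k)).prodMk
    (measurable_piv measurable_coordR k)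

lemma pivots_joinCoord_castSucc (w : Coord K F p r × LastCoord K F p r) (k : Fin p) :
    pivots (joinCoord w) k.castSucc = pivots w.1 k := by
  obtain ⟨x, z⟩ := w
  rw [pivots, piv_castSucc, piv_castSucc, minor_coordT, minor_coordR, pivots]

lemma pivots_joinCoord_last (w : Coord K F p r × LastCoord K F p r) :
    pivots (joinCoord w) (Fin.last p) =
      (lastRho (coordT w.1) (coordL w.1) w.2, lastS (coordR w.1) w.2) := by
  obtain ⟨x, z⟩ := w
  rw [pivots, piv_last, piv_last, re_schur_coordT, schur_coordR]

lemma measurable_weight : Measurable (weight K) := by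
  unfold weight
  fun_prop

lemma weight_nonneg (w : ℝ × K) : 0 ≤ weight K w := by unfold weight; positivity

/-- A product of functions of the pivots is integrated factor by factor. -/
theorem hasInt_prod_pivots (g : Fin p → ℝ × K → ℂ) (hg : ∀ k, Measurable (g k))
    (h0 : ∀ k w, w.1 ≤ 0 → g k w = 0) (J : Fin p → ℂ)
    (hJ : ∀ k, HasInt (fun w => g k w * (weight K w : ℂ) ^ (p - 1 - k.val)) (model K F k r)
      (J k)) :
    HasInt (fun x : Coord K F p r => ∏ k, g k (pivots x k)) volume (∏ k, J k) := by
  induction p with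
  | zero =>
    -- Without rows every coordinate space is a point of mass one, and the integral of the empty
    -- product is 1.
    have : IsProbabilityMeasure (volume : Measure (Fin 0 → ℝ)) := by
      rw [volume_pi, Measure.pi_of_empty]; infer_instance
    have : IsProbabilityMeasure (volume : Measure (Upper 0 → K)) := by
      rw [volume_pi, Measure.pi_of_empty]; infer_instance
    have : IsProbabilityMeasure (volume : Measure (Fin 0 → F)) := by
      rw [volume_pi, Measure.pi_of_empty]; infer_instance
    have : IsProbabilityMeasure (volume : Measure (Fin 0 → Fin r → K)) := by
      rw [volume_pi, Measure.pi_of_empty]; infer_instance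
    have : IsProbabilityMeasure (volume : Measure (Coord K F 0 r)) := by
      simp only [Measure.volume_eq_prod]; infer_instance
    simp [HasInt]
  | succ p ih =>
    have hmeas : Measurable fun x : Coord K F (p + 1) r => ∏ k, g k (pivots x k) :=
      Finset.measurable_prod _ fun k _ => (hg k).comp (measurable_pivots k)
    rw [← hasInt_comp (measurePreserving_joinCoord K F p r) hmeas.aestronglyMeasurable]
    simp only [Fin.prod_univ_castSucc, pivots_joinCoord_castSucc, pivots_joinCoord_last]
    rw [Measure.volume_eq_prod]
    -- Integrating out the last row leaves one factor `weight` at every earlier pivot, which is put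
    -- into the functions of the inductive hypothesis. In total pivot `k` receives one such factor
    -- from each of the `p - 1 - k` later rows.
    have hIH := ih (fun k w => g k.castSucc w * weight K w)
      (fun k => (hg _).mul (Complex.measurable_ofReal.comp measurable_weight))
      (fun k w hw => by rw [h0 _ _ hw, zero_mul]) (fun k => J k.castSucc) (fun k => by
        refine (hasInt_congr fun w => ?_).1 (hJ k.castSucc)
        have : p + 1 - 1 - (k.castSucc : Fin (p + 1)).val = (p - 1 - k.val) + 1 := by
          have := k.isLt
          simp only [Fin.val_castSucc]
          omega
        rw [this, pow_succ]
        ring)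
    have hlast : HasInt (g (Fin.last p)) (model K F p r) (J (Fin.last p)) := by
      refine (hasInt_congr fun w => ?_).1 (hJ (Fin.last p))
      simp
    have hψ : Measurable fun w : Coord K F p r × LastCoord K F p r =>
        (lastRho (coordT w.1) (coordL w.1) w.2, lastS (coordR w.1) w.2) := by
      have := (measurable_pivots (K := K) (F := F) (r := r) (Fin.last p)).comp
        (measurePreserving_joinCoord K F p r).measurable
      simpa only [Function.comp_def, pivots_joinCoord_last] using this
    have hG : Measurable fun x : Coord K F p r => ∏ k : Fin p, g k.castSucc (pivots x k) :=
      Finset.measurable_prod _ fun k _ => (hg _).comp (measurable_pivots k)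
    have hc : Measurable fun x : Coord K F p r => ∏ k : Fin p, weight K (pivots x k) :=
      Finset.measurable_prod _ fun k _ => measurable_weight.comp (measurable_pivots k)
    have : SigmaFinite (volume : Measure (Coord K F p r)) := sigmaFinite_prod_five
    have : SigmaFinite (volume : Measure (LastCoord K F p r)) := sigmaFinite_prod_five
    refine hasInt_fibre (D := {x : Coord K F p r | ∀ k, 0 < (pivots x k).1})
      (c := fun x => ∏ k, weight K (pivots x k)) hψ ?_ hc ?_ ?_ hG (hg _) ?_ ?_ hlast
    · simp only [Set.ofPred_forall]
      exact MeasurableSet.iInter fun k =>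
        measurableSet_lt measurable_const (measurable_fst.comp (measurable_pivots k))
    · exact fun x => Finset.prod_nonneg fun k _ => weight_nonneg _
    · intro x hx h hh
      have := lintegral_last (F := F) (coordT_isHermitian x)
        ((diss_iff_piv (coordT_isHermitian x)).2 hx) (coordN_conjTranspose x) (L := coordL x) hh
      rw [← coordR_eq] at this
      exact this
    · intro x hx
      simp only [Set.mem_ofPred_eq, not_forall, not_lt] at hx
      obtain ⟨k, hk⟩ := hx
      exact Finset.prod_eq_zero (Finset.mem_univ k) (h0 _ _ hk)
    · refine (hasInt_congr fun x => ?_).1 hIH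
      rw [Finset.prod_mul_distrib]
      push_cast
      rfl

end Coordinates

/-! ### Scalar integrals -/

lemma sigmaFinite_prod_three {A B C : Type*} [MeasureSpace A] [MeasureSpace B]
    [MeasureSpace C] [SigmaFinite (volume : Measure A)]
    [SigmaFinite (volume : Measure B)] [SigmaFinite (volume : Measure C)] :
    SigmaFinite (volume : Measure (A × B × C)) := inferInstance

/-- The integral of a non-integrable function is 0 by convention, so a nonzero value proves
convergence. -/
lemma hasInt_of_ne_zero {α : Type*} [MeasurableSpace α] {f : α → ℂ} {μ : Measure α} {I : ℂ}
    (h : ∫ x, f x ∂μ = I) (hI : I ≠ 0) : HasInt f μ I :=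
  ⟨Integrable.of_integral_ne_zero (h ▸ hI), h⟩

lemma HasInt.const_mul {α : Type*} [MeasurableSpace α] {f : α → ℂ} {μ : Measure α} {I : ℂ}
    (h : HasInt f μ I) (c : ℂ) : HasInt (fun x => c * f x) μ (c * I) :=
  ⟨h.1.const_mul c, by rw [integral_const_mul, h.2]⟩

lemma HasInt.congr_ae {α : Type*} [MeasurableSpace α] {f g : α → ℂ} {μ : Measure α} {I : ℂ}
    (h : HasInt f μ I) (hfg : f =ᵐ[μ] g) : HasInt g μ I :=
  ⟨h.1.congr hfg, by rw [← integral_congr_ae hfg, h.2]⟩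

lemma HasInt.mul_prod {α β : Type*} [MeasurableSpace α] [MeasurableSpace β] {μ : Measure α}
    {ν : Measure β} [SFinite ν] [SFinite μ] {f : α → ℂ} {g : β → ℂ} {I J : ℂ}
    (hf : HasInt f μ I) (hg : HasInt g ν J) :
    HasInt (fun w : α × β => f w.1 * g w.2) (μ.prod ν) (I * J) :=
  ⟨hf.1.mul_prod hg.1, by rw [integral_prod_mul, hf.2, hg.2]⟩

lemma hasInt_gamma {a : ℂ} (ha : 0 < a.re) {r : ℝ} (hr : 0 < r) :
    HasInt (fun t : ℝ => (t : ℂ) ^ (a - 1) * Complex.exp (-(r * t)))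
      (volume.restrict (Set.Ioi 0)) ((r : ℂ) ^ (-a) * Complex.Gamma a) := by
  have hr' : (r : ℂ) ≠ 0 := Complex.ofReal_ne_zero.2 hr.ne'
  refine hasInt_of_ne_zero ?_ (mul_ne_zero ?_ (Complex.Gamma_ne_zero_of_re_pos ha))
  · rw [Complex.integral_cpow_mul_exp_neg_mul_Ioi ha hr, one_div, Complex.inv_cpow,
      Complex.cpow_neg]
    rw [Complex.arg_ofReal_of_nonneg hr.le]
    exact Real.pi_pos.ne
  · simp [Complex.cpow_eq_zero_iff, hr']

section Laplace

variable {X : Type*} [MeasurableSpace X] {m : Measure X} [SigmaFinite m] {b : X → ℂ} {n : X → ℝ}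

/-- A power of a shifted function from the integrals of the exponentials of its multiples. -/
lemma hasInt_laplace (hb : Measurable b) (hn : Measurable n) (hn0 : ∀ᵐ x ∂m, 0 ≤ n x)
    {δ c c' α : ℂ}
    (h : ∀ u : ℝ, 0 < u → HasInt (fun x => b x * Complex.exp (-(u * n x))) m
      (c * (u : ℂ) ^ (-δ)))
    (h' : ∀ u : ℝ, 0 < u → HasInt (fun x => (‖b x‖ : ℂ) * Complex.exp (-(u * n x))) m
      (c' * (u : ℂ) ^ (-(δ.re : ℂ))))
    (hα : 0 < α.re) (hαδ : δ.re < α.re) {B : ℝ} (hB : 0 < B) :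
    HasInt (fun x => b x * ((B + n x : ℝ) : ℂ) ^ (-α)) m
      (c * (((B : ℂ) ^ (-(α - δ))) * Complex.Gamma (α - δ)) / Complex.Gamma α) := by
  set I0 := volume.restrict (Set.Ioi (0 : ℝ)) with hI0
  -- Euler's integral: integration over `u` gives `Γ(α) (B + n)^(-α) b`, whereas integration over
  -- `x` leaves a Gamma integral in `u` with exponent `α - δ`.
  obtain ⟨f, hf⟩ : ∃ f : X × ℝ → ℂ, ∀ z, f z = (z.2 : ℂ) ^ (α - 1) *
    Complex.exp (-((B + n z.1 : ℝ) * z.2)) * b z.1 := ⟨_, fun _ => rfl⟩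
  have hfm : Measurable f := by
    rw [funext hf]
    refine .mul (.mul (.pow (by fun_prop) measurable_const) ?_) (by fun_prop)
    fun_prop
  have hpos : ∀ᵐ u ∂I0, 0 < u := ae_restrict_mem measurableSet_Ioi
  have hexp : ∀ (x : X) (u : ℝ), Complex.exp (-((B + n x : ℝ) * u)) =
      Complex.exp (-(B * u)) * Complex.exp (-(u * n x)) := fun x u => by
    rw [← Complex.exp_add]
    congr 1
    push_cast
    ring
  have hu : ∀ u : ℝ, 0 < u → HasInt (fun x => f (x, u)) m
      (c * ((u : ℂ) ^ ((α - δ) - 1) * Complex.exp (-(B * u)))) := by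
    intro u hu
    have hu' : (u : ℂ) ≠ 0 := Complex.ofReal_ne_zero.2 hu.ne'
    have h1 := (h u hu).const_mul ((u : ℂ) ^ (α - 1) * Complex.exp (-(B * u)))
    rw [show (u : ℂ) ^ (α - 1) * Complex.exp (-(B * u)) * (c * (u : ℂ) ^ (-δ)) =
      c * ((u : ℂ) ^ ((α - δ) - 1) * Complex.exp (-(B * u))) by
        rw [show α - δ - 1 = (α - 1) + -δ by ring, Complex.cpow_add _ _ hu']; ring] at h1
    refine (hasInt_congr fun x => ?_).1 h1
    rw [hf, hexp]
    ring
  -- Absolute convergence is the same computation with `‖b‖` and the real parts of the exponents, by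
  -- `h'`.
  have hint : Integrable f (m.prod I0) := by
    rw [integrable_prod_iff' hfm.aestronglyMeasurable]
    refine ⟨hpos.mono fun u h0 => (hu u h0).1, ?_⟩
    have hre' : 0 < ((α.re : ℂ) - δ.re).re := by simpa using hαδ
    have hG' := (hasInt_gamma hre' hB).const_mul c'
    have key : ∀ᵐ u ∂I0, ((∫ x, ‖f (x, u)‖ ∂m : ℝ) : ℂ) =
        c' * ((u : ℂ) ^ (((α.re : ℂ) - δ.re) - 1) * Complex.exp (-(B * u))) := by
      filter_upwards [hpos] with u h0
      have hu' : (u : ℂ) ≠ 0 := Complex.ofReal_ne_zero.2 h0.ne'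
      have h1 := (h' u h0).const_mul ((u : ℂ) ^ ((α.re : ℂ) - 1) * Complex.exp (-(B * u)))
      rw [show (u : ℂ) ^ ((α.re : ℂ) - 1) * Complex.exp (-(B * u)) *
          (c' * (u : ℂ) ^ (-(δ.re : ℂ))) =
        c' * ((u : ℂ) ^ (((α.re : ℂ) - δ.re) - 1) * Complex.exp (-(B * u))) by
          rw [show (α.re : ℂ) - δ.re - 1 = ((α.re : ℂ) - 1) + -(δ.re : ℂ) by ring,
            Complex.cpow_add _ _ hu']; ring] at h1
      rw [← integral_complex_ofReal, ← h1.2]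
      refine integral_congr_ae (.of_forall fun x => ?_)
      simp only [hf, norm_mul, Complex.norm_cpow_eq_rpow_re_of_pos h0, Complex.norm_exp, hexp]
      rw [show -((B : ℂ) * u) = ((-(B * u) : ℝ) : ℂ) by push_cast; ring,
        show -((u : ℂ) * n x) = ((-(u * n x) : ℝ) : ℂ) by push_cast; ring]
      simp only [Complex.ofReal_re]
      push_cast [Complex.ofReal_cpow h0.le]
      simp only [Complex.sub_re, Complex.one_re]
      push_cast
      ring
    have h3 := hG'.1.congr (key.mono fun u hu => hu.symm)
    simpa using h3.re
  have hG := (hasInt_gamma (a := α - δ) (by simpa using hαδ) hB).const_mul c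
  have h4 : HasInt (fun x => ∫ u, f (x, u) ∂I0) m
      (c * ((B : ℂ) ^ (-(α - δ)) * Complex.Gamma (α - δ))) := by
    refine ⟨hint.integral_prod_left, ?_⟩
    rw [integral_integral_swap (f := fun x u => f (x, u)) hint, ← hG.2]
    refine integral_congr_ae ?_
    filter_upwards [hpos] with u h0
    exact (hu u h0).2
  have h5 := (h4.const_mul (Complex.Gamma α)⁻¹).congr_ae (g := fun x =>
    b x * ((B + n x : ℝ) : ℂ) ^ (-α)) (by
    filter_upwards [hn0] with x hx
    have hp : 0 < B + n x := by linarith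
    have h6 := (hasInt_gamma hα hp).const_mul (b x)
    have h7 : ∫ u, f (x, u) ∂I0 = b x *
        (((B + n x : ℝ) : ℂ) ^ (-α) * Complex.Gamma α) := by
      rw [← h6.2]
      refine integral_congr_ae (.of_forall fun u => ?_)
      simp only [hf]
      ring
    rw [h7]
    have := Complex.Gamma_ne_zero_of_re_pos hα
    field_simp)
  convert! h5 using 1
  ring

end Laplace

section Beta

variable {E : Type*} [MeasurableSpace E] {μ : Measure E} [SigmaFinite μ] {N : E → ℝ} {D : ℝ}

/-- `hN` says that `N` has the Gaussian integrals of the squared norm on a Euclidean space of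
dimension `D`. -/
lemma hasInt_gauss (hN : ∀ u : ℝ, 0 < u →
      ∫ e, Real.exp (-(u * N e)) ∂μ = (Real.pi / u) ^ (D / 2)) {u : ℝ} (hu : 0 < u) :
    HasInt (fun e => Complex.exp (-(u * N e))) μ
      ((Real.pi : ℂ) ^ ((D : ℂ) / 2) * (u : ℂ) ^ (-((D : ℂ) / 2))) := by
  have h1 : HasInt (fun e => ((Real.exp (-(u * N e)) : ℝ) : ℂ)) μ
      (((Real.pi / u) ^ (D / 2) : ℝ) : ℂ) := by
    refine hasInt_of_ne_zero ?_ ?_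
    · rw [integral_complex_ofReal, hN u hu]
    · exact Complex.ofReal_ne_zero.2 (Real.rpow_pos_of_pos (by positivity) _).ne'
  rw [Real.div_rpow Real.pi_pos.le hu.le, Complex.ofReal_div, Complex.ofReal_cpow
      Real.pi_pos.le, Complex.ofReal_cpow hu.le, div_eq_mul_inv, ← Complex.cpow_neg] at h1
  push_cast at h1
  exact h1

/-- The integral of a power over a space with a Gaussian weight. -/
lemma hasInt_power (hNm : Measurable N) (hN0 : ∀ e, 0 ≤ N e) (hN : ∀ u : ℝ, 0 < u →
      ∫ e, Real.exp (-(u * N e)) ∂μ = (Real.pi / u) ^ (D / 2))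
    {α : ℂ} (hα : 0 < α.re) (hD : D / 2 < α.re) {B : ℝ} (hB : 0 < B) :
    HasInt (fun e => ((B + N e : ℝ) : ℂ) ^ (-α)) μ
      ((Real.pi : ℂ) ^ ((D : ℂ) / 2) * ((B : ℂ) ^ (-(α - D / 2)) *
        Complex.Gamma (α - D / 2)) / Complex.Gamma α) := by
  have hre : ((D : ℂ) / 2).re = D / 2 := by
    rw [show (D : ℂ) / 2 = ((D / 2 : ℝ) : ℂ) by push_cast; ring, Complex.ofReal_re]
  have := hasInt_laplace (m := μ) (b := fun _ => 1) (n := N) (δ := (D : ℂ) / 2) (α := α)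
    (c := (Real.pi : ℂ) ^ ((D : ℂ) / 2)) (c' := (Real.pi : ℂ) ^ ((D : ℂ) / 2))
    measurable_const hNm (.of_forall hN0) (fun u hu => by simpa using hasInt_gauss hN hu)
    (fun u hu => by
      rw [hre]
      simpa using hasInt_gauss hN hu) hα (by rwa [hre]) hB
  simpa using this

/-- The beta integral over a half-line times a space with a Gaussian weight. -/
lemma hasInt_beta (hNm : Measurable N) (hN0 : ∀ e, 0 ≤ N e) (hN : ∀ u : ℝ, 0 < u →
      ∫ e, Real.exp (-(u * N e)) ∂μ = (Real.pi / u) ^ (D / 2))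
    {a α : ℂ} (ha : 0 < a.re) (hα : 0 < α.re) (haα : D / 2 < (α - a).re) :
    HasInt (fun w : E × ℝ => (w.2 : ℂ) ^ (a - 1) * ((1 + w.2 + N w.1 : ℝ) : ℂ) ^ (-α))
      (μ.prod (volume.restrict (Set.Ioi 0)))
      ((Real.pi : ℂ) ^ ((D : ℂ) / 2) * Complex.Gamma a *
        Complex.Gamma (α - a - D / 2) / Complex.Gamma α) := by
  have hre : ((D : ℂ) / 2).re = D / 2 := by
    rw [show (D : ℂ) / 2 = ((D / 2 : ℝ) : ℂ) by push_cast; ring, Complex.ofReal_re]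
  have hpos2 : ∀ᵐ w ∂(μ.prod (volume.restrict (Set.Ioi (0 : ℝ)))), 0 < w.2 :=
    Measure.quasiMeasurePreserving_snd.ae (ae_restrict_mem measurableSet_Ioi)
  have hu : ∀ (a : ℂ), 0 < a.re → ∀ u : ℝ, 0 < u →
      HasInt (fun w : E × ℝ => (w.2 : ℂ) ^ (a - 1) *
        Complex.exp (-(u * ((w.2 + N w.1 : ℝ) : ℂ)))) (μ.prod (volume.restrict (Set.Ioi 0)))
        ((Real.pi : ℂ) ^ ((D : ℂ) / 2) * Complex.Gamma a * (u : ℂ) ^ (-(a + (D : ℂ) / 2))) := by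
    intro a ha u hu
    have hu' : (u : ℂ) ≠ 0 := Complex.ofReal_ne_zero.2 hu.ne'
    have h2 := (hasInt_gauss hN hu).mul_prod (hasInt_gamma ha hu)
    rw [show (Real.pi : ℂ) ^ ((D : ℂ) / 2) * (u : ℂ) ^ (-((D : ℂ) / 2)) *
      ((u : ℂ) ^ (-a) * Complex.Gamma a) = (Real.pi : ℂ) ^ ((D : ℂ) / 2) * Complex.Gamma a *
        (u : ℂ) ^ (-(a + (D : ℂ) / 2)) by
      rw [show -(a + (D : ℂ) / 2) = -a + -((D : ℂ) / 2) by ring, Complex.cpow_add _ _ hu']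
      ring] at h2
    refine (hasInt_congr fun w => ?_).1 h2
    rw [show -((u : ℂ) * ((w.2 + N w.1 : ℝ) : ℂ)) = -(u * N w.1) + -(u * w.2) by
      push_cast; ring, Complex.exp_add]
    ring
  -- The function in the exponent is `ρ + N`: the half-line contributes `a` to the exponent `δ` and
  -- the space contributes `D/2`.
  have := hasInt_laplace (m := μ.prod (volume.restrict (Set.Ioi (0 : ℝ))))
    (b := fun w => (w.2 : ℂ) ^ (a - 1)) (n := fun w => w.2 + N w.1) (δ := a + (D : ℂ) / 2)
    (α := α) (c' := (Real.pi : ℂ) ^ ((D : ℂ) / 2) * Complex.Gamma a.re)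
    (.pow (by fun_prop) measurable_const) (by fun_prop)
    (by filter_upwards [hpos2] with w hw; exact add_nonneg hw.le (hN0 _)) (hu a ha)
    (fun u h0 => by
      have h3 := hu a.re ha u h0
      rw [show ((a + (D : ℂ) / 2).re : ℂ) = a.re + (D : ℂ) / 2 by
        rw [Complex.add_re, hre]; push_cast; ring]
      refine h3.congr_ae ?_
      filter_upwards [hpos2] with w hw
      rw [Complex.norm_cpow_eq_rpow_re_of_pos hw, Complex.ofReal_cpow hw.le]
      simp) hα (by rw [Complex.add_re, hre]; rw [Complex.sub_re] at haα; linarith) one_pos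
  rw [Complex.ofReal_one, Complex.one_cpow, one_mul, ← sub_sub] at this
  refine (hasInt_congr fun w => ?_).1 this
  rw [add_assoc]

/-- The integral over a half-line times a space with a Gaussian weight, with a further
integration the result of which is a power. -/
lemma hasInt_beta_im {F : Type*} [MeasurableSpace F] {ν : Measure F} [SigmaFinite ν]
    (hNm : Measurable N) (hN0 : ∀ e, 0 ≤ N e) (hN : ∀ u : ℝ, 0 < u →
      ∫ e, Real.exp (-(u * N e)) ∂μ = (Real.pi / u) ^ (D / 2))
    {Ψ : ℝ × F → ℂ} (hΨ : Measurable Ψ) {C : ℂ} {C' : ℝ}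
    {a α : ℂ} (ha : 0 < a.re) (hα : 0 < α.re) (haα : D / 2 < (α - a).re)
    (hφ : ∀ A : ℝ, 0 < A → HasInt (fun v => Ψ (A, v)) ν (C * (A : ℂ) ^ (-α)))
    (hφ' : ∀ A : ℝ, 0 < A → ∫ v, ‖Ψ (A, v)‖ ∂ν ≤ C' * A ^ (-α.re)) :
    HasInt (fun z : (E × ℝ) × F => if 0 < z.1.2 then (z.1.2 : ℂ) ^ (a - 1) *
        Ψ (1 + z.1.2 + N z.1.1, z.2) else 0) ((μ.prod volume).prod ν)
      (C * ((Real.pi : ℂ) ^ ((D : ℂ) / 2) * Complex.Gamma a *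
        Complex.Gamma (α - a - D / 2) / Complex.Gamma α)) := by
  obtain ⟨G, hG⟩ : ∃ G : (E × ℝ) × F → ℂ, ∀ z, G z = if 0 < z.1.2 then (z.1.2 : ℂ) ^ (a - 1) *
      Ψ (1 + z.1.2 + N z.1.1, z.2) else 0 := ⟨_, fun _ => rfl⟩
  refine (hasInt_congr hG).1 ?_
  have hGm : Measurable G := by
    rw [funext hG]
    refine Measurable.ite (measurableSet_lt measurable_const (by fun_prop))
      (.mul (.pow (by fun_prop) measurable_const) (hΨ.comp ?_)) measurable_const
    fun_prop
  have hB := hasInt_beta hNm hN0 hN ha hα haα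
  have hB' := hasInt_beta (a := a.re) (α := α.re) hNm hN0 hN ha hα (by simpa using haα)
  set I0 := volume.restrict (Set.Ioi (0 : ℝ)) with hI0
  have hpos2 : ∀ᵐ w ∂(μ.prod I0), 0 < w.2 :=
    Measure.quasiMeasurePreserving_snd.ae (ae_restrict_mem measurableSet_Ioi)
  have hvol : ((μ.prod volume).prod ν).restrict {z | 0 < z.1.2} = (μ.prod I0).prod ν := by
    have e1 : μ.prod I0 = (μ.prod volume).restrict (Set.univ ×ˢ Set.Ioi 0) := by
      rw [← Measure.prod_restrict, Measure.restrict_univ]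
    have e2 : {z : (E × ℝ) × F | 0 < z.1.2} = (Set.univ ×ˢ Set.Ioi 0) ×ˢ Set.univ := by
      ext z
      simp
    rw [e1, e2, ← Measure.prod_restrict, Measure.restrict_univ]
  rw [← hasInt_restrict (D := {z : (E × ℝ) × F | 0 < z.1.2})
    (fun z hz => (hG z).trans (if_neg (by simpa using hz))), hvol]
  have hfib : ∀ w : E × ℝ, 0 < w.2 →
      HasInt (fun v => G (w, v)) ν ((w.2 : ℂ) ^ (a - 1) *
        (C * ((1 + w.2 + N w.1 : ℝ) : ℂ) ^ (-α))) := by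
    intro w hw
    have := (hφ (1 + w.2 + N w.1) (by linarith [hN0 w.1])).const_mul ((w.2 : ℂ) ^ (a - 1))
    refine (hasInt_congr fun v => ?_).1 this
    simp only [hG, if_pos hw]
  have hint : Integrable G ((μ.prod I0).prod ν) := by
    rw [integrable_prod_iff hGm.aestronglyMeasurable]
    refine ⟨hpos2.mono fun w hw => (hfib w hw).1, ?_⟩
    -- By `hφ'` the integrals of the norms over `F` are dominated by the beta integrand with the
    -- exponents replaced by their real parts.
    refine Integrable.mono' (hB'.1.norm.const_mul C')
      hGm.aestronglyMeasurable.norm.integral_prod_right' ?_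
    filter_upwards [hpos2] with w hw
    have hp : 0 < 1 + w.2 + N w.1 := by linarith [hN0 w.1]
    rw [Real.norm_of_nonneg (integral_nonneg fun _ => norm_nonneg _)]
    have e3 : ∀ v : F, ‖G (w, v)‖ = w.2 ^ (a.re - 1) * ‖Ψ (1 + w.2 + N w.1, v)‖ := fun v => by
      simp only [hG, if_pos hw, norm_mul, Complex.norm_cpow_eq_rpow_re_of_pos hw, Complex.sub_re,
        Complex.one_re]
    simp only [e3]
    rw [integral_const_mul, norm_mul, Complex.norm_cpow_eq_rpow_re_of_pos hw,
      Complex.norm_cpow_eq_rpow_re_of_pos hp, mul_left_comm]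
    simp only [Complex.sub_re, Complex.one_re, Complex.neg_re, Complex.ofReal_re]
    exact mul_le_mul_of_nonneg_left (hφ' _ hp) (Real.rpow_nonneg hw.le _)
  refine ⟨hint, ?_⟩
  rw [integral_prod _ hint, ← hB.2, ← integral_const_mul]
  refine integral_congr_ae ?_
  filter_upwards [hpos2] with w hw
  rw [(hfib w hw).2]
  ring

end Beta

/-! ### A single factor of the integral. -/

section ModelIntegral

variable {K : Type*} [NormedDivisionRing K] [NormedAlgebra ℝ K] [StarRing K] [ReField K]
variable [MeasureSpace K] [BorelSpace K] [SecondCountableTopology K] [FiniteDimensional ℝ K]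
variable [(volume : Measure K).IsAddHaarMeasure]
variable {F : Type*} [AddCommGroup F] [MeasureSpace F] [MeasurableAdd₂ F] [ImCoord K F]
variable [SigmaFinite (volume : Measure F)] [(volume : Measure F).IsAddLeftInvariant]
variable {p r : ℕ}

lemma nsq_nonneg {n : ℕ} (x : Fin n → K) : 0 ≤ nsq x :=
  Finset.sum_nonneg fun _ _ => by positivity

lemma integral_exp_nsq {d : ℝ}
    (hK : ∀ u : ℝ, 0 < u → ∫ x : K, Real.exp (-(u * ‖x‖ ^ 2)) = (Real.pi / u) ^ (d / 2))
    (n : ℕ) {u : ℝ} (hu : 0 < u) :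
    ∫ x : Fin n → K, Real.exp (-(u * nsq x)) = (Real.pi / u) ^ (d * n / 2) := by
  have h := integral_fintype_prod_volume_eq_pow (ι := Fin n)
    (fun x : K => Real.exp (-(u * ‖x‖ ^ 2)))
  rw [hK u hu, Fintype.card_fin, ← Real.rpow_natCast, ← Real.rpow_mul (by positivity)] at h
  rw [show d * n / 2 = d / 2 * n by ring, ← h]
  congr 1
  ext x
  rw [← Real.exp_sum, nsq, Finset.mul_sum, Finset.sum_neg_distrib]

/-- This puts the imaginary part last, where `hasInt_beta_im` expects it. -/
lemma measurePreserving_rotate {A B C D E : Type*} [MeasureSpace A] [MeasureSpace B]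
    [MeasureSpace C] [MeasureSpace D] [MeasureSpace E] [SigmaFinite (volume : Measure A)]
    [SigmaFinite (volume : Measure B)] [SigmaFinite (volume : Measure C)]
    [SigmaFinite (volume : Measure D)] [SigmaFinite (volume : Measure E)] :
    MeasurePreserving (fun w : A × B × C × D × E =>
      (((w.1, w.2.1, w.2.2.1), w.2.2.2.2), w.2.2.2.1)) := by
  have a1 : MeasurePreserving (fun w : B × C × (D × E) => ((w.1, w.2.1), w.2.2)) :=
    (volume_preserving_prodAssoc (α₁ := B) (β₁ := C) (γ₁ := D × E)).symm
  have a2 : MeasurePreserving (Prod.swap : D × E → E × D) := Measure.measurePreserving_swap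
  have a3 : MeasurePreserving (fun w : B × C × (D × E) => ((w.1, w.2.1), w.2.2.swap)) :=
    ((MeasurePreserving.id _).prod a2).comp a1
  have a4 : MeasurePreserving (fun w : A × B × C × (D × E) =>
      (w.1, ((w.2.1, w.2.2.1), w.2.2.2.swap))) := (MeasurePreserving.id _).prod a3
  have a5 : MeasurePreserving (fun w : A × (B × C) × (E × D) => ((w.1, w.2.1), w.2.2)) :=
    (volume_preserving_prodAssoc (α₁ := A) (β₁ := B × C) (γ₁ := E × D)).symm
  have a6 : MeasurePreserving (fun w : (A × (B × C)) × (E × D) => ((w.1, w.2.1), w.2.2)) :=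
    (volume_preserving_prodAssoc (α₁ := A × (B × C)) (β₁ := E) (γ₁ := D)).symm
  exact a6.comp (a5.comp a4)

/-- A factor of the integral, given the integral over the imaginary part. -/
theorem hasInt_model {d : ℝ}
    (hK : ∀ u : ℝ, 0 < u → ∫ x : K, Real.exp (-(u * ‖x‖ ^ 2)) = (Real.pi / u) ^ (d / 2))
    {φ : K → ℂ} (hφm : Measurable φ) {C : ℂ} {C' : ℝ} {a α : ℂ} (ha : 0 < a.re) (hα : 0 < α.re)
    (haα : d * (2 * p + r) / 2 < (α - a).re)
    (hφ : ∀ A : ℝ, 0 < A → HasInt (fun v : F => φ (algebraMap ℝ K A + ImCoord.emb v)) volume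
      (C * (A : ℂ) ^ (-α)))
    (hφ' : ∀ A : ℝ, 0 < A → ∫ v : F, ‖φ (algebraMap ℝ K A + ImCoord.emb v)‖ ≤
      C' * A ^ (-α.re)) :
    HasInt (fun w : ℝ × K => if 0 < w.1 then (w.1 : ℂ) ^ (a - 1) * φ w.2 else 0)
      (model K F p r)
      (C * ((Real.pi : ℂ) ^ ((d * (2 * p + r) : ℂ) / 2) * Complex.Gamma a *
        Complex.Gamma (α - a - (d * (2 * p + r) : ℂ) / 2) / Complex.Gamma α)) := by
  set N : (Fin p → K) × (Fin r → K) × (Fin p → K) → ℝ :=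
    fun e => nsq e.1 + nsq e.2.1 + nsq e.2.2 with hNdef
  have hNm : Measurable N := .add (.add (measurable_nsq (by fun_prop))
    (measurable_nsq (by fun_prop))) (measurable_nsq (by fun_prop))
  have hN0 : ∀ e, 0 ≤ N e := fun e => add_nonneg (add_nonneg (nsq_nonneg _) (nsq_nonneg _))
    (nsq_nonneg _)
  have hN : ∀ u : ℝ, 0 < u → ∫ e, Real.exp (-(u * N e)) =
      (Real.pi / u) ^ (d * (2 * p + r) / 2) := by
    intro u hu
    have e1 : ∀ e, Real.exp (-(u * N e)) = Real.exp (-(u * nsq e.1)) *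
        (Real.exp (-(u * nsq e.2.1)) * Real.exp (-(u * nsq e.2.2))) := fun e => by
      rw [← Real.exp_add, ← Real.exp_add, hNdef]
      congr 1
      ring
    have hpu : 0 < Real.pi / u := by positivity
    simp only [e1]
    rw [Measure.volume_eq_prod, integral_prod_mul (fun x : Fin p → K => Real.exp (-(u * nsq x)))
      (fun e : (Fin r → K) × (Fin p → K) => Real.exp (-(u * nsq e.1)) * Real.exp (-(u * nsq e.2))),
      Measure.volume_eq_prod, integral_prod_mul (fun x : Fin r → K => Real.exp (-(u * nsq x)))
      (fun x : Fin p → K => Real.exp (-(u * nsq x))), integral_exp_nsq hK _ hu,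
      integral_exp_nsq hK _ hu, ← Real.rpow_add hpu, ← Real.rpow_add hpu]
    congr 1
    ring
  have hgm : Measurable fun w : ℝ × K =>
      if 0 < w.1 then (w.1 : ℂ) ^ (a - 1) * φ w.2 else 0 :=
    Measurable.ite (measurableSet_lt measurable_const measurable_fst)
      (.mul (.pow (by fun_prop) measurable_const) (by fun_prop)) measurable_const
  have hmp : MeasurePreserving (modelMap K F p r) volume (model K F p r) :=
    ⟨measurable_modelMap, rfl⟩
  rw [← hasInt_comp hmp hgm.aestronglyMeasurable]
  set G : (((Fin p → K) × (Fin r → K) × (Fin p → K)) × ℝ) × F → ℂ := fun z =>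
    if 0 < z.1.2 then (z.1.2 : ℂ) ^ (a - 1) *
      φ (algebraMap ℝ K (1 + z.1.2 + N z.1.1) + ImCoord.emb z.2) else 0 with hG
  have hGm : Measurable G := by
    have h1 := measurable_algebraMap (K := K)
    have h2 := ImCoord.measurable_emb (K := K) (F := F)
    refine Measurable.ite (measurableSet_lt measurable_const (by fun_prop))
      (.mul (.pow (by fun_prop) measurable_const) (hφm.comp ?_)) measurable_const
    fun_prop
  have : SigmaFinite (volume : Measure ((Fin p → K) × (Fin r → K) × (Fin p → K))) :=
    sigmaFinite_prod_three
  have hrot := hasInt_comp (measurePreserving_rotate (A := Fin p → K) (B := Fin r → K)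
    (C := Fin p → K) (D := F) (E := ℝ)) hGm.aestronglyMeasurable (I :=
      (C * ((Real.pi : ℂ) ^ ((d * (2 * p + r) : ℂ) / 2) * Complex.Gamma a *
        Complex.Gamma (α - a - (d * (2 * p + r) : ℂ) / 2) / Complex.Gamma α)))
  refine (hasInt_congr fun w => rfl).1 (hrot.2 ?_)
  have hcast : ((d * (2 * p + r) : ℝ) : ℂ) = (d * (2 * p + r) : ℂ) := by push_cast; rfl
  have h1 := measurable_algebraMap (K := K)
  have h2 := ImCoord.measurable_emb (K := K) (F := F)
  have := hasInt_beta_im (ν := (volume : Measure F)) hNm hN0 hN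
    (Ψ := fun z => φ (algebraMap ℝ K z.1 + ImCoord.emb z.2)) (by fun_prop) ha hα haα hφ hφ'
  rw [hcast] at this
  exact this

end ModelIntegral

/-! ### The Cauchy beta integral -/

/-- Integrals of exponentials depend holomorphically on the exponent. -/
lemma differentiableAt_integral_exp {X : Type*} [MeasurableSpace X] {m : Measure X} {g : X → ℂ}
    {h : X → ℝ} (hg : Measurable g) (hh : Measurable h) {z₀ : ℂ} {ε : ℝ} (hε : 0 < ε)
    (h1 : Integrable (fun x => ‖g x‖ * Real.exp ((z₀.re + 2 * ε) * h x)) m)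
    (h2 : Integrable (fun x => ‖g x‖ * Real.exp ((z₀.re - 2 * ε) * h x)) m) :
    DifferentiableAt ℂ (fun z : ℂ => ∫ x, g x * Complex.exp (z * h x) ∂m) z₀ := by
  -- One bound for both the integrand and its derivative: `1 + ε|y| ≤ exp(ε|y|)`, and moving `t`
  -- costs another `ε|y|`. The result is one of the two exponentials on the right, according to the
  -- sign of `y`.
  have hle : ∀ (t y : ℝ), |t - z₀.re| ≤ ε →
      Real.exp (t * y) * (1 + ε * |y|) ≤ Real.exp ((z₀.re + 2 * ε) * y) +
        Real.exp ((z₀.re - 2 * ε) * y) := by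
    intro t y ht
    have e1 : 1 + ε * |y| ≤ Real.exp (ε * |y|) := by
      have := Real.add_one_le_exp (ε * |y|); linarith
    have e2 : Real.exp (t * y) * (1 + ε * |y|) ≤ Real.exp (z₀.re * y + 2 * ε * |y|) := by
      calc _ ≤ Real.exp (t * y) * Real.exp (ε * |y|) := by gcongr
        _ = Real.exp (t * y + ε * |y|) := (Real.exp_add _ _).symm
        _ ≤ _ := by
          refine Real.exp_le_exp.2 ?_
          have : (t - z₀.re) * y ≤ ε * |y| :=
            (le_abs_self _).trans (by rw [abs_mul]; gcongr)
          nlinarith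
    refine e2.trans ?_
    rcases abs_cases y with ⟨hy, _⟩ | ⟨hy, _⟩
    · rw [hy]
      refine le_trans (le_of_eq ?_) (le_add_of_nonneg_right (Real.exp_pos _).le)
      congr 1; ring
    · rw [hy]
      refine le_trans (le_of_eq ?_) (le_add_of_nonneg_left (Real.exp_pos _).le)
      congr 1; ring
  have hsum : Integrable (fun x => ‖g x‖ * Real.exp ((z₀.re + 2 * ε) * h x) +
      ‖g x‖ * Real.exp ((z₀.re - 2 * ε) * h x)) m := h1.add h2
  have hmeas : ∀ z : ℂ, Measurable fun x => g x * Complex.exp (z * h x) := fun z => by fun_prop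
  have hb : ∀ t : ℝ, |t - z₀.re| ≤ ε → ∀ x, ‖g x‖ * (Real.exp (t * h x) * (1 + ε * |h x|)) ≤
      ‖g x‖ * Real.exp ((z₀.re + 2 * ε) * h x) + ‖g x‖ * Real.exp ((z₀.re - 2 * ε) * h x) := by
    intro t ht x
    rw [← mul_add]
    exact mul_le_mul_of_nonneg_left (hle t (h x) ht) (norm_nonneg _)
  have hnorm : ∀ (z : ℂ) x, ‖Complex.exp (z * h x)‖ = Real.exp (z.re * h x) := fun z x => by
    rw [Complex.norm_exp]; simp
  refine (hasDerivAt_integral_of_dominated_loc_of_deriv_le (F := fun z x =>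
    g x * Complex.exp (z * h x)) (F' := fun z x => g x * (Complex.exp (z * h x) * h x))
    (bound := fun x => ε⁻¹ * (‖g x‖ * Real.exp ((z₀.re + 2 * ε) * h x) +
      ‖g x‖ * Real.exp ((z₀.re - 2 * ε) * h x))) (Metric.ball_mem_nhds z₀ hε) ?_ ?_ ?_ ?_ ?_
      ?_).2.differentiableAt
  · exact .of_forall fun z => (hmeas z).aestronglyMeasurable
  · refine Integrable.mono' hsum (hmeas z₀).aestronglyMeasurable (.of_forall fun x => ?_)
    rw [norm_mul, hnorm]
    refine le_trans ?_ (hb z₀.re (by simpa using hε.le) x)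
    refine mul_le_mul_of_nonneg_left ?_ (norm_nonneg _)
    refine le_mul_of_one_le_right (Real.exp_pos _).le ?_
    have := mul_nonneg hε.le (abs_nonneg (h x))
    linarith
  · exact Measurable.aestronglyMeasurable (by fun_prop)
  · refine .of_forall fun x z hz => ?_
    have hz' : |z.re - z₀.re| ≤ ε := by
      rw [← Complex.sub_re]
      exact (Complex.abs_re_le_norm _).trans (by simpa [dist_eq_norm] using (Metric.mem_ball.1 hz).le)
    rw [norm_mul, norm_mul, hnorm, Complex.norm_real, Real.norm_eq_abs, le_inv_mul_iff₀ hε]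
    refine le_trans ?_ (hb z.re hz' x)
    have e3 := Real.exp_pos (z.re * h x)
    have e4 := norm_nonneg (g x)
    have : 0 ≤ ‖g x‖ * Real.exp (z.re * h x) := by positivity
    nlinarith
  · exact hsum.const_mul _
  · refine .of_forall fun x z _ => ?_
    have := ((hasDerivAt_id z).mul_const (h x : ℂ)).cexp.const_mul (g x)
    simpa using this

/-- Both sides are holomorphic in `r` on the right half-plane and agree for positive `r`, in
particular at the points `1 + 1/(n+1)`, which accumulate at 1. -/
lemma hasInt_gamma_complex {a : ℂ} (ha : 0 < a.re) {r : ℂ} (hr : 0 < r.re) :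
    HasInt (fun t : ℝ => (t : ℂ) ^ (a - 1) * Complex.exp (-r * t))
      (volume.restrict (Set.Ioi 0)) (r ^ (-a) * Complex.Gamma a) := by
  have hpos : ∀ᵐ u ∂(volume.restrict (Set.Ioi (0 : ℝ))), 0 < u :=
    ae_restrict_mem measurableSet_Ioi
  have hm : ∀ a : ℂ, Measurable fun t : ℝ => (t : ℂ) ^ (a - 1) := fun a =>
    .pow (by fun_prop) measurable_const
  have hint : ∀ s : ℝ, 0 < s →
      Integrable (fun t : ℝ => ‖(t : ℂ) ^ (a - 1)‖ * Real.exp (-s * t))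
        (volume.restrict (Set.Ioi 0)) := by
    intro s hs
    have := (hasInt_gamma ha hs).1.norm
    refine this.congr (.of_forall fun t => ?_)
    simp only [norm_mul, Complex.norm_exp]
    congr 2
    simp
  constructor
  · have hm' : Measurable fun t : ℝ => (t : ℂ) ^ (a - 1) * Complex.exp (-r * t) :=
      (hm a).mul (by fun_prop)
    rw [← integrable_norm_iff hm'.aestronglyMeasurable]
    refine (hint r.re hr).congr (.of_forall fun t => ?_)
    simp only [norm_mul, Complex.norm_exp]
    congr 2
    simp
  · have hU : IsOpen {z : ℂ | 0 < z.re} := isOpen_lt continuous_const Complex.continuous_re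
    have hc : IsPreconnected {z : ℂ | 0 < z.re} := (convex_halfSpace_re_gt 0).isPreconnected
    have h1 : AnalyticOnNhd ℂ (fun z : ℂ => ∫ t in Set.Ioi (0 : ℝ),
        (t : ℂ) ^ (a - 1) * Complex.exp (z * (-t : ℝ))) {z : ℂ | 0 < z.re} := by
      refine DifferentiableOn.analyticOnNhd (fun z hz => ?_) hU
      have hz : 0 < z.re := hz
      -- With `ε = Re z / 4` both `Re z ± 2ε` are positive rates of decay.
      refine (differentiableAt_integral_exp (hm a) (by fun_prop) (ε := z.re / 4) (by positivity)
        ?_ ?_).differentiableWithinAt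
      · refine (hint (z.re + 2 * (z.re / 4)) (by linarith)).congr (.of_forall fun t => ?_)
        simp only
        congr 2; ring
      · refine (hint (z.re - 2 * (z.re / 4)) (by linarith)).congr (.of_forall fun t => ?_)
        simp only
        congr 2; ring
    have h2 : AnalyticOnNhd ℂ (fun z : ℂ => z ^ (-a) * Complex.Gamma a) {z : ℂ | 0 < z.re} := by
      refine DifferentiableOn.analyticOnNhd (fun z hz => ?_) hU
      exact (((differentiableAt_id).cpow_const (Or.inl hz)).mul_const _).differentiableWithinAt
    have h3 := h1.eqOn_of_preconnected_of_frequently_eq h2 hc (z₀ := 1) (by simp) (by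
      have htend : Filter.Tendsto (fun n : ℕ => (1 : ℂ) + ((1 / ((n : ℝ) + 1) : ℝ) : ℂ))
          Filter.atTop (𝓝[≠] 1) := by
        refine tendsto_nhdsWithin_iff.2 ⟨?_, .of_forall fun n => ?_⟩
        · have h := (Complex.continuous_ofReal.tendsto 0).comp
            (tendsto_one_div_add_atTop_nhds_zero_nat (𝕜 := ℝ))
          simpa using h.const_add (1 : ℂ)
        · have : (0 : ℝ) < 1 / ((n : ℝ) + 1) := by positivity
          simp only [Set.mem_compl_iff, Set.mem_singleton_iff, add_eq_left]
          exact Complex.ofReal_ne_zero.2 this.ne'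
      refine htend.frequently (Filter.Frequently.of_forall fun n => ?_)
      have hp : (0 : ℝ) < 1 + 1 / ((n : ℝ) + 1) := by positivity
      have := (hasInt_gamma ha hp).2
      rw [show (1 : ℂ) + ((1 / ((n : ℝ) + 1) : ℝ) : ℂ) = ((1 + 1 / ((n : ℝ) + 1) : ℝ) : ℂ) by
        push_cast; ring, ← this]
      congr 1
      ext t
      push_cast
      congr 2
      ring)
    have h4 := h3 (show r ∈ {z : ℂ | 0 < z.re} from hr)
    simp only at h4
    rw [← h4]
    congr 1
    ext t
    push_cast
    congr 2
    ring

/-- The inverse of `z ^ σ * (conj z) ^ τ`. -/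
def bipow (σ τ z : ℂ) : ℂ :=
  Complex.exp (-(σ * Complex.log z)) * Complex.exp (-(τ * conj (Complex.log z)))

lemma measurable_bipow (σ τ : ℂ) : Measurable (bipow σ τ) := by
  have h1 : Measurable Complex.log := Complex.measurable_log
  have h2 : Measurable (conj : ℂ → ℂ) := Complex.continuous_conj.measurable
  unfold bipow
  fun_prop

lemma norm_bipow {σ τ z : ℂ} (hz : z ≠ 0) :
    ‖bipow σ τ z‖ = ‖z‖ ^ (-(σ + τ).re) * Real.exp ((σ - τ).im * z.arg) := by
  rw [bipow, norm_mul, Complex.norm_exp, Complex.norm_exp, ← Real.exp_add,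
    Real.rpow_def_of_pos (norm_pos_iff.2 hz), ← Real.exp_add]
  congr 1
  simp only [Complex.neg_re, Complex.mul_re, Complex.conj_re, Complex.conj_im, Complex.log_re,
    Complex.log_im, Complex.add_re, Complex.sub_im]
  ring

/-- The argument is bounded, so the imaginary parts of the exponents cost only a constant and
convergence is governed by `Re (σ + τ)`. -/
lemma norm_bipow_le {σ τ z : ℂ} (hz : z ≠ 0) :
    ‖bipow σ τ z‖ ≤ Real.exp (|(σ - τ).im| * Real.pi) * ‖z‖ ^ (-(σ + τ).re) := by
  rw [norm_bipow hz, mul_comm]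
  refine mul_le_mul_of_nonneg_right (Real.exp_le_exp.2 ((le_abs_self _).trans ?_))
    (Real.rpow_nonneg (norm_nonneg _) _)
  rw [abs_mul]
  exact mul_le_mul_of_nonneg_left (Complex.abs_arg_le_pi z) (abs_nonneg _)

lemma add_mul_I_ne_zero {A : ℝ} (hA : 0 < A) (v : ℝ) : (A : ℂ) + v * Complex.I ≠ 0 := by
  intro h
  have := congrArg Complex.re h
  simp at this
  exact hA.ne' this

lemma integral_gauss_real (u : ℝ) (_hu : 0 < u) :
    ∫ x : ℝ, Real.exp (-(u * x ^ 2)) = (Real.pi / u) ^ ((1 : ℝ) / 2) := by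
  have := integral_gaussian u
  simp only [neg_mul] at this
  rw [this, Real.sqrt_eq_rpow]

lemma norm_add_mul_I_rpow {A : ℝ} (v w : ℝ) :
    ‖(A : ℂ) + v * Complex.I‖ ^ (-w) = (A ^ 2 + v ^ 2) ^ (-(w / 2)) := by
  rw [Complex.norm_add_mul_I, Real.sqrt_eq_rpow, ← Real.rpow_mul (by positivity)]
  congr 1
  ring

/-- The squared norm is `A² + v²`, so this is `hasInt_power` in dimension one with exponent `w/2`.
-/
lemma hasInt_norm_rpow {w : ℝ} (hw : 1 < w) {A : ℝ} (hA : 0 < A) :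
    Integrable (fun v : ℝ => ‖(A : ℂ) + v * Complex.I‖ ^ (-w)) ∧
    ∫ v : ℝ, ‖(A : ℂ) + v * Complex.I‖ ^ (-w) =
      (Real.pi ^ ((1 : ℝ) / 2) * Real.Gamma (w / 2 - 1 / 2) / Real.Gamma (w / 2)) *
        A ^ (-(w - 1)) := by
  have h := hasInt_power (μ := (volume : Measure ℝ)) (N := fun v => v ^ 2) (D := 1)
    (by fun_prop) (fun _ => by positivity) integral_gauss_real (α := ((w / 2 : ℝ) : ℂ))
    (by rw [Complex.ofReal_re]; linarith) (by rw [Complex.ofReal_re]; linarith)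
    (B := A ^ 2) (by positivity)
  have e : ∀ v : ℝ, ((A ^ 2 + v ^ 2 : ℝ) : ℂ) ^ (-((w / 2 : ℝ) : ℂ)) =
      ((‖(A : ℂ) + v * Complex.I‖ ^ (-w) : ℝ) : ℂ) := fun v => by
    rw [norm_add_mul_I_rpow, Complex.ofReal_cpow (by positivity)]
    push_cast
    rfl
  rw [hasInt_congr e] at h
  refine ⟨by simpa using h.1.re, ?_⟩
  have h2 := h.2
  rw [integral_complex_ofReal] at h2
  apply Complex.ofReal_injective
  rw [h2]
  have e2 : ((A ^ 2 : ℝ) : ℂ) ^ (-(((w / 2 : ℝ) : ℂ) - (1 : ℝ) / 2)) =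
      ((A ^ (-(w - 1)) : ℝ) : ℂ) := by
    rw [show -(((w / 2 : ℝ) : ℂ) - (1 : ℝ) / 2) = ((-(w / 2 - 1 / 2) : ℝ) : ℂ) by
      push_cast; ring, ← Complex.ofReal_cpow (by positivity), ← Real.rpow_natCast,
      ← Real.rpow_mul hA.le]
    congr 2
    push_cast
    ring
  rw [e2, show ((w / 2 : ℝ) : ℂ) - (1 : ℝ) / 2 = ((w / 2 - 1 / 2 : ℝ) : ℂ) by push_cast; ring,
    Complex.Gamma_ofReal, Complex.Gamma_ofReal]
  push_cast [Complex.ofReal_cpow Real.pi_pos.le]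
  ring

lemma integrable_bipow {σ τ : ℂ} (h : 1 < (σ + τ).re) {A : ℝ} (hA : 0 < A) :
    Integrable fun v : ℝ => bipow σ τ ((A : ℂ) + v * Complex.I) := by
  refine Integrable.mono' ((hasInt_norm_rpow h hA).1.const_mul _)
    ((measurable_bipow σ τ).comp (by fun_prop)).aestronglyMeasurable
    (.of_forall fun v => norm_bipow_le (add_mul_I_ne_zero hA v))

lemma integral_norm_bipow_le {σ τ : ℂ} (h : 1 < (σ + τ).re) {A : ℝ} (hA : 0 < A) :
    ∫ v : ℝ, ‖bipow σ τ ((A : ℂ) + v * Complex.I)‖ ≤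
      Real.exp (|(σ - τ).im| * Real.pi) * (Real.pi ^ ((1 : ℝ) / 2) *
        Real.Gamma ((σ + τ).re / 2 - 1 / 2) / Real.Gamma ((σ + τ).re / 2)) *
        A ^ (-((σ + τ).re - 1)) := by
  rw [mul_assoc, ← (hasInt_norm_rpow h hA).2, ← integral_const_mul]
  exact integral_mono (integrable_bipow h hA).norm ((hasInt_norm_rpow h hA).1.const_mul _)
    fun v => norm_bipow_le (add_mul_I_ne_zero hA v)

lemma bipow_eq_cpow {σ τ z : ℂ} (hz : 0 < z.re) :
    bipow σ τ z = z ^ (-σ) * (conj z) ^ (-τ) := by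
  have h0 : z ≠ 0 := by rintro rfl; simp at hz
  have h1 : conj z ≠ 0 := by simpa using h0
  have harg : z.arg ≠ Real.pi := by
    have := (Complex.abs_arg_lt_pi_div_two_iff.2 (Or.inl hz))
    intro h
    rw [h, abs_of_pos Real.pi_pos] at this
    linarith [Real.pi_pos]
  rw [bipow, Complex.cpow_def_of_ne_zero h0, Complex.cpow_def_of_ne_zero h1,
    Complex.log_conj _ harg]
  congr 2 <;> ring

/-- Parseval's identity for the functions `u^(σ-1) e^(-u)` and `u^(τ-1) e^(-u)` on the half-line.
Their Fourier transforms are `Γ(σ)(1 + 2πiξ)^(-σ)` and `Γ(τ)(1 + 2πiξ)^(-τ)`. -/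
lemma integral_bipow_strip {σ τ : ℂ} (hσ : 0 < σ.re) (hτ : 1 < τ.re) :
    ∫ t : ℝ, bipow σ τ (1 + t * Complex.I) =
      2 * Real.pi * 2 ^ (1 - σ - τ) * Complex.Gamma (σ + τ - 1) *
        ((Complex.Gamma σ)⁻¹ * (Complex.Gamma τ)⁻¹) := by
  have hτ0 : 0 < τ.re := by linarith
  obtain ⟨e, he⟩ : ∃ e : ℂ → ℝ → ℂ, ∀ s, e s = Set.indicator (Set.Ioi 0)
    (fun u : ℝ => (u : ℂ) ^ (s - 1) * Complex.exp (-(1 : ℝ) * u)) := ⟨_, fun _ => rfl⟩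
  have hei : ∀ s : ℂ, 0 < s.re → Integrable (e s) := fun s hs => by
    rw [he, integrable_indicator_iff measurableSet_Ioi]
    have := (hasInt_gamma hs one_pos).1
    simpa [IntegrableOn] using this
  have hF : ∀ s : ℂ, 0 < s.re → ∀ ξ : ℝ, 𝓕 (e s) ξ =
      (1 + (2 * Real.pi * ξ : ℝ) * Complex.I) ^ (-s) * Complex.Gamma s := by
    intro s hs ξ
    rw [Real.fourier_real_eq_integral_exp_smul, ← (hasInt_gamma_complex hs
      (r := 1 + (2 * Real.pi * ξ : ℝ) * Complex.I) (by simp)).2,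
      ← integral_indicator measurableSet_Ioi]
    congr 1
    ext v
    rw [he, smul_eq_mul]
    by_cases hv : v ∈ Set.Ioi (0 : ℝ)
    · rw [Set.indicator_of_mem hv, Set.indicator_of_mem hv, mul_left_comm, ← Complex.exp_add]
      congr 2
      push_cast
      ring
    · rw [Set.indicator_of_notMem hv, Set.indicator_of_notMem hv, mul_zero]
  -- Since `1 < Re τ`, the function tends to 0 at the origin and its extension by 0 is continuous;
  -- Fourier inversion then holds at every point.
  have hcont : Continuous (e τ) := by
    have h1 : e τ = fun u : ℝ => ((max u 0 : ℝ) : ℂ) ^ (τ - 1) * Complex.exp (-(1 : ℝ) * u) := by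
      ext u
      rw [he]
      by_cases hu : u ∈ Set.Ioi (0 : ℝ)
      · rw [Set.indicator_of_mem hu, max_eq_left (le_of_lt hu)]
      · have : τ - 1 ≠ 0 := fun h => by
          have := congrArg Complex.re h
          simp at this
          linarith
        rw [Set.indicator_of_notMem hu, max_eq_right (not_lt.1 hu), Complex.ofReal_zero,
          Complex.zero_cpow this, zero_mul]
    rw [h1]
    have h2 := (Complex.continuous_ofReal_cpow_const (y := τ - 1) (by simpa using hτ)).comp
      (continuous_id.max continuous_const : Continuous fun u : ℝ => max u 0)
    exact h2.mul (by fun_prop)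
  have hpow : ∀ t : ℝ, (1 + (t : ℂ) * Complex.I) ^ (-τ) = bipow τ 0 ((1 : ℝ) + t * Complex.I) :=
    fun t => by rw [bipow_eq_cpow (by simp)]; simp
  have hFi : Integrable (𝓕 (e τ)) := by
    rw [funext (hF τ hτ0)]
    have h3 := (integrable_bipow (σ := τ) (τ := 0) (by simpa using hτ) one_pos).comp_mul_left'
      (R := 2 * Real.pi) (by positivity)
    refine Integrable.mul_const ?_ _
    simpa only [hpow] using h3
  have hinv : 𝓕 (𝓕⁻ (e τ)) = e τ := hcont.fourier_fourierInv_eq (hei τ hτ0) hFi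
  have hFinv : ∀ ξ : ℝ, 𝓕⁻ (e τ) ξ =
      (1 - (2 * Real.pi * ξ : ℝ) * Complex.I) ^ (-τ) * Complex.Gamma τ := by
    intro ξ
    rw [Real.fourierInv_eq_fourier_neg, hF τ hτ0]
    congr 2
    push_cast
    ring
  have hFinvi : Integrable (𝓕⁻ (e τ)) := by
    have : 𝓕⁻ (e τ) = fun ξ => 𝓕 (e τ) (-ξ) := by
      ext ξ; exact Real.fourierInv_eq_fourier_neg _ _
    rw [this]
    exact hFi.comp_neg
  -- Once inversion is applied, the right side is a Gamma integral with exponent `σ + τ - 1` and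
  -- rate 2.
  have hflip : ∫ ξ : ℝ, 𝓕 (e σ) ξ * 𝓕⁻ (e τ) ξ = ∫ u : ℝ, e σ u * 𝓕 (𝓕⁻ (e τ)) u := by
    simpa using! (VectorFourier.integral_fourierIntegral_smul_eq_flip (L := innerₗ ℝ)
      Real.continuous_fourierChar continuous_inner (hei σ hσ) hFinvi)
  rw [hinv] at hflip
  have hR : ∫ u : ℝ, e σ u * e τ u = ((2 : ℝ) : ℂ) ^ (-(σ + τ - 1)) *
      Complex.Gamma (σ + τ - 1) := by
    rw [← (hasInt_gamma (a := σ + τ - 1) (r := 2) (by simp; linarith) two_pos).2,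
      ← integral_indicator measurableSet_Ioi]
    congr 1
    ext u
    rw [he, he]
    by_cases hu : u ∈ Set.Ioi (0 : ℝ)
    · have hu' : (u : ℂ) ≠ 0 := Complex.ofReal_ne_zero.2 (ne_of_gt hu)
      rw [Set.indicator_of_mem hu, Set.indicator_of_mem hu, Set.indicator_of_mem hu,
        show σ + τ - 1 - 1 = (σ - 1) + (τ - 1) by ring, Complex.cpow_add _ _ hu',
        show -(((2 : ℝ) : ℂ) * u) = -(1 : ℝ) * u + -(1 : ℝ) * u by push_cast; ring,
        Complex.exp_add]
      ring
    · simp [Set.indicator_of_notMem hu]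
  have hL : ∫ ξ : ℝ, 𝓕 (e σ) ξ * 𝓕⁻ (e τ) ξ = Complex.Gamma σ * Complex.Gamma τ *
      ∫ ξ : ℝ, bipow σ τ (1 + ((2 * Real.pi * ξ : ℝ) : ℂ) * Complex.I) := by
    rw [← integral_const_mul]
    congr 1
    ext ξ
    rw [hF σ hσ, hFinv, bipow_eq_cpow (by simp)]
    simp only [map_add, map_one, map_mul, Complex.conj_ofReal, Complex.conj_I]
    rw [show (1 : ℂ) + ((2 * Real.pi * ξ : ℝ) : ℂ) * -Complex.I =
      1 - ((2 * Real.pi * ξ : ℝ) : ℂ) * Complex.I by ring]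
    ring
  have hscale := Measure.integral_comp_mul_left
    (fun t : ℝ => bipow σ τ (1 + (t : ℂ) * Complex.I)) (2 * Real.pi)
  rw [hR, hL, hscale] at hflip
  have g1 := Complex.Gamma_ne_zero_of_re_pos hσ
  have g2 := Complex.Gamma_ne_zero_of_re_pos hτ0
  have hpi : (Real.pi : ℂ) ≠ 0 := Complex.ofReal_ne_zero.2 Real.pi_pos.ne'
  rw [abs_of_pos (by positivity), Complex.real_smul] at hflip
  push_cast at hflip
  rw [show 1 - σ - τ = -(σ + τ - 1) by ring]
  generalize ∫ t : ℝ, bipow σ τ (1 + (t : ℂ) * Complex.I) = J at hflip ⊢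
  field_simp at hflip ⊢
  rw [hflip]

/-- The Cauchy beta integral at `A = 1`. -/
lemma integral_bipow_one {σ τ : ℂ} (h : 1 < (σ + τ).re) :
    ∫ t : ℝ, bipow σ τ (1 + t * Complex.I) =
      2 * Real.pi * 2 ^ (1 - σ - τ) * Complex.Gamma (σ + τ - 1) *
        ((Complex.Gamma σ)⁻¹ * (Complex.Gamma τ)⁻¹) := by
  -- For fixed `w = σ + τ` both sides are entire in `σ`: on the left `σ` enters only through
  -- `exp(-2iσ arg)` with a bounded argument, on the right through values of `1/Γ`. They agree on
  -- the strip `0 < Re σ < Re w - 1`, hence everywhere.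
  obtain ⟨w, hw⟩ : ∃ w, w = σ + τ := ⟨_, rfl⟩
  rw [← hw] at h
  have hτ : τ = w - σ := by rw [hw]; ring
  subst hτ
  set g : ℝ → ℂ := fun t => Complex.exp (-(w * conj (Complex.log (1 + t * Complex.I)))) with hg
  have hgm : Measurable g := by
    have h1 : Measurable Complex.log := Complex.measurable_log
    have h2 : Measurable (conj : ℂ → ℂ) := Complex.continuous_conj.measurable
    simp only [hg]
    fun_prop
  have ham : Measurable fun t : ℝ => Complex.arg (1 + t * Complex.I) :=
    Complex.measurable_arg.comp (by fun_prop)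
  have hgi : Integrable (fun t => ‖g t‖) := by
    have := (integrable_bipow (σ := 0) (τ := w) (by simpa using h) one_pos).norm
    refine this.congr (.of_forall fun t => ?_)
    simp [bipow, hg]
  have hexp : ∀ s : ℝ, Integrable
      (fun t : ℝ => ‖g t‖ * Real.exp (s * Complex.arg (1 + t * Complex.I))) := by
    intro s
    refine Integrable.mono' (hgi.const_mul (Real.exp (|s| * Real.pi)))
      (Measurable.aestronglyMeasurable (by fun_prop)) (.of_forall fun t => ?_)
    rw [norm_mul, norm_norm, mul_comm, Real.norm_of_nonneg (Real.exp_pos _).le]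
    refine mul_le_mul_of_nonneg_right (Real.exp_le_exp.2 ?_) (norm_nonneg _)
    refine (le_abs_self _).trans ?_
    rw [abs_mul]
    gcongr
    exact Complex.abs_arg_le_pi _
  have hd1 : Differentiable ℂ fun z : ℂ =>
      ∫ t : ℝ, g t * Complex.exp (z * Complex.arg (1 + t * Complex.I)) := fun z =>
    differentiableAt_integral_exp hgm ham one_pos (hexp _) (hexp _)
  have hf : ∀ s : ℂ, ∫ t : ℝ, bipow s (w - s) (1 + t * Complex.I) =
      ∫ t : ℝ, g t * Complex.exp ((-(2 * Complex.I * s)) * Complex.arg (1 + t * Complex.I)) := by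
    intro s
    congr 1
    ext t
    rw [hg, bipow, ← Complex.exp_add, ← Complex.exp_add]
    congr 1
    generalize (1 : ℂ) + t * Complex.I = z
    have h1 : Complex.log z - conj (Complex.log z) = 2 * z.arg * Complex.I := by
      rw [Complex.sub_conj, Complex.log_im]
      push_cast
      ring
    linear_combination (-s) * h1
  have hd2 : Differentiable ℂ fun s : ℂ => ∫ t : ℝ, bipow s (w - s) (1 + t * Complex.I) := by
    rw [funext hf]
    exact hd1.comp (by fun_prop)
  have hd3 : Differentiable ℂ fun s : ℂ =>
      2 * Real.pi * 2 ^ (1 - w) * Complex.Gamma (w - 1) *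
        ((Complex.Gamma s)⁻¹ * (Complex.Gamma (w - s))⁻¹) := by
    have h1 := Complex.differentiable_one_div_Gamma
    have h2 : Differentiable ℂ fun s : ℂ => (Complex.Gamma (w - s))⁻¹ :=
      h1.comp (by fun_prop : Differentiable ℂ fun s : ℂ => w - s)
    exact (h1.mul h2).const_mul _
  have heq := AnalyticOnNhd.eq_of_eventuallyEq
    (Complex.analyticOnNhd_univ_iff_differentiable.2 hd2)
    (Complex.analyticOnNhd_univ_iff_differentiable.2 hd3) (z₀ := (((w.re - 1) / 2 : ℝ) : ℂ)) (by
      have hU : IsOpen {s : ℂ | 0 < s.re ∧ s.re < w.re - 1} :=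
        (isOpen_lt continuous_const Complex.continuous_re).inter
          (isOpen_lt Complex.continuous_re continuous_const)
      filter_upwards [hU.mem_nhds (show (((w.re - 1) / 2 : ℝ) : ℂ) ∈ _ from by
        simp only [Set.mem_ofPred_eq, Complex.ofReal_re]
        constructor <;> linarith)] with s hs
      have := integral_bipow_strip (σ := s) (τ := w - s) hs.1 (by
        rw [Complex.sub_re]; linarith [hs.2])
      rw [this, show 1 - s - (w - s) = 1 - w by ring, show s + (w - s) - 1 = w - 1 by ring])
  have := congrFun heq σ
  rw [this, show 1 - σ - (w - σ) = 1 - w by ring, show σ + (w - σ) - 1 = w - 1 by ring]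

/-- The Cauchy beta integral. -/
lemma hasInt_bipow {σ τ : ℂ} (h : 1 < (σ + τ).re) {A : ℝ} (hA : 0 < A) :
    HasInt (fun v : ℝ => bipow σ τ ((A : ℂ) + v * Complex.I)) volume
      (2 * Real.pi * 2 ^ (1 - σ - τ) * Complex.Gamma (σ + τ - 1) *
        ((Complex.Gamma σ)⁻¹ * (Complex.Gamma τ)⁻¹) * (A : ℂ) ^ (-(σ + τ - 1))) := by
  refine ⟨integrable_bipow h hA, ?_⟩
  have hA' : (A : ℂ) ≠ 0 := Complex.ofReal_ne_zero.2 hA.ne'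
  -- Positive scalars do not affect the branch of the logarithm, so `bipow` is homogeneous under
  -- them; the substitution `v = A t` gives one further power of `A`.
  have h1 : ∀ v : ℝ, bipow σ τ ((A : ℂ) + v * Complex.I) =
      (A : ℂ) ^ (-(σ + τ)) * bipow σ τ (1 + ((A⁻¹ * v : ℝ) : ℂ) * Complex.I) := by
    intro v
    have h2 : (A : ℂ) + v * Complex.I = A * (1 + ((A⁻¹ * v : ℝ) : ℂ) * Complex.I) := by
      push_cast
      field_simp
    have h3 : (1 : ℂ) + ((A⁻¹ * v : ℝ) : ℂ) * Complex.I ≠ 0 := by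
      have := add_mul_I_ne_zero one_pos (A⁻¹ * v)
      simpa using this
    rw [h2, bipow, bipow, Complex.log_ofReal_mul hA h3, Complex.cpow_def_of_ne_zero hA',
      ← Complex.exp_add, ← Complex.exp_add, ← Complex.exp_add, ← Complex.ofReal_log hA.le]
    congr 1
    simp only [map_add, Complex.conj_ofReal]
    ring
  simp only [h1]
  rw [integral_const_mul, Measure.integral_comp_mul_left
    (fun t : ℝ => bipow σ τ (1 + (t : ℂ) * Complex.I)), integral_bipow_one h, inv_inv,
    abs_of_pos hA, Complex.real_smul, show -(σ + τ - 1) = -(σ + τ) + 1 by ring,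
    Complex.cpow_add _ _ hA', Complex.cpow_one]
  ring

/-! ### Determinants as products of pivots -/

section Blocks

variable {K R m : Type*} [DivisionRing K] [CommRing R] [Fintype m] [DecidableEq m] {p : ℕ}

/-- The block matrix obtained by applying `ρ` to all entries. -/
def blocks (ρ : K →+* Matrix m m R) (g : Matrix (Fin p) (Fin p) K) :
    Matrix (Fin p × m) (Fin p × m) R :=
  Matrix.of fun i j => ρ (g i.1 j.1) i.2 j.2

/-- Splitting off the last block. -/
def lastBlock (p : ℕ) (m : Type*) : (Fin p × m) ⊕ m ≃ Fin (p + 1) × m where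
  toFun := Sum.elim (fun a => (a.1.castSucc, a.2)) fun b => (Fin.last p, b)
  invFun a := Fin.lastCases (motive := fun _ => (Fin p × m) ⊕ m) (.inr a.2)
    (fun i => .inl (i, a.2)) a.1
  left_inv a := by rcases a with a | b <;> simp
  right_inv a := by
    obtain ⟨i, b⟩ := a
    refine Fin.lastCases ?_ (fun i => ?_) i <;> simp

/-- Multiplication by a unipotent block matrix clears the last block column. Passing to matrices
over the commutative ring `R` gives determinants a meaning for noncommutative `K`: the blocks are
1×1 over a field and real 4×4 for quaternions. -/
lemma det_blocks_succ (ρ : K →+* Matrix m m R) {g : Matrix (Fin (p + 1)) (Fin (p + 1)) K}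
    (h : minor g *ᵥ solve p (minor g) (lastCol g) = lastCol g) :
    (blocks ρ g).det = (blocks ρ (minor g)).det * (ρ (schur g)).det := by
  set x := solve p (minor g) (lastCol g) with hx
  set B : Matrix (Fin p × m) m R := Matrix.of fun i b => ρ (lastCol g i.1) i.2 b with hB
  set C : Matrix m (Fin p × m) R := Matrix.of fun a j => ρ (lastRow g j.1) a j.2 with hC
  set X : Matrix (Fin p × m) m R := Matrix.of fun i b => ρ (x i.1) i.2 b with hX
  have h1 : (blocks ρ g).submatrix (lastBlock p m) (lastBlock p m) =
      fromBlocks (blocks ρ (minor g)) B C (ρ (g (Fin.last p) (Fin.last p))) := by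
    ext i j
    rcases i with i | i <;> rcases j with j | j <;> rfl
  have h2 : blocks ρ (minor g) * X = B := by
    ext i b
    rw [hB, Matrix.of_apply, ← h]
    simp [blocks, Matrix.mul_apply, hX, mulVec, dotProduct, Fintype.sum_prod_type,
      Matrix.sum_apply]
  have h3 : C * X = ρ (lastRow g ⬝ᵥ x) := by
    ext a b
    simp [Matrix.mul_apply, hX, hC, dotProduct, Fintype.sum_prod_type, Matrix.sum_apply]
  have h4 : fromBlocks (blocks ρ (minor g)) B C (ρ (g (Fin.last p) (Fin.last p))) *
      fromBlocks 1 (-X) 0 1 = fromBlocks (blocks ρ (minor g)) 0 C (ρ (schur g)) := by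
    rw [fromBlocks_multiply]
    simp only [Matrix.mul_one, Matrix.mul_zero, add_zero, Matrix.mul_neg, h2, h3, neg_add_cancel]
    rw [schur, map_sub, neg_add_eq_sub]
  have h5 := congrArg det h4
  rw [det_mul, det_fromBlocks_zero₂₁, det_fromBlocks_zero₁₂, det_one, det_one, one_mul,
    mul_one, ← h1, det_submatrix_equiv_self] at h5
  exact h5

end Blocks

section BlocksDiss

variable {K R m : Type*} [NormedDivisionRing K] [NormedAlgebra ℝ K] [StarRing K] [ReField K]
  [CommRing R] [Fintype m] [DecidableEq m] {p : ℕ}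

lemma det_blocks (ρ : K →+* Matrix m m R) {g : Matrix (Fin p) (Fin p) K} (hg : Diss g) :
    (blocks ρ g).det = ∏ k, (ρ (piv g k)).det := by
  induction p with
  | zero => simp [Matrix.det_isEmpty]
  | succ p ih =>
    rw [det_blocks_succ ρ (hg.minor.mulVec_solve _), ih hg.minor, Fin.prod_univ_castSucc]
    rfl

end BlocksDiss

section Field

variable {K : Type*} [NormedField K] [NormedAlgebra ℝ K] [StarRing K] [ReField K] {p : ℕ}

lemma det_eq_prod_piv {g : Matrix (Fin p) (Fin p) K} (hg : Diss g) : g.det = ∏ k, piv g k := by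
  have h1 := det_blocks (scalar (α := K) Unit) hg
  have h2 : g = (blocks (scalar (α := K) Unit) g).submatrix (Equiv.prodUnique (Fin p) Unit).symm
      (Equiv.prodUnique (Fin p) Unit).symm := by
    ext i j; simp [blocks]
  rw [h2, det_submatrix_equiv_self, h1, ← h2]
  simp

lemma det_succ_eq {g : Matrix (Fin (p + 1)) (Fin (p + 1)) K} (hg : Diss g) :
    g.det = (minor g).det * schur g := by
  rw [det_eq_prod_piv hg, det_eq_prod_piv hg.minor, Fin.prod_univ_castSucc]
  rfl

end Field

/-! ### The three division rings. -/

instance : ReField ℝ where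
  re := ContinuousLinearMap.id ℝ ℝ
  add_star x := by simp [two_mul]
  star_mul_self x := by simp [sq]
  star_algebraMap r := by simp

instance : ReField ℂ where
  re := Complex.reCLM
  add_star x := by simpa using! Complex.add_conj x
  star_mul_self x := by simpa using! Complex.conj_mul' x
  star_algebraMap r := by simp

instance : ReField (Quaternion ℝ) where
  re := LinearMap.toContinuousLinearMap
    { toFun := fun x => x.re
      map_add' := fun _ _ => rfl
      map_smul' := fun _ _ => rfl }
  add_star x := by simpa using! Quaternion.self_add_star x
  star_mul_self x := by
    rw [Quaternion.star_mul_self, Quaternion.normSq_eq_norm_mul_self, sq]; rfl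
  star_algebraMap r := by simp

@[simp] lemma re_real (x : ℝ) : re x = x := rfl

@[simp] lemma re_complex (x : ℂ) : re x = x.re := rfl

@[simp] lemma re_quaternion (x : Quaternion ℝ) : re x = x.re := rfl

lemma diss_one {K : Type*} [NormedDivisionRing K] [NormedAlgebra ℝ K] [StarRing K] [ReField K]
    {p : ℕ} : Diss (1 : Matrix (Fin p) (Fin p) K) := by
  intro x hx
  rw [qf, one_mulVec, re_star_dot_self]
  obtain ⟨i, hi⟩ := Function.ne_iff.1 hx
  exact Finset.sum_pos' (fun _ _ => by positivity)
    ⟨i, Finset.mem_univ _, by have := norm_pos_iff.2 hi; positivity⟩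

/-! ### The logarithm of the determinant -/

section LogDet

variable {p : ℕ}

/-- For `u ≠ 0` this is, up to the factor `(-u)^p`, the characteristic polynomial at `-(w / u)`,
which splits over ℂ. -/
lemma det_add_smul (g : Matrix (Fin p) (Fin p) ℂ) (w u : ℂ) :
    (w • (1 : Matrix (Fin p) (Fin p) ℂ) + u • g).det =
      (g.charpoly.roots.map fun μ => w + u * μ).prod := by
  have hs : g.charpoly.Splits := IsAlgClosed.splits _
  have hc : g.charpoly.roots.card = p := by
    rw [← hs.natDegree_eq_card_roots, charpoly_natDegree_eq_dim, Fintype.card_fin]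
  by_cases hu : u = 0
  · simp [hu, hc]
  have h1 : w • (1 : Matrix (Fin p) (Fin p) ℂ) + u • g = (-u) • (scalar (Fin p) (-(w / u)) - g) := by
    rw [smul_sub, scalar_apply, ← smul_one_eq_diagonal, smul_smul, neg_smul, sub_neg_eq_add]
    congr 2
    field_simp
  rw [h1, det_smul, ← eval_charpoly, hs.eval_eq_prod_roots_of_monic (charpoly_monic g),
    Fintype.card_fin]
  have h2 : (-u) ^ p = (g.charpoly.roots.map fun _ => -u).prod := by
    rw [Multiset.map_const', Multiset.prod_replicate, hc]
  rw [h2, ← Multiset.prod_map_mul]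
  congr 1
  refine Multiset.map_congr rfl fun μ _ => ?_
  field_simp
  ring

/-- At an eigenvector `v` the form of `g` equals `Re μ · |v|²`. -/
lemma re_root_pos {g : Matrix (Fin p) (Fin p) ℂ} (hg : Diss g) {μ : ℂ}
    (hμ : μ ∈ g.charpoly.roots) : 0 < μ.re := by
  have h1 : Module.End.HasEigenvalue g.toLin' μ := by
    rw [Module.End.hasEigenvalue_iff_isRoot_charpoly, charpoly_toLin']
    exact Polynomial.isRoot_of_mem_roots hμ
  obtain ⟨v, hv⟩ := h1.exists_hasEigenvector
  have h2 : g *ᵥ v = μ • v := hv.apply_eq_smul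
  have h3 := hg v hv.2
  rw [qf, h2, dotProduct_smul, smul_eq_mul, star_dot_self] at h3
  have h4 : 0 ≤ nsq v := Finset.sum_nonneg fun _ _ => by positivity
  simp only [re_complex, Complex.coe_algebraMap, Complex.mul_re, Complex.ofReal_re,
    Complex.ofReal_im, mul_zero, sub_zero] at h3
  exact pos_of_mul_pos_left h3 h4

/-- The segment from the unit matrix to `g`. -/
def segment (g : Matrix (Fin p) (Fin p) ℂ) (u : ℝ) : Matrix (Fin p) (Fin p) ℂ :=
  ((1 - u : ℝ) : ℂ) • 1 + (u : ℂ) • g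

lemma Diss.segment {g : Matrix (Fin p) (Fin p) ℂ} (hg : Diss g) {u : ℝ}
    (hu : u ∈ Set.Icc (0 : ℝ) 1) :
    Diss (segment g u) := by
  intro x hx
  have h1 := hg x hx
  have h2 := diss_one (K := ℂ) x hx
  have h3 : qf (SectionOfWedge.segment g u) x =
      (1 - u) * qf 1 x + u * qf g x := by
    simp only [qf, SectionOfWedge.segment, add_mulVec, smul_mulVec, dotProduct_add, dotProduct_smul, smul_eq_mul,
      re_complex, Complex.add_re, Complex.re_ofReal_mul]
  rw [h3]
  rcases eq_or_lt_of_le hu.1 with h | h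
  · rw [← h]; simpa using h2
  · have := hu.2
    have h4 : 0 ≤ (1 - u) * qf 1 x := mul_nonneg (by linarith) h2.le
    have h5 : 0 < u * qf g x := mul_pos h h1
    linarith

lemma re_segment_pos {μ : ℂ} (hμ : 0 < μ.re) {u : ℝ} (hu : u ∈ Set.Icc (0 : ℝ) 1) :
    0 < (((1 - u : ℝ) : ℂ) + (u : ℂ) * μ).re := by
  rw [Complex.add_re, Complex.ofReal_re, Complex.re_ofReal_mul]
  rcases eq_or_lt_of_le hu.1 with h | h
  · rw [← h]; simp
  · have := mul_pos h hμ
    linarith [hu.2]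

/-- `∑ ln ((1 - u) + u μ)` over the eigenvalues `μ`. -/
def logSum (g : Matrix (Fin p) (Fin p) ℂ) (u : ℝ) : ℂ :=
  (g.charpoly.roots.map fun μ => Complex.log (((1 - u : ℝ) : ℂ) + (u : ℂ) * μ)).sum

lemma exp_logSum {g : Matrix (Fin p) (Fin p) ℂ} (hg : Diss g) {u : ℝ}
    (hu : u ∈ Set.Icc (0 : ℝ) 1) : Complex.exp (logSum g u) = (segment g u).det := by
  rw [segment, det_add_smul, logSum, Complex.exp_multiset_sum, Multiset.map_map]
  congr 1
  refine Multiset.map_congr rfl fun μ hμ => Complex.exp_log fun h => ?_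
  have := re_segment_pos (re_root_pos hg hμ) hu
  rw [h] at this
  simp at this

lemma continuousOn_logSum {g : Matrix (Fin p) (Fin p) ℂ} (hg : Diss g) :
    ContinuousOn (logSum g) (Set.Icc 0 1) := by
  unfold logSum
  refine continuousOn_multiset_sum _ fun μ hμ => ?_
  refine ContinuousOn.clog (by fun_prop) fun u hu => Or.inl ?_
  exact re_segment_pos (re_root_pos hg hμ) hu

/-- The values lie in the discrete set `2πiℤ`, so a continuous function on an interval cannot
change. -/
lemma eq_of_exp_eq_one {D : ℝ → ℂ} (hD : ContinuousOn D (Set.Icc 0 1))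
    (h : ∀ u ∈ Set.Icc (0 : ℝ) 1, Complex.exp (D u) = 1) : D 1 = D 0 := by
  have hm : ∀ u ∈ Set.Icc (0 : ℝ) 1, ∃ n : ℤ, D u = n * (2 * Real.pi * Complex.I) :=
    fun u hu => Complex.exp_eq_one_iff.1 (h u hu)
  have h1 := isPreconnected_Icc.constant_of_mapsTo (S := Set.Icc (0 : ℝ) 1)
    (T := Set.range ((↑) : ℤ → ℝ)) Int.isClosedEmbedding_coe_real.isEmbedding.isDiscrete_range
    (f := fun u => (D u).im / (2 * Real.pi))
    ((Complex.continuous_im.comp_continuousOn hD).div_const _) (by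
      intro u hu
      obtain ⟨n, hn⟩ := hm u hu
      refine ⟨n, ?_⟩
      simp only [hn]
      rw [eq_div_iff (by positivity)]
      simp)
    (x := 1) (y := 0) (by simp) (by simp)
  obtain ⟨n, hn⟩ := hm 1 (by simp)
  obtain ⟨k, hk⟩ := hm 0 (by simp)
  have him : ∀ l : ℤ, ((l : ℂ) * (2 * Real.pi * Complex.I)).im / (2 * Real.pi) = l := fun l => by
    rw [div_eq_iff (by positivity)]
    simp
  simp only [hn, hk, him] at h1
  rw [hn, hk, Int.cast_injective h1]

/-- The exponentials agree, so the two sides differ by an element of `2πiℤ`. Along the segment from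
the unit matrix to `g` all eigenvalues and Schur complements stay in the right half-plane, so the
difference is continuous, and it vanishes at the unit matrix. -/
lemma logDet_succ {g : Matrix (Fin (p + 1)) (Fin (p + 1)) ℂ} (hg : Diss g) :
    logDet g = logDet (minor g) + Complex.log (schur g) := by
  have hmin : ∀ u, minor (segment g u) = segment (minor g) u := fun u => by
    ext i j
    simp [segment, minor, Matrix.one_apply]
  have hsc : ∀ u ∈ Set.Icc (0 : ℝ) 1, schur (segment g u) = (segment g u).det / (segment (minor g) u).det := by
    intro u hu
    have h1 := det_succ_eq (hg.segment hu)
    have h2 : (segment (minor g) u).det ≠ 0 := by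
      rw [← exp_logSum hg.minor hu]
      exact Complex.exp_ne_zero _
    rw [eq_div_iff h2, mul_comm, ← hmin]
    exact h1.symm
  have hcS : ∀ {n : ℕ} (g : Matrix (Fin n) (Fin n) ℂ), Continuous fun u => (segment g u).det :=
    fun g => Continuous.matrix_det (by unfold segment; fun_prop)
  have h := eq_of_exp_eq_one
    (D := fun u => logSum g u - logSum (minor g) u - Complex.log (schur (segment g u))) (by
      refine ((continuousOn_logSum hg).sub (continuousOn_logSum hg.minor)).sub ?_
      refine ContinuousOn.clog ?_ fun u hu => Or.inl (hg.segment hu).re_schur_pos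
      refine ContinuousOn.congr ?_ hsc
      refine (hcS g).continuousOn.div (hcS _).continuousOn fun u hu => ?_
      rw [← exp_logSum hg.minor hu]
      exact Complex.exp_ne_zero _) (by
      intro u hu
      have h2 : (segment (minor g) u).det ≠ 0 := by
        rw [← exp_logSum hg.minor hu]
        exact Complex.exp_ne_zero _
      have h3 : (segment g u).det ≠ 0 := by
        rw [← exp_logSum hg hu]
        exact Complex.exp_ne_zero _
      rw [Complex.exp_sub, Complex.exp_sub, exp_logSum hg hu, exp_logSum hg.minor hu,
        Complex.exp_log (hg.segment hu).schur_ne_zero, hsc u hu]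
      exact div_self (div_ne_zero h3 h2))
  have h0 : schur (segment g 0) = 1 := by
    rw [hsc 0 (by simp)]
    simp [segment]
  have h1 : segment g 1 = g := by simp [segment]
  have hl : ∀ {n : ℕ} (g : Matrix (Fin n) (Fin n) ℂ), logSum g 1 = logDet g ∧ logSum g 0 = 0 :=
    fun g => by simp [logSum, logDet]
  simp only [h0, h1, hl, Complex.log_one, sub_zero] at h
  linear_combination h

lemma logDet_eq_sum {g : Matrix (Fin p) (Fin p) ℂ} (hg : Diss g) :
    logDet g = ∑ k, Complex.log (piv g k) := by
  induction p with
  | zero => simp [logDet]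
  | succ p ih =>
    rw [logDet_succ hg, ih hg.minor, Fin.sum_univ_castSucc]
    rfl

end LogDet

/-! ### Quaternionic determinants -/

section QuatDet

variable {p : ℕ}

/-- The coordinates of a quaternion. -/
def quatEquiv : Quaternion ℝ ≃ₗ[ℝ] (Fin 4 → ℝ) where
  toFun x := ![x.re, x.imI, x.imJ, x.imK]
  invFun := quat
  map_add' x y := by ext i; fin_cases i <;> rfl
  map_smul' r x := by ext i; fin_cases i <;> rfl
  left_inv x := rfl
  right_inv v := by ext i; fin_cases i <;> rfl

lemma quatEquiv_apply (x : Quaternion ℝ) : quatEquiv x = ![x.re, x.imI, x.imJ, x.imK] := rfl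

/-- The standard basis of the quaternions. -/
def quatBasis : Module.Basis (Fin 4) ℝ (Quaternion ℝ) := .ofEquivFun quatEquiv

/-- Left multiplication in the standard basis. -/
def leftMul : Quaternion ℝ →+* Matrix (Fin 4) (Fin 4) ℝ :=
  (Algebra.leftMulMatrix quatBasis).toRingHom

lemma leftMul_apply (x : Quaternion ℝ) (i j : Fin 4) :
    leftMul x i j = quatEquiv (x * quat (Pi.single j 1)) i := by
  change Algebra.leftMulMatrix quatBasis x i j = _
  rw [Algebra.leftMulMatrix_eq_repr_mul, quatBasis, Module.Basis.ofEquivFun_repr_apply,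
    Module.Basis.coe_ofEquivFun]
  rfl

lemma det_leftMul (x : Quaternion ℝ) : (leftMul x).det = ‖x‖ ^ 4 := by
  have h : leftMul x = !![x.re, -x.imI, -x.imJ, -x.imK; x.imI, x.re, -x.imK, x.imJ;
      x.imJ, x.imK, x.re, -x.imI; x.imK, -x.imJ, x.imI, x.re] := by
    ext i j
    rw [leftMul_apply]
    fin_cases i <;> fin_cases j <;> simp [quatEquiv_apply] <;> simp [quat]
  have h2 : ‖x‖ ^ 4 = (x.re ^ 2 + x.imI ^ 2 + x.imJ ^ 2 + x.imK ^ 2) ^ 2 := by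
    rw [← Quaternion.normSq_def', Quaternion.normSq_eq_norm_mul_self]
    ring
  rw [h, h2]
  simp [Matrix.det_succ_row_zero, Fin.sum_univ_succ,
    show Fin.succAbove (1 : Fin 4) 2 = 3 from rfl, show Fin.succAbove (2 : Fin 4) 2 = 3 from rfl,
    show Fin.succAbove (3 : Fin 4) 2 = 2 from rfl]
  ring

lemma det_quatOp (g : Matrix (Fin p) (Fin p) (Quaternion ℝ)) :
    LinearMap.det (quatOp g) = (blocks leftMul g).det := by
  rw [← LinearMap.det_toMatrix ((Pi.basis fun _ : Fin p => quatBasis).reindex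
    (Equiv.sigmaEquivProd (Fin p) (Fin 4)))]
  congr 1
  ext i j
  rw [LinearMap.toMatrix_apply]
  simp only [quatOp, blocks, leftMul_apply, quatBasis]
  simp
  rfl

/-- Left multiplication by a pivot `s` has real determinant `‖s‖⁴`, and the fourth root is taken. -/
lemma quatDet_eq_prod {g : Matrix (Fin p) (Fin p) (Quaternion ℝ)} (hg : Diss g) :
    quatDet g = ∏ k, ‖piv g k‖ := by
  rw [quatDet, det_quatOp, det_blocks leftMul hg]
  simp only [det_leftMul]
  rw [Finset.prod_pow, ← Real.rpow_natCast, ← Real.rpow_mul (Finset.prod_nonneg fun _ _ =>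
    norm_nonneg _)]
  norm_num

end QuatDet

/-! ### Products over the leading blocks -/

section Telescope

variable {p : ℕ}

/-- Abel summation; the boundary term vanishes because the parameter after the last one is 0. -/
lemma sum_gap (l a : Fin p → ℂ) :
    ∑ j : Fin p, (∑ i : Fin (j.val + 1), l (Fin.castLE (Nat.succ_le_of_lt j.isLt) i)) * gap a j =
      ∑ k, l k * a k := by
  set a' : ℕ → ℂ := fun n => if h : n < p then a ⟨n, h⟩ else 0 with ha
  set l' : ℕ → ℂ := fun n => if h : n < p then l ⟨n, h⟩ else 0 with hl
  have h1 : ∀ n, ∑ j ∈ Finset.range n, (∑ i ∈ Finset.range (j + 1), l' i) * (a' j - a' (j + 1)) =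
      ∑ j ∈ Finset.range n, l' j * a' j - (∑ i ∈ Finset.range n, l' i) * a' n := by
    intro n
    induction n with
    | zero => simp
    | succ n ih =>
      rw [Finset.sum_range_succ, ih, Finset.sum_range_succ (fun j => l' j * a' j),
        Finset.sum_range_succ l']
      ring
  have h2 := h1 p
  rw [show a' p = 0 by simp [ha], mul_zero, sub_zero, Finset.sum_range, Finset.sum_range] at h2
  convert h2 using 1
  · refine Finset.sum_congr rfl fun j _ => ?_
    rw [Finset.sum_range]
    congr 1
    · refine Finset.sum_congr rfl fun i _ => ?_
      simp [hl, lt_of_lt_of_le i.isLt (Nat.succ_le_of_lt j.isLt), Fin.castLE]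
    · simp [ha, gap]
  · refine Finset.sum_congr rfl fun j _ => ?_
    simp [hl, ha]

/-- Working with logarithms `l` rather than with powers avoids any question of branches for the
complex pivots. -/
lemma prod_exp_gap (l a : Fin p → ℂ) :
    ∏ j : Fin p, Complex.exp
      ((∑ i : Fin (j.val + 1), l (Fin.castLE (Nat.succ_le_of_lt j.isLt) i)) * gap a j) =
      ∏ k, Complex.exp (l k * a k) := by
  rw [← Complex.exp_sum, sum_gap, Complex.exp_sum]

lemma ofReal_prod_cpow {n : ℕ} {x : Fin n → ℝ} (hx : ∀ i, 0 < x i) (w : ℂ) :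
    ((∏ i, x i : ℝ) : ℂ) ^ w = Complex.exp ((∑ i, (Real.log (x i) : ℂ)) * w) := by
  have h0 : 0 < ∏ i, x i := Finset.prod_pos fun i _ => hx i
  rw [Complex.cpow_def_of_ne_zero (Complex.ofReal_ne_zero.2 h0.ne'), ← Complex.ofReal_log h0.le,
    Real.log_prod fun i _ => (hx i).ne']
  push_cast
  rfl

/-- The product of powers of the determinants of the leading blocks. -/
lemma prod_cpow_gap {x : Fin p → ℝ} (hx : ∀ i, 0 < x i) (a : Fin p → ℂ) :
    ∏ j : Fin p,
      ((∏ i : Fin (j.val + 1), x (Fin.castLE (Nat.succ_le_of_lt j.isLt) i) : ℝ) : ℂ) ^ gap a j =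
      ∏ k, (x k : ℂ) ^ a k := by
  simp only [ofReal_prod_cpow fun i => hx _]
  rw [prod_exp_gap fun k => (Real.log (x k) : ℂ)]
  refine Finset.prod_congr rfl fun k _ => ?_
  rw [Complex.cpow_def_of_ne_zero (Complex.ofReal_ne_zero.2 (hx k).ne'),
    ← Complex.ofReal_log (hx k).le]

lemma ofReal_prod_cpow_const {n : ℕ} {x : Fin n → ℝ} (hx : ∀ i, 0 < x i) (w : ℂ) :
    ((∏ i, x i : ℝ) : ℂ) ^ w = ∏ i, (x i : ℂ) ^ w := by
  rw [ofReal_prod_cpow hx, Finset.sum_mul, Complex.exp_sum]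
  refine Finset.prod_congr rfl fun k _ => ?_
  rw [Complex.cpow_def_of_ne_zero (Complex.ofReal_ne_zero.2 (hx k).ne'),
    ← Complex.ofReal_log (hx k).le]

lemma piv_lead {K : Type*} [DivisionRing K] (g : Matrix (Fin p) (Fin p) K) (j : Fin p)
    (i : Fin (j.val + 1)) :
    piv (lead g j) i = piv g (Fin.castLE (Nat.succ_le_of_lt j.isLt) i) := rfl

end Telescope

/-! ### Integrals of powers of the pivots -/

section Powers

variable {K : Type*} [NormedDivisionRing K] [NormedAlgebra ℝ K] [StarRing K] [ReField K]
variable [MeasureSpace K] [BorelSpace K] [SecondCountableTopology K] [FiniteDimensional ℝ K]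
variable [(volume : Measure K).IsAddHaarMeasure]
variable {F : Type*} [AddCommGroup F] [MeasureSpace F] [MeasurableAdd₂ F] [ImCoord K F]
variable [SigmaFinite (volume : Measure F)] [(volume : Measure F).IsAddLeftInvariant]
variable {p r : ℕ}

lemma diss_coordT_iff (x : Coord K F p r) : Diss (coordT x) ↔ ∀ k, 0 < (pivots x k).1 :=
  diss_iff_piv (coordT_isHermitian x)

lemma measurableSet_diss : MeasurableSet {x : Coord K F p r | Diss (coordT x)} := by
  simp only [diss_coordT_iff]
  rw [Set.ofPred_forall]
  exact MeasurableSet.iInter fun k =>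
    measurableSet_lt measurable_const (measurable_pivots k).fst

/-- On the domain of positivity, products of powers of the pivots of `M - L L*` and of functions
of the pivots of `1 + M + N` are integrated factor by factor. -/
theorem hasInt_pivot_powers {d : ℕ} (hd : Module.finrank ℝ K = d)
    (hK : ∀ u : ℝ, 0 < u → ∫ x : K, Real.exp (-(u * ‖x‖ ^ 2)) = (Real.pi / u) ^ ((d : ℝ) / 2))
    (lam : Fin p → ℂ) (χ : Fin p → K → ℂ) (hχ : ∀ k, Measurable (χ k)) (C α : Fin p → ℂ)
    (C' : Fin p → ℝ) (ha : ∀ k, 0 < (lam k - d * (p + r + (k + 1)) / 2 + 1).re)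
    (hα : ∀ k, 0 < (α k).re)
    (haα : ∀ k : Fin p, 0 <
      (α k - (lam k - d * (p + r + (k + 1)) / 2 + 1) - (d * (2 * k + r)) / 2).re)
    (hφ : ∀ k : Fin p, ∀ A : ℝ, 0 < A → HasInt (fun v : F =>
      χ k (algebraMap ℝ K A + ImCoord.emb v) *
        (‖algebraMap ℝ K A + ImCoord.emb v‖ : ℂ) ^ (d * (p - 1 - k.val))) volume
      (C k * (A : ℂ) ^ (-α k)))
    (hφ' : ∀ k : Fin p, ∀ A : ℝ, 0 < A → ∫ v : F,
      ‖χ k (algebraMap ℝ K A + ImCoord.emb v) *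
        (‖algebraMap ℝ K A + ImCoord.emb v‖ : ℂ) ^ (d * (p - 1 - k.val))‖ ≤
      C' k * A ^ (-(α k).re))
    {f : Coord K F p r → ℂ} (hf : ∀ x, Diss (coordT x) → f x =
      ∏ k, ((re (piv (coordT x) k) : ℂ) ^ (lam k - d * (p + (p + r)) / 2) *
        χ k (piv (coordR x) k))) :
    HasInt f (volume.restrict {x : Coord K F p r | Diss (coordT x)})
      (∏ k : Fin p, (C k * ((Real.pi : ℂ) ^ ((d * (2 * k + r) : ℂ) / 2) *
        Complex.Gamma (lam k - d * (p + r + (k + 1)) / 2 + 1) *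
        Complex.Gamma (α k - (lam k - d * (p + r + (k + 1)) / 2 + 1) -
          (d * (2 * k + r) : ℂ) / 2) / Complex.Gamma (α k)))) := by
  set g : Fin p → ℝ × K → ℂ := fun k w =>
    if 0 < w.1 then (w.1 : ℂ) ^ (lam k - d * (p + (p + r)) / 2) * χ k w.2 else 0 with hg
  have hgm : ∀ k, Measurable (g k) := fun k => by
    have h1 : Measurable fun w : ℝ × K => χ k w.2 := (hχ k).comp measurable_snd
    exact Measurable.ite (measurableSet_lt measurable_const measurable_fst)
      (((Complex.measurable_ofReal.comp measurable_fst).pow_const _).mul h1) measurable_const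
  have h0 : ∀ k w, w.1 ≤ 0 → g k w = 0 := fun k w hw => if_neg (not_lt.2 hw)
  -- The weights raise the exponent of ρ by `d(p - 1 - k)/2` and multiply `χ` by `‖s‖^(d(p - 1 -
  -- k))`.
  have hwt : ∀ k w, g k w * (weight K w : ℂ) ^ (p - 1 - k.val) =
      if 0 < w.1 then (w.1 : ℂ) ^ (lam k - d * (p + r + (k + 1)) / 2 + 1 - 1) *
        (χ k w.2 * (‖w.2‖ : ℂ) ^ (d * (p - 1 - k.val))) else 0 := by
    intro k w
    simp only [hg]
    split_ifs with hw
    · have hw' : (w.1 : ℂ) ≠ 0 := Complex.ofReal_ne_zero.2 hw.ne'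
      have hk : ((p - 1 - k.val : ℕ) : ℂ) = p - 1 - k := by
        have := k.isLt
        rw [Nat.cast_sub (by omega), Nat.cast_sub (by omega)]
        simp
      have h1 : (weight K w : ℂ) ^ (p - 1 - k.val) =
          (w.1 : ℂ) ^ ((d * (p - 1 - k) : ℂ) / 2) * (‖w.2‖ : ℂ) ^ (d * (p - 1 - k.val)) := by
        rw [weight, hd, Complex.ofReal_pow, ← pow_mul, Complex.ofReal_mul, mul_pow,
          Real.sqrt_eq_rpow, Complex.ofReal_cpow hw.le, ← Complex.cpow_mul_nat]
        congr 2
        push_cast [hk]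
        ring
      rw [h1, show lam k - d * (p + r + (k + 1)) / 2 + 1 - 1 =
        (lam k - d * (p + (p + r)) / 2) + (d * (p - 1 - k) : ℂ) / 2 by ring,
        Complex.cpow_add _ _ hw']
      ring
    · rw [zero_mul]
  have hJ := hasInt_prod_pivots (F := F) (r := r) g hgm h0 _ fun k => by
    rw [hasInt_congr (hwt k)]
    have h2 := haα k
    have h3 : ((d * (2 * k + r) : ℂ) / 2).re = (d : ℝ) * (2 * (k : ℕ) + r) / 2 := by
      rw [show (d * (2 * k + r) : ℂ) / 2 = ((((d : ℝ) * (2 * (k : ℕ) + r) / 2 : ℝ)) : ℂ) by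
        push_cast; ring, Complex.ofReal_re]
    rw [Complex.sub_re, h3] at h2
    have h4 := hasInt_model (F := F) (p := k) (r := r) (d := (d : ℝ)) hK
      (φ := fun s => χ k s * (‖s‖ : ℂ) ^ (d * (p - 1 - k.val)))
      ((hχ k).mul (by fun_prop)) (C := C k) (C' := C' k) (ha k) (hα k) (by linarith) (hφ k)
      (hφ' k)
    exact h4
  have hzero : ∀ x : Coord K F p r, x ∉ {x : Coord K F p r | Diss (coordT x)} →
      ∏ k, g k (pivots x k) = 0 := by
    intro x hx
    rw [Set.mem_ofPred_eq, diss_coordT_iff] at hx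
    push Not at hx
    obtain ⟨k, hk⟩ := hx
    exact Finset.prod_eq_zero (Finset.mem_univ k) (h0 k _ hk)
  rw [← hasInt_restrict hzero] at hJ
  refine hJ.congr_ae ?_
  rw [Filter.EventuallyEq, ae_restrict_iff' measurableSet_diss]
  refine .of_forall fun x hx => ?_
  rw [hf x hx]
  refine Finset.prod_congr rfl fun k _ => ?_
  exact if_pos ((diss_coordT_iff x).1 hx k)

end Powers

/-! ### Domains -/

section Domains

lemma half_smul_add {K : Type*} [NormedDivisionRing K] [NormedAlgebra ℝ K] [StarRing K] {p : ℕ}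
    {M N : Matrix (Fin p) (Fin p) K} (hM : M.IsHermitian) (hN : Nᴴ = -N) :
    (1 / 2 : ℝ) • ((M + N) + (M + N)ᴴ) = M := by
  rw [conjTranspose_add, hM.eq, hN, show M + N + (M + -N) = (2 : ℝ) • M by rw [two_smul]; abel,
    smul_smul]
  norm_num

lemma posDef_iff_diss_real {p : ℕ} {T : Matrix (Fin p) (Fin p) ℝ} (hT : T.IsHermitian) :
    T.PosDef ↔ Diss T := by
  rw [posDef_iff_dotProduct_mulVec]
  exact ⟨fun h x hx => h.2 hx, fun h => ⟨hT, fun x hx => h x hx⟩⟩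

lemma posDef_iff_diss_complex {p : ℕ} {T : Matrix (Fin p) (Fin p) ℂ} (hT : T.IsHermitian) :
    T.PosDef ↔ Diss T := by
  rw [posDef_iff_dotProduct_mulVec]
  refine ⟨fun h x hx => (Complex.pos_iff.1 (h.2 hx)).1, fun h => ⟨hT, fun x hx =>
    Complex.pos_iff.2 ⟨h x hx, ?_⟩⟩⟩
  -- Positivity in the order on ℂ includes a vanishing imaginary part, which hermiticity supplies.
  have h1 : star (star x ⬝ᵥ T *ᵥ x) = star x ⬝ᵥ T *ᵥ x := by
    rw [← star_dotProduct, hT.star_dot_mulVec]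
  have := congrArg Complex.im h1
  simp only [Complex.star_def, Complex.conj_im] at this
  linarith

/-- One condition tests rows and the other columns; the involution exchanges them. -/
lemma quatPosDef_iff_diss {p : ℕ} {T : Matrix (Fin p) (Fin p) (Quaternion ℝ)}
    (hT : T.IsHermitian) : QuatPosDef T ↔ Diss T := by
  refine ⟨fun h x hx => ?_, fun h => ⟨hT, fun x hx => ?_⟩⟩
  · have := h.2 (star x) (star_ne_zero.2 hx)
    rwa [star_star] at this
  · have := h (star x) (star_ne_zero.2 hx)
    rwa [qf, star_star] at this

lemma hasInt_preimage {α β : Type*} [MeasureSpace α] [MeasureSpace β] {φ : α → β}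
    (hφ : MeasurePreserving φ) {D : Set β} (hD : MeasurableSet D) {f : β → ℂ} {I : ℂ}
    (h : HasInt f (volume.restrict D) I) :
    HasInt (fun x => f (φ x)) (volume.restrict (φ ⁻¹' D)) I :=
  (hasInt_comp (hφ.restrict_preimage hD) h.1.aestronglyMeasurable).2 h

end Domains

/-! ### The real case -/

section Real

/-- Imaginary parts form a zero-dimensional space, which lets the real case follow the general
scheme. -/
instance : ImCoord ℝ (Fin 0 → ℝ) where
  emb := 0
  im _ := 0
  measurable_emb := measurable_const
  re_emb _ := rfl
  re_add_im _ := add_zero _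

/-- Insert the trivial diagonal of a real skew-symmetric matrix. -/
def realCoord {p q : ℕ} (x : CoordReal p q) : Coord ℝ (Fin 0 → ℝ) p (q - p) :=
  (x.1, x.2.1, 0, x.2.2.1, x.2.2.2)

lemma measurePreserving_insert {α β γ : Type*} [MeasureSpace α] [MeasureSpace β] [MeasureSpace γ]
    [SFinite (volume : Measure α)] [SFinite (volume : Measure β)] [SFinite (volume : Measure γ)]
    (c : γ) (h : (volume : Measure γ) = Measure.dirac c) :
    MeasurePreserving (fun x : α × β => ((x.1, c, x.2) : α × γ × β)) := by
  have h1 : MeasurePreserving (fun x : β => ((c, x) : γ × β)) := by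
    refine ⟨by fun_prop, ?_⟩
    rw [Measure.volume_eq_prod, h, Measure.dirac_prod]
  exact (MeasurePreserving.id _).prod h1

lemma measurePreserving_realCoord (p q : ℕ) :
    MeasurePreserving (realCoord : CoordReal p q → Coord ℝ (Fin 0 → ℝ) p (q - p)) := by
  have h1 : (volume : Measure (Fin 0 → ℝ)) Set.univ = 1 := by
    rw [volume_pi, Measure.pi_of_empty, Measure.dirac_apply_of_mem (Set.mem_univ _)]
  have h2 : (volume : Measure (Fin p → Fin 0 → ℝ)) Set.univ = 1 := by
    rw [volume_pi, Measure.pi_univ, h1, Finset.prod_const_one]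
  -- A measure of total mass one on a single point, so inserting this coordinate changes no
  -- integral.
  have h3 : (volume : Measure (Fin p → Fin 0 → ℝ)) = Measure.dirac 0 := by
    ext s _
    rcases Set.eq_empty_or_nonempty s with rfl | hs
    · simp
    · rw [Subsingleton.eq_univ_of_nonempty hs, h2,
        Measure.dirac_apply_of_mem (Set.mem_univ _)]
  have h4 : SFinite (volume : Measure ((Upper p → ℝ) × (Fin p → Fin (q - p) → ℝ))) := by
    rw [Measure.volume_eq_prod]; infer_instance
  have h5 : SFinite (volume : Measure
      ((Upper p → ℝ) × (Upper p → ℝ) × (Fin p → Fin (q - p) → ℝ))) := by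
    rw [Measure.volume_eq_prod]; infer_instance
  exact (MeasurePreserving.id _).prod (measurePreserving_insert 0 h3)

lemma realCoord_mem_iff {p q : ℕ} (x : CoordReal p q) :
    x ∈ domReal p q ↔ Diss (coordT (realCoord x)) := by
  have hN : (coordN (realCoord x))ᴴ = -coordN (realCoord x) := coordN_conjTranspose _
  have hM : (coordM (realCoord x)).IsHermitian := herm_isHermitian _ _
  rw [← posDef_iff_diss_real (coordT_isHermitian _)]
  change Matrix.PosDef ((1 / 2 : ℝ) • ((coordM (realCoord x) + coordN (realCoord x)) +
    (coordM (realCoord x) + coordN (realCoord x))ᴴ) - _) ↔ _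
  rw [half_smul_add hM hN]
  rfl

lemma integral_gauss_norm_real (u : ℝ) (hu : 0 < u) :
    ∫ x : ℝ, Real.exp (-(u * ‖x‖ ^ 2)) = (Real.pi / u) ^ (((1 : ℕ) : ℝ) / 2) := by
  simp only [Real.norm_eq_abs, sq_abs, Nat.cast_one]
  exact integral_gauss_real u hu

/-- The integral over the imaginary part is an evaluation, so `C = 1` and `α_k = σ_k - (p - 1 - k)`,
the shift coming from the weights. -/
theorem integral_real (p q : ℕ) (hpq : p ≤ q) (lam sig : Fin p → ℂ)
    (h : ∀ k : Fin p, ((q : ℝ) + (k + 1)) / 2 - 1 < (lam k).re ∧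
      ((p : ℝ) - (k + 1)) / 2 < (sig k - lam k).re) :
    HasInt (integrandReal (q := q) lam sig) (volume.restrict (domReal p q))
      (∏ k : Fin p, (Real.pi : ℂ) ^ ((k + 1 : ℂ) + ((q : ℂ) - p) / 2 - 1) *
        (Complex.Gamma (lam k - ((q : ℂ) + (k + 1)) / 2 + 1) *
          Complex.Gamma (sig k - lam k - ((p : ℂ) - (k + 1)) / 2)) /
        Complex.Gamma (sig k - p + (k + 1))) := by
  have hqc : (q : ℂ) = p + (q - p : ℕ) := by rw [Nat.cast_sub hpq]; ring
  have hqr : (q : ℝ) = p + (q - p : ℕ) := by rw [Nat.cast_sub hpq]; ring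
  have hn : ∀ k : Fin p, ((p - 1 - k.val : ℕ) : ℝ) = p - 1 - (k : ℕ) := fun k => by
    have := k.isLt
    rw [Nat.cast_sub (by omega), Nat.cast_sub (by omega)]
    simp
  have hα : ∀ k : Fin p, 0 < (sig k - ((p - 1 - k.val : ℕ) : ℝ)).re := fun k => by
    obtain ⟨h1, h2⟩ := h k
    rw [Complex.sub_re] at h2
    rw [Complex.sub_re, Complex.ofReal_re, hn]
    have : (0 : ℝ) ≤ (k : ℕ) := by positivity
    have : (0 : ℝ) ≤ (q - p : ℕ) := by positivity
    linarith
  have hval : ∀ k : Fin p, ∀ A : ℝ, 0 < A → ∀ v : Fin 0 → ℝ,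
      ((algebraMap ℝ ℝ A + ImCoord.emb v : ℝ) : ℂ) ^ (-sig k) *
        (‖(algebraMap ℝ ℝ A + ImCoord.emb v : ℝ)‖ : ℂ) ^ (1 * (p - 1 - k.val)) =
      (A : ℂ) ^ (-(sig k - ((p - 1 - k.val : ℕ) : ℝ))) := by
    intro k A hA v
    have h1 : (algebraMap ℝ ℝ A + ImCoord.emb v : ℝ) = A := add_zero A
    rw [h1, Real.norm_of_nonneg hA.le, one_mul, ← Complex.cpow_natCast,
      ← Complex.cpow_add _ _ (Complex.ofReal_ne_zero.2 hA.ne')]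
    congr 1
    push_cast
    ring
  have hprob : IsProbabilityMeasure (volume : Measure (Fin 0 → ℝ)) := by
    rw [volume_pi, Measure.pi_of_empty]; infer_instance
  have key := hasInt_pivot_powers (K := ℝ) (F := Fin 0 → ℝ) (p := p) (r := q - p) (d := 1)
    (by simp) integral_gauss_norm_real lam (fun k s => (s : ℂ) ^ (-sig k))
    (fun k => by fun_prop) (fun _ => 1) (fun k => sig k - ((p - 1 - k.val : ℕ) : ℝ)) (fun _ => 1)
    (fun k => by
      obtain ⟨h1, h2⟩ := h k
      simp
      linarith) hα
    (fun k => by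
      obtain ⟨h1, h2⟩ := h k
      simp [hn] at h2 ⊢
      linarith)
    (fun k A hA => by
      rw [hasInt_congr (hval k A hA), one_mul]
      exact ⟨integrable_const _, by simp⟩)
    (fun k A hA => by
      refine (integral_congr_ae (.of_forall fun v => congrArg norm (hval k A hA v))).le.trans ?_
      simp [Complex.norm_cpow_eq_rpow_re_of_pos hA])
    (f := fun x => (∏ j : Fin p, (((lead (coordT x) j).det : ℝ) : ℂ) ^ gap lam j /
      (((lead (coordR x) j).det : ℝ) : ℂ) ^ gap sig j) *
      (((coordT x).det : ℝ) : ℂ) ^ (-((p : ℂ) + q) / 2))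
    (fun x hx => by
      have hR : Diss (coordR x) := by
        rw [coordR_eq]
        exact diss_of_hermitian _ hx (coordN_conjTranspose x)
      have hTp := hx.re_piv_pos
      have hRp := hR.re_piv_pos
      simp only [re_real] at hTp hRp ⊢
      simp only [det_eq_prod_piv hx, det_eq_prod_piv (hx.lead _), det_eq_prod_piv (hR.lead _),
        piv_lead, Finset.prod_div_distrib]
      rw [prod_cpow_gap hTp, prod_cpow_gap hRp, ofReal_prod_cpow_const hTp,
        ← Finset.prod_div_distrib, ← Finset.prod_mul_distrib]
      refine Finset.prod_congr rfl fun k _ => ?_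
      rw [Complex.cpow_neg, show lam k - (1 : ℕ) * (p + (p + (q - p : ℕ))) / 2 =
        lam k + -((p : ℂ) + q) / 2 by rw [hqc]; push_cast; ring,
        Complex.cpow_add _ _ (Complex.ofReal_ne_zero.2 (hTp k).ne')]
      ring)
  have h3 := hasInt_preimage (measurePreserving_realCoord p q) measurableSet_diss key
  have hdom : domReal p q = realCoord ⁻¹' {x | Diss (coordT x)} :=
    Set.ext fun x => realCoord_mem_iff x
  rw [hdom]
  convert h3 using 1
  · rfl
  refine Fintype.prod_congr _ _ fun k => ?_
  have hnc : (((p - 1 - k.val : ℕ) : ℝ) : ℂ) = p - 1 - (k : ℕ) := by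
    rw [hn]
    push_cast
    ring
  rw [hnc, show ((1 : ℕ) * (2 * (k : ℕ) + (q - p : ℕ)) : ℂ) / 2 = (k + 1 : ℂ) + ((q : ℂ) - p) / 2 - 1
      by rw [hqc, Nat.cast_one]; ring,
    show sig k - (p - 1 - (k : ℕ) : ℂ) - (lam k - (1 : ℕ) * (p + (q - p : ℕ) + (k + 1)) / 2 + 1) -
      ((k + 1 : ℂ) + ((q : ℂ) - p) / 2 - 1) = sig k - lam k - ((p : ℂ) - (k + 1)) / 2
      by rw [hqc, Nat.cast_one]; ring,
    show lam k - (1 : ℕ) * (p + (q - p : ℕ) + (k + 1) : ℂ) / 2 + 1 =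
      lam k - ((q : ℂ) + (k + 1)) / 2 + 1 by rw [hqc, Nat.cast_one]; ring,
    show sig k - (p - 1 - (k : ℕ) : ℂ) = sig k - p + (k + 1) by ring]
  ring

end Real

lemma cast_sub_one_sub {p : ℕ} (k : Fin p) : ((p - 1 - k.val : ℕ) : ℂ) = p - 1 - (k : ℕ) := by
  have := k.isLt
  rw [Nat.cast_sub (by omega), Nat.cast_sub (by omega)]
  simp

/-! ### The complex case -/

section Complex

instance : ImCoord ℂ ℝ where
  emb :=
    { toFun := fun v => (v : ℂ) * Complex.I
      map_zero' := by simp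
      map_add' := fun x y => by push_cast; ring }
  im := Complex.im
  measurable_emb := by
    change Measurable fun v : ℝ => (v : ℂ) * Complex.I
    fun_prop
  re_emb v := by simp
  re_add_im x := Complex.re_add_im x

lemma emb_complex (v : ℝ) : (ImCoord.emb v : ℂ) = v * Complex.I := rfl

/-- `CoordComplex p q` is by definition `Coord ℂ ℝ p (q - p)`, so no change of coordinates
intervenes. -/
lemma mem_domComplex_iff {p q : ℕ} (x : CoordComplex p q) :
    x ∈ domComplex p q ↔ Diss (coordT (K := ℂ) (F := ℝ) x) := by
  have hN := coordN_conjTranspose (K := ℂ) (F := ℝ) x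
  have hM : (coordM (K := ℂ) (F := ℝ) x).IsHermitian := herm_isHermitian _ _
  rw [← posDef_iff_diss_complex (coordT_isHermitian _)]
  change Matrix.PosDef ((1 / 2 : ℝ) • ((coordM (K := ℂ) (F := ℝ) x + coordN (K := ℂ) (F := ℝ) x) +
    (coordM (K := ℂ) (F := ℝ) x + coordN (K := ℂ) (F := ℝ) x)ᴴ) - _) ↔ _
  rw [half_smul_add hM hN]
  rfl

lemma integral_gauss_norm_complex (u : ℝ) (hu : 0 < u) :
    ∫ x : ℂ, Real.exp (-(u * ‖x‖ ^ 2)) = (Real.pi / u) ^ (((2 : ℕ) : ℝ) / 2) := by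
  have := GaussianFourier.integral_rexp_neg_mul_sq_norm (V := ℂ) hu
  simp only [neg_mul, Complex.finrank_real_complex] at this
  exact this

/-- Since `|z|^(2n) = z^n z̄^n`, the weights shift both exponents by the same integer. -/
lemma bipow_mul_norm (σ τ : ℂ) {z : ℂ} (hz : z ≠ 0) (n : ℕ) :
    bipow σ τ z * (‖z‖ : ℂ) ^ (2 * n) = bipow (σ - n) (τ - n) z := by
  have h1 : (‖z‖ : ℂ) ^ (2 * n) = Complex.exp (n * Complex.log z) *
      Complex.exp (n * conj (Complex.log z)) := by
    rw [Complex.exp_nat_mul, Complex.exp_nat_mul, Complex.exp_conj, Complex.exp_log hz, ← mul_pow,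
      Complex.mul_conj', pow_mul]
  rw [h1, bipow, bipow, ← Complex.exp_add, ← Complex.exp_add, ← Complex.exp_add,
    ← Complex.exp_add]
  congr 1
  ring

/-- The products of the complex powers of the determinants of the leading blocks. -/
lemma prod_detPow_gap {p : ℕ} {R : Matrix (Fin p) (Fin p) ℂ} (hR : Diss R) (σ τ : Fin p → ℂ) :
    (∏ j : Fin p, detPow (lead R j) (gap σ j) (gap τ j))⁻¹ = ∏ k, bipow (σ k) (τ k) (piv R k) := by
  simp only [detPow, Finset.prod_mul_distrib]
  have h1 : ∏ j : Fin p, Complex.exp (gap σ j * logDet (lead R j)) =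
      ∏ k, Complex.exp (Complex.log (piv R k) * σ k) := by
    rw [← prod_exp_gap fun k => Complex.log (piv R k)]
    refine Finset.prod_congr rfl fun j _ => ?_
    rw [logDet_eq_sum (hR.lead j), mul_comm]
    rfl
  have h2 : ∏ j : Fin p, Complex.exp (gap τ j * conj (logDet (lead R j))) =
      ∏ k, Complex.exp (conj (Complex.log (piv R k)) * τ k) := by
    rw [← prod_exp_gap fun k => conj (Complex.log (piv R k))]
    refine Finset.prod_congr rfl fun j _ => ?_
    rw [logDet_eq_sum (hR.lead j), mul_comm, map_sum]
    rfl
  rw [h1, h2, ← Finset.prod_mul_distrib, ← Finset.prod_inv_distrib]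
  refine Finset.prod_congr rfl fun k _ => ?_
  rw [bipow, mul_inv, ← Complex.exp_neg, ← Complex.exp_neg, mul_comm (σ k), mul_comm (τ k)]

/-- With the shifted exponents `s`, `t` the Cauchy integral contributes `Γ(s + t - 1)/(Γ(s)Γ(t))`,
and its numerator cancels the `Γ(α)` of the beta integral. At a pole `Complex.Gamma` takes the value
0 and division by 0 gives 0, which realizes the convention `1/Γ = 0`. -/
theorem integral_complex (p q : ℕ) (hpq : p ≤ q) (lam sig tau : Fin p → ℂ)
    (h : ∀ k : Fin p, (q : ℝ) + (k + 1) - 1 < (lam k).re ∧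
      (p : ℝ) - (k + 1) < (sig k + tau k - lam k).re) :
    HasInt (integrandComplex (q := q) lam sig tau) (volume.restrict (domComplex p q))
      (∏ k : Fin p, (2 : ℂ) ^ (2 * ((p : ℂ) - (k + 1) + 1) - sig k - tau k) *
        (Real.pi : ℂ) ^ (2 * (k + 1 : ℂ) + ((q : ℂ) - p) - 1) *
        (Complex.Gamma (lam k - ((q : ℂ) + (k + 1)) + 1) *
          Complex.Gamma (sig k + tau k - lam k - p + (k + 1))) /
        (Complex.Gamma (sig k - p + (k + 1)) * Complex.Gamma (tau k - p + (k + 1)))) := by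
  have hqc : (q : ℂ) = p + (q - p : ℕ) := by rw [Nat.cast_sub hpq]; ring
  have hqr : (q : ℝ) = p + (q - p : ℕ) := by rw [Nat.cast_sub hpq]; ring
  obtain ⟨s, hs⟩ : ∃ s : Fin p → ℂ, ∀ k, s k = sig k - (p - 1 - k.val : ℕ) := ⟨_, fun _ => rfl⟩
  obtain ⟨t, ht⟩ : ∃ t : Fin p → ℂ, ∀ k, t k = tau k - (p - 1 - k.val : ℕ) := ⟨_, fun _ => rfl⟩
  have hα : ∀ k : Fin p, 0 < (s k + t k - 1).re := fun k => by
    obtain ⟨h1, h2⟩ := h k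
    have : (0 : ℝ) ≤ (k : ℕ) := by positivity
    have : (0 : ℝ) ≤ (q - p : ℕ) := by positivity
    rw [hs, ht, cast_sub_one_sub]
    simp at h2 ⊢
    linarith
  have hα' : ∀ k : Fin p, 1 < (s k + t k).re := fun k => by
    have := hα k
    rw [Complex.sub_re, Complex.one_re] at this
    linarith
  have hval : ∀ k : Fin p, ∀ A : ℝ, 0 < A → ∀ v : ℝ,
      bipow (sig k) (tau k) (algebraMap ℝ ℂ A + ImCoord.emb v) *
        (‖(algebraMap ℝ ℂ A + ImCoord.emb v : ℂ)‖ : ℂ) ^ (2 * (p - 1 - k.val)) =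
      bipow (s k) (t k) ((A : ℂ) + v * Complex.I) := by
    intro k A hA v
    rw [emb_complex, Complex.coe_algebraMap, bipow_mul_norm _ _ (add_mul_I_ne_zero hA v), hs, ht]
  have key := hasInt_pivot_powers (K := ℂ) (F := ℝ) (p := p) (r := q - p) (d := 2)
    Complex.finrank_real_complex integral_gauss_norm_complex lam
    (fun k => bipow (sig k) (tau k)) (fun k => measurable_bipow _ _)
    (fun k => 2 * Real.pi * 2 ^ (1 - s k - t k) * Complex.Gamma (s k + t k - 1) *
        ((Complex.Gamma (s k))⁻¹ * (Complex.Gamma (t k))⁻¹))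
    (fun k => s k + t k - 1)
    (fun k => Real.exp (|(s k - t k).im| * Real.pi) * (Real.pi ^ ((1 : ℝ) / 2) *
        Real.Gamma ((s k + t k).re / 2 - 1 / 2) / Real.Gamma ((s k + t k).re / 2)))
    (fun k => by
      obtain ⟨h1, h2⟩ := h k
      rw [show lam k - (2 : ℕ) * (p + (q - p : ℕ) + (k + 1) : ℂ) / 2 + 1 =
        lam k - ((q : ℂ) + (k + 1)) + 1 by rw [hqc, Nat.cast_two]; ring]
      simp
      linarith) hα
    (fun k => by
      obtain ⟨h1, h2⟩ := h k
      rw [hs, ht, cast_sub_one_sub, show sig k - (p - 1 - (k : ℕ) : ℂ) +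
        (tau k - (p - 1 - (k : ℕ) : ℂ)) - 1 - (lam k - (2 : ℕ) * (p + (q - p : ℕ) + (k + 1)) / 2 + 1) -
        (2 : ℕ) * (2 * (k : ℕ) + (q - p : ℕ)) / 2 = sig k + tau k - lam k - p + (k + 1) by
          rw [Nat.cast_two]; ring]
      simp at h2 ⊢
      linarith)
    (fun k A hA => by
      rw [hasInt_congr (hval k A hA)]
      exact hasInt_bipow (hα' k) hA)
    (fun k A hA => by
      refine (integral_congr_ae (.of_forall fun v => congrArg norm (hval k A hA v))).le.trans ?_
      refine (integral_norm_bipow_le (hα' k) hA).trans_eq ?_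
      rw [Complex.sub_re, Complex.one_re])
    (f := integrandComplex (q := q) lam sig tau)
    (fun x hx => by
      have hR : Diss (coordR x) := by
        rw [coordR_eq]
        exact diss_of_hermitian _ hx (coordN_conjTranspose x)
      have hTp := hx.re_piv_pos
      have hdet : ∀ {n : ℕ} {g : Matrix (Fin n) (Fin n) ℂ}, g.IsHermitian → Diss g →
          g.det = ((∏ k, re (piv g k) : ℝ) : ℂ) := by
        intro n g h1 h2
        rw [det_eq_prod_piv h2, Complex.ofReal_prod]
        exact Finset.prod_congr rfl fun k _ => piv_eq_re h1 h2 k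
      change (∏ j : Fin p, (lead (coordT x) j).det ^ gap lam j /
        detPow (lead (coordR x) j) (gap sig j) (gap tau j)) *
        (coordT x).det ^ (-((p : ℂ) + q)) = _
      have hT := coordT_isHermitian x
      rw [Finset.prod_div_distrib, div_eq_mul_inv, prod_detPow_gap hR, hdet hT hx,
        ofReal_prod_cpow_const hTp]
      have hlead : ∀ j, (lead (coordT x) j).det =
          ((∏ i : Fin (j.val + 1), re (piv (coordT x)
            (Fin.castLE (Nat.succ_le_of_lt j.isLt) i)) : ℝ) : ℂ) := fun j =>
        hdet (hT.submatrix _) (hx.lead j)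
      simp only [hlead]
      rw [prod_cpow_gap hTp, ← Finset.prod_mul_distrib, ← Finset.prod_mul_distrib]
      refine Finset.prod_congr rfl fun k _ => ?_
      rw [show lam k - (2 : ℕ) * (p + (p + (q - p : ℕ))) / 2 =
        lam k + -((p : ℂ) + q) by rw [hqc, Nat.cast_two]; ring,
        Complex.cpow_add _ _ (Complex.ofReal_ne_zero.2 (hTp k).ne')]
      ring)
  have hdom : domComplex p q = {x | Diss (coordT (K := ℂ) (F := ℝ) x)} :=
    Set.ext fun x => mem_domComplex_iff x
  rw [hdom]
  convert key using 1
  refine Fintype.prod_congr _ _ fun k => ?_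
  have hG := Complex.Gamma_ne_zero_of_re_pos (hα k)
  have e1 : (2 * Real.pi * 2 ^ (1 - s k - t k) : ℂ) =
      2 ^ (2 * ((p : ℂ) - (k + 1) + 1) - sig k - tau k) * Real.pi := by
    rw [hs, ht, cast_sub_one_sub, show 2 * ((p : ℂ) - (k + 1) + 1) - sig k - tau k =
      1 + (1 - (sig k - (p - 1 - (k : ℕ))) - (tau k - (p - 1 - (k : ℕ)))) by ring,
      Complex.cpow_add _ _ two_ne_zero, Complex.cpow_one]
    ring
  have e2 : (Real.pi : ℂ) ^ (2 * (k + 1 : ℂ) + ((q : ℂ) - p) - 1) =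
      Real.pi * Real.pi ^ (((2 : ℕ) * (2 * (k : ℕ) + (q - p : ℕ)) : ℂ) / 2) := by
    rw [show 2 * (k + 1 : ℂ) + ((q : ℂ) - p) - 1 =
      1 + ((2 : ℕ) * (2 * (k : ℕ) + (q - p : ℕ)) : ℂ) / 2 by rw [hqc, Nat.cast_two]; ring,
      Complex.cpow_add _ _ (Complex.ofReal_ne_zero.2 Real.pi_pos.ne'), Complex.cpow_one]
  have e3 : s k + t k - 1 - (lam k - (2 : ℕ) * (p + (q - p : ℕ) + (k + 1)) / 2 + 1) -
      (2 : ℕ) * (2 * (k : ℕ) + (q - p : ℕ)) / 2 = sig k + tau k - lam k - p + (k + 1) := by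
    rw [hs, ht, cast_sub_one_sub, Nat.cast_two]
    ring
  rw [e1, e2, e3, show lam k - (2 : ℕ) * (p + (q - p : ℕ) + (k + 1) : ℂ) / 2 + 1 =
    lam k - ((q : ℂ) + (k + 1)) + 1 by rw [hqc, Nat.cast_two]; ring,
    show sig k - p + (k + 1) = s k by rw [hs, cast_sub_one_sub]; ring,
    show tau k - p + (k + 1) = t k by rw [ht, cast_sub_one_sub]; ring]
  rw [div_eq_mul_inv _ (Complex.Gamma (s k + t k - 1)), div_eq_mul_inv, mul_inv]
  generalize Complex.Gamma (s k + t k - 1) = G at hG ⊢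
  linear_combination (-(2 ^ (2 * ((p : ℂ) - (k + 1) + 1) - sig k - tau k) *
    (Real.pi * Real.pi ^ (((2 : ℕ) * (2 * (k : ℕ) + (q - p : ℕ)) : ℂ) / 2)) *
    (Complex.Gamma (lam k - ((q : ℂ) + (k + 1)) + 1) *
      Complex.Gamma (sig k + tau k - lam k - p + (k + 1))) *
    ((Complex.Gamma (s k))⁻¹ * (Complex.Gamma (t k))⁻¹))) * mul_inv_cancel₀ hG

end Complex

/-! ### The quaternionic case -/

section Quaternions

/-- `quat` as a linear homeomorphism. -/
def quatL : (Fin 4 → ℝ) ≃L[ℝ] Quaternion ℝ := quatEquiv.symm.toContinuousLinearEquiv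

/-- Lebesgue measure is transported from ℝ⁴, so that `quat` preserves measure by construction. -/
instance : MeasureSpace (Quaternion ℝ) where
  toMeasurableSpace := borel _
  volume := @Measure.map _ _ _ (borel _) quatL volume

instance : BorelSpace (Quaternion ℝ) := ⟨rfl⟩

instance : (volume : Measure (Quaternion ℝ)).IsAddHaarMeasure :=
  quatL.isAddHaarMeasure_map volume

lemma measurePreserving_quat : MeasurePreserving quat :=
  ⟨quatL.continuous.measurable, rfl⟩

lemma norm_quat_sq (v : Fin 4 → ℝ) : ‖quat v‖ ^ 2 = ∑ i, v i ^ 2 := by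
  rw [sq, ← Quaternion.normSq_eq_norm_mul_self, Quaternion.normSq_def', Fin.sum_univ_four]
  rfl

lemma integral_gauss_pi (n : ℕ) {u : ℝ} (hu : 0 < u) :
    ∫ v : Fin n → ℝ, Real.exp (-(u * ∑ i, v i ^ 2)) = (Real.pi / u) ^ ((n : ℝ) / 2) := by
  have h := integral_exp_nsq (K := ℝ) (d := ((1 : ℕ) : ℝ)) integral_gauss_norm_real n hu
  simp only [nsq, Real.norm_eq_abs, sq_abs, Nat.cast_one, one_mul] at h
  exact h

lemma integral_gauss_norm_quat (u : ℝ) (hu : 0 < u) :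
    ∫ x : Quaternion ℝ, Real.exp (-(u * ‖x‖ ^ 2)) = (Real.pi / u) ^ (((4 : ℕ) : ℝ) / 2) := by
  rw [← integral_gauss_pi 4 hu, ← measurePreserving_quat.map_eq,
    integral_map measurePreserving_quat.measurable.aemeasurable
      (Continuous.aestronglyMeasurable (by fun_prop))]
  simp only [norm_quat_sq]

instance : ImCoord (Quaternion ℝ) (Fin 3 → ℝ) where
  emb :=
    { toFun := quatIm
      map_zero' := rfl
      map_add' := fun x y => by ext <;> simp <;> simp [quatIm] }
  im x := ![x.imI, x.imJ, x.imK]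
  measurable_emb := by
    have h1 : Measurable fun v : Fin 3 → ℝ => quat ![0, v 0, v 1, v 2] := by
      refine measurePreserving_quat.measurable.comp (measurable_pi_iff.2 fun i => ?_)
      fin_cases i <;> simp <;> fun_prop
    exact h1
  re_emb _ := rfl
  re_add_im x := by ext <;> simp <;> rfl

lemma norm_add_quatIm_sq (A : ℝ) (v : Fin 3 → ℝ) :
    ‖algebraMap ℝ (Quaternion ℝ) A + (ImCoord.emb v : Quaternion ℝ)‖ ^ 2 =
      A ^ 2 + ∑ i, v i ^ 2 := by
  have h1 : algebraMap ℝ (Quaternion ℝ) A + (ImCoord.emb v : Quaternion ℝ) =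
      quat ![A, v 0, v 1, v 2] := by
    change algebraMap ℝ (Quaternion ℝ) A + quatIm v = _
    ext <;> simp <;> simp [quatIm, quat]
  rw [h1, norm_quat_sq, Fin.sum_univ_four, Fin.sum_univ_three]
  simp
  ring

/-- Quaternionic coordinates. -/
def quatCoord {p q : ℕ} (x : CoordQuat p q) : Coord (Quaternion ℝ) (Fin 3 → ℝ) p (q - p) :=
  (x.1, fun ij => quat (x.2.1 ij), x.2.2.1, fun ij => quat (x.2.2.2.1 ij),
    fun i j => quat (x.2.2.2.2 i j))

lemma measurePreserving_quatCoord (p q : ℕ) :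
    MeasurePreserving
      (quatCoord : CoordQuat p q → Coord (Quaternion ℝ) (Fin 3 → ℝ) p (q - p)) := by
  have h1 : MeasurePreserving fun (o : Upper p → Fin 4 → ℝ) ij => quat (o ij) :=
    volume_preserving_pi fun _ => measurePreserving_quat
  have h2 : MeasurePreserving fun (l : Fin p → Fin (q - p) → Fin 4 → ℝ) i j => quat (l i j) :=
    volume_preserving_pi fun _ => volume_preserving_pi fun _ => measurePreserving_quat
  have h3 := h1.prod h2
  have h4 : SFinite (volume : Measure ((Upper p → Fin 4 → ℝ) ×
      (Fin p → Fin (q - p) → Fin 4 → ℝ))) := by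
    rw [Measure.volume_eq_prod]; infer_instance
  have h5 := (MeasurePreserving.id (volume : Measure (Fin p → Fin 3 → ℝ))).prod h3
  have h6 : SFinite (volume : Measure ((Fin p → Fin 3 → ℝ) × (Upper p → Fin 4 → ℝ) ×
      (Fin p → Fin (q - p) → Fin 4 → ℝ))) := by
    rw [Measure.volume_eq_prod]; infer_instance
  have h7 := h1.prod h5
  have h8 : SFinite (volume : Measure ((Upper p → Fin 4 → ℝ) × (Fin p → Fin 3 → ℝ) ×
      (Upper p → Fin 4 → ℝ) × (Fin p → Fin (q - p) → Fin 4 → ℝ))) := by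
    rw [Measure.volume_eq_prod]; infer_instance
  exact (MeasurePreserving.id (volume : Measure (Fin p → ℝ))).prod h7

lemma mem_domQuat_iff {p q : ℕ} (x : CoordQuat p q) :
    x ∈ domQuat p q ↔ Diss (coordT (quatCoord x)) := by
  have hN := coordN_conjTranspose (quatCoord x)
  have hM : (coordM (quatCoord x)).IsHermitian := herm_isHermitian _ _
  rw [← quatPosDef_iff_diss (coordT_isHermitian _)]
  change QuatPosDef ((1 / 2 : ℝ) • ((coordM (quatCoord x) + coordN (quatCoord x)) +
    (coordM (quatCoord x) + coordN (quatCoord x))ᴴ) - _) ↔ _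
  rw [half_smul_add hM hN]
  rfl

/-- Norms are replaced by their squares `A² + |v|²`, to which `hasInt_power` applies. -/
lemma ofReal_cpow_eq_sq {y : ℝ} (hy : 0 < y) (w : ℂ) : (y : ℂ) ^ w = ((y ^ 2 : ℝ) : ℂ) ^ (w / 2) := by
  rw [Complex.cpow_def_of_ne_zero (Complex.ofReal_ne_zero.2 hy.ne'),
    Complex.cpow_def_of_ne_zero (Complex.ofReal_ne_zero.2 (by positivity)),
    ← Complex.ofReal_log hy.le, ← Complex.ofReal_log (by positivity), Real.log_pow]
  congr 1
  push_cast
  ring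

lemma hasInt_quatIm {w : ℂ} (hw : 3 < w.re) {A : ℝ} (hA : 0 < A) :
    HasInt (fun v : Fin 3 → ℝ => ((A ^ 2 + ∑ i, v i ^ 2 : ℝ) : ℂ) ^ (-(w / 2))) volume
      ((Real.pi : ℂ) ^ ((3 : ℂ) / 2) * Complex.Gamma (w / 2 - 3 / 2) / Complex.Gamma (w / 2) *
        (A : ℂ) ^ (-(w - 3))) := by
  have hre : (w / 2).re = w.re / 2 := by simp
  have h := hasInt_power (μ := (volume : Measure (Fin 3 → ℝ))) (N := fun v => ∑ i, v i ^ 2)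
    (D := ((3 : ℕ) : ℝ)) (by fun_prop) (fun _ => by positivity)
    (fun u hu => integral_gauss_pi 3 hu) (α := w / 2) (by rw [hre]; linarith)
    (by rw [hre]; push_cast; linarith) (B := A ^ 2) (by positivity)
  convert h using 1
  rw [ofReal_cpow_eq_sq hA, show -(w - 3) / 2 = -(w / 2 - 3 / 2) by ring]
  push_cast
  ring

/-- The norm of the integrand is the integrand for the exponent `Re w`; only an upper bound is
needed for convergence. -/
lemma hasInt_norm_quat {w : ℂ} (hw : 3 < w.re) {A : ℝ} (hA : 0 < A) :
    ∫ v : Fin 3 → ℝ, ‖((A ^ 2 + ∑ i, v i ^ 2 : ℝ) : ℂ) ^ (-(w / 2))‖ ≤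
      ‖(Real.pi : ℂ) ^ ((3 : ℂ) / 2) * Complex.Gamma ((w.re : ℂ) / 2 - 3 / 2) /
        Complex.Gamma ((w.re : ℂ) / 2)‖ * A ^ (-(w.re - 3)) := by
  have h := (hasInt_quatIm (w := (w.re : ℂ)) (by simpa using hw) hA).2
  have e : ∀ v : Fin 3 → ℝ, ((A ^ 2 + ∑ i, v i ^ 2 : ℝ) : ℂ) ^ (-((w.re : ℂ) / 2)) =
      ((‖((A ^ 2 + ∑ i, v i ^ 2 : ℝ) : ℂ) ^ (-(w / 2))‖ : ℝ) : ℂ) := fun v => by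
    have hp : 0 < A ^ 2 + ∑ i, v i ^ 2 := by positivity
    rw [Complex.norm_cpow_eq_rpow_re_of_pos hp, Complex.ofReal_cpow hp.le]
    simp
  simp only [e] at h
  rw [integral_complex_ofReal] at h
  have h2 := congrArg norm h
  rw [norm_mul, Complex.norm_cpow_eq_rpow_re_of_pos hA, Complex.norm_real] at h2
  refine (le_abs_self _).trans ?_
  rw [← Real.norm_eq_abs, h2]
  simp

/-- The weights shift the exponent to `s_k = σ_k - 4(p - 1 - k)`, and the radial integral over the
three imaginary directions lowers it to `α_k = s_k - 3`. -/
theorem integral_quat (p q : ℕ) (hpq : p ≤ q) (lam sig : Fin p → ℂ)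
    (h : ∀ k : Fin p, 2 * ((q : ℝ) + (k + 1)) - 1 < (lam k).re ∧
      2 * ((p : ℝ) - (k + 1)) < (sig k - lam k).re) :
    HasInt (integrandQuat (q := q) lam sig) (volume.restrict (domQuat p q))
      (∏ k : Fin p, (2 : ℂ) ^ (4 * ((p : ℂ) - (k + 1) + 1) - sig k) *
        (Real.pi : ℂ) ^ (4 * (k + 1 : ℂ) + 2 * ((q : ℂ) - p) - 2) *
        (Complex.Gamma (lam k - 2 * ((q : ℂ) + (k + 1)) + 1) *
          Complex.Gamma (sig k - lam k - 2 * ((p : ℂ) - (k + 1)))) /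
        (Complex.Gamma (sig k / 2 - 2 * ((p : ℂ) - (k + 1))) *
          Complex.Gamma (sig k / 2 - 2 * ((p : ℂ) - (k + 1)) - 1))) := by
  have hqc : (q : ℂ) = p + (q - p : ℕ) := by rw [Nat.cast_sub hpq]; ring
  have hqr : (q : ℝ) = p + (q - p : ℕ) := by rw [Nat.cast_sub hpq]; ring
  have hfin : Module.finrank ℝ (Quaternion ℝ) = 4 := by
    rw [quatEquiv.finrank_eq]; simp
  obtain ⟨s, hs⟩ : ∃ s : Fin p → ℂ, ∀ k, s k = sig k - 4 * (p - 1 - k.val : ℕ) :=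
    ⟨_, fun _ => rfl⟩
  have hα : ∀ k : Fin p, 0 < (s k - 3).re := fun k => by
    obtain ⟨h1, h2⟩ := h k
    have : (0 : ℝ) ≤ (k : ℕ) := by positivity
    have : (0 : ℝ) ≤ (q - p : ℕ) := by positivity
    rw [hs, cast_sub_one_sub]
    simp at h2 ⊢
    linarith
  have hα' : ∀ k : Fin p, 3 < (s k).re := fun k => by
    have := hα k
    simp at this
    linarith
  have hval : ∀ k : Fin p, ∀ A : ℝ, 0 < A → ∀ v : Fin 3 → ℝ,
      (‖algebraMap ℝ (Quaternion ℝ) A + ImCoord.emb v‖ : ℂ) ^ (-sig k) *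
        (‖algebraMap ℝ (Quaternion ℝ) A + ImCoord.emb v‖ : ℂ) ^ (4 * (p - 1 - k.val)) =
      ((A ^ 2 + ∑ i, v i ^ 2 : ℝ) : ℂ) ^ (-(s k / 2)) := by
    intro k A hA v
    have hne : algebraMap ℝ (Quaternion ℝ) A + ImCoord.emb v ≠ 0 := by
      intro h0
      have h1 := norm_add_quatIm_sq A v
      rw [h0, norm_zero] at h1
      have : 0 < A ^ 2 + ∑ i, v i ^ 2 := by positivity
      rw [← h1] at this
      norm_num at this
    have hpos := norm_pos_iff.2 hne
    rw [← norm_add_quatIm_sq, ← Complex.cpow_natCast,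
      ← Complex.cpow_add _ _ (Complex.ofReal_ne_zero.2 hpos.ne'), ofReal_cpow_eq_sq hpos, hs]
    congr 1
    push_cast
    ring
  have key := hasInt_pivot_powers (K := Quaternion ℝ) (F := Fin 3 → ℝ) (p := p) (r := q - p)
    (d := 4) hfin integral_gauss_norm_quat lam (fun k x => (‖x‖ : ℂ) ^ (-sig k))
    (fun k => by fun_prop)
    (fun k => (Real.pi : ℂ) ^ ((3 : ℂ) / 2) * Complex.Gamma (s k / 2 - 3 / 2) /
      Complex.Gamma (s k / 2))
    (fun k => s k - 3)
    (fun k => ‖(Real.pi : ℂ) ^ ((3 : ℂ) / 2) * Complex.Gamma (((s k).re : ℂ) / 2 - 3 / 2) /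
        Complex.Gamma (((s k).re : ℂ) / 2)‖)
    (fun k => by
      obtain ⟨h1, h2⟩ := h k
      rw [show lam k - (4 : ℕ) * (p + (q - p : ℕ) + (k + 1) : ℂ) / 2 + 1 =
        lam k - 2 * ((q : ℂ) + (k + 1)) + 1 by rw [hqc, Nat.cast_ofNat]; ring]
      simp
      linarith) hα
    (fun k => by
      obtain ⟨h1, h2⟩ := h k
      rw [hs, cast_sub_one_sub, show sig k - 4 * (p - 1 - (k : ℕ) : ℂ) - 3 -
        (lam k - (4 : ℕ) * (p + (q - p : ℕ) + (k + 1)) / 2 + 1) -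
        (4 : ℕ) * (2 * (k : ℕ) + (q - p : ℕ)) / 2 = sig k - lam k - 2 * ((p : ℂ) - (k + 1)) by
          rw [Nat.cast_ofNat]; ring]
      simp at h2 ⊢
      linarith)
    (fun k A hA => by
      rw [hasInt_congr (hval k A hA)]
      exact hasInt_quatIm (hα' k) hA)
    (fun k A hA => by
      refine (integral_congr_ae (.of_forall fun v => congrArg norm (hval k A hA v))).le.trans ?_
      refine (hasInt_norm_quat (hα' k) hA).trans_eq ?_
      simp)
    (f := fun x => (∏ j : Fin p, (quatDet (lead (coordT x) j) : ℂ) ^ gap lam j /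
      (quatDet (lead (coordR x) j) : ℂ) ^ gap sig j) *
      (quatDet (coordT x) : ℂ) ^ (-2 * ((p : ℂ) + q)))
    (fun x hx => by
      have hR : Diss (coordR x) := by
        rw [coordR_eq]
        exact diss_of_hermitian _ hx (coordN_conjTranspose x)
      have hTp : ∀ k, 0 < ‖piv (coordT x) k‖ := fun k => norm_pos_iff.2 fun h0 => by
        have := hx.re_piv_pos k
        rw [h0, map_zero] at this
        exact lt_irrefl _ this
      have hRp : ∀ k, 0 < ‖piv (coordR x) k‖ := fun k => norm_pos_iff.2 fun h0 => by
        have := hR.re_piv_pos k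
        rw [h0, map_zero] at this
        exact lt_irrefl _ this
      have hTn : ∀ k, re (piv (coordT x) k) = ‖piv (coordT x) k‖ := fun k => by
        conv_rhs => rw [piv_eq_re (coordT_isHermitian x) hx k, norm_algebraMap',
          Real.norm_of_nonneg (hx.re_piv_pos k).le]
      simp only [hTn, quatDet_eq_prod hx, quatDet_eq_prod (hx.lead _),
        quatDet_eq_prod (hR.lead _), piv_lead, Finset.prod_div_distrib]
      rw [prod_cpow_gap hTp, prod_cpow_gap hRp, ofReal_prod_cpow_const hTp,
        ← Finset.prod_div_distrib, ← Finset.prod_mul_distrib]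
      refine Finset.prod_congr rfl fun k _ => ?_
      rw [Complex.cpow_neg, show lam k - (4 : ℕ) * (p + (p + (q - p : ℕ))) / 2 =
        lam k + -2 * ((p : ℂ) + q) by rw [hqc, Nat.cast_ofNat]; ring,
        Complex.cpow_add _ _ (Complex.ofReal_ne_zero.2 (hTp k).ne')]
      ring)
  have h3 := hasInt_preimage (measurePreserving_quatCoord p q) measurableSet_diss key
  have hdom : domQuat p q = quatCoord ⁻¹' {x | Diss (coordT x)} :=
    Set.ext fun x => mem_domQuat_iff x
  rw [hdom]
  convert h3 using 1
  · rfl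
  refine Fintype.prod_congr _ _ fun k => ?_
  have hG := Complex.Gamma_ne_zero_of_re_pos (hα k)
  have hG1 : Complex.Gamma (s k / 2 - 1) ≠ 0 := Complex.Gamma_ne_zero_of_re_pos (by
    have := hα' k
    simp
    linarith)
  -- Duplication at `s/2 - 3/2` replaces `Γ(s/2 - 3/2)/Γ(s - 3)` by `1/Γ(s/2 - 1)`, and produces the
  -- power of 2 and the missing `√π`.
  have hdup : Complex.Gamma (s k / 2 - 3 / 2) * Complex.Gamma (s k / 2 - 1) =
      Complex.Gamma (s k - 3) * 2 ^ (4 - s k) * (Real.pi : ℂ) ^ (1 / 2 : ℂ) := by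
    have := Complex.Gamma_mul_Gamma_add_half (s k / 2 - 3 / 2)
    rw [show s k / 2 - 3 / 2 + 1 / 2 = s k / 2 - 1 by ring,
      show 2 * (s k / 2 - 3 / 2) = s k - 3 by ring, show 1 - (s k - 3) = 4 - s k by ring,
      Real.sqrt_eq_rpow, Complex.ofReal_cpow Real.pi_pos.le] at this
    rw [this]
    push_cast
    rfl
  have hpi : (Real.pi : ℂ) ≠ 0 := Complex.ofReal_ne_zero.2 Real.pi_pos.ne'
  have e2 : (Real.pi : ℂ) ^ (4 * (k + 1 : ℂ) + 2 * ((q : ℂ) - p) - 2) =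
      Real.pi ^ ((3 : ℂ) / 2) * Real.pi ^ (1 / 2 : ℂ) *
        Real.pi ^ (((4 : ℕ) * (2 * (k : ℕ) + (q - p : ℕ)) : ℂ) / 2) := by
    rw [← Complex.cpow_add _ _ hpi, ← Complex.cpow_add _ _ hpi]
    congr 1
    rw [hqc, Nat.cast_ofNat]
    ring
  have e3 : s k - 3 - (lam k - (4 : ℕ) * (p + (q - p : ℕ) + (k + 1)) / 2 + 1) -
      (4 : ℕ) * (2 * (k : ℕ) + (q - p : ℕ)) / 2 = sig k - lam k - 2 * ((p : ℂ) - (k + 1)) := by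
    rw [hs, cast_sub_one_sub, Nat.cast_ofNat]
    ring
  rw [e2, e3, show lam k - (4 : ℕ) * (p + (q - p : ℕ) + (k + 1) : ℂ) / 2 + 1 =
    lam k - 2 * ((q : ℂ) + (k + 1)) + 1 by rw [hqc, Nat.cast_ofNat]; ring,
    show 4 * ((p : ℂ) - (k + 1) + 1) - sig k = 4 - s k by rw [hs, cast_sub_one_sub]; ring,
    show sig k / 2 - 2 * ((p : ℂ) - (k + 1)) = s k / 2 by rw [hs, cast_sub_one_sub]; ring,
    eq_div_of_mul_eq hG1 hdup]
  field_simp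

end Quaternions

end SectionOfWedge

end

theorem mainTheorem2 (p q : ℕ) (hpq : p ≤ q) :
    (∀ lam sig : Fin p → ℂ,
      (∀ k : Fin p, ((q : ℝ) + (k + 1)) / 2 - 1 < (lam k).re ∧
        ((p : ℝ) - (k + 1)) / 2 < (sig k - lam k).re) →
      IntegrableOn (SectionOfWedge.integrandReal (q := q) lam sig)
          (SectionOfWedge.domReal p q) volume ∧
        ∫ x in SectionOfWedge.domReal p q, SectionOfWedge.integrandReal lam sig x =
          ∏ k : Fin p,
            (Real.pi : ℂ) ^ ((k + 1 : ℂ) + ((q : ℂ) - p) / 2 - 1) *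
              (Complex.Gamma (lam k - ((q : ℂ) + (k + 1)) / 2 + 1) *
                Complex.Gamma (sig k - lam k - ((p : ℂ) - (k + 1)) / 2)) /
              Complex.Gamma (sig k - p + (k + 1))) ∧
    (∀ lam sig tau : Fin p → ℂ,
      (∀ k : Fin p, (q : ℝ) + (k + 1) - 1 < (lam k).re ∧
        (p : ℝ) - (k + 1) < (sig k + tau k - lam k).re) →
      IntegrableOn (SectionOfWedge.integrandComplex (q := q) lam sig tau)
          (SectionOfWedge.domComplex p q) volume ∧
        ∫ x in SectionOfWedge.domComplex p q, SectionOfWedge.integrandComplex lam sig tau x =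
          ∏ k : Fin p,
            (2 : ℂ) ^ (2 * ((p : ℂ) - (k + 1) + 1) - sig k - tau k) *
              (Real.pi : ℂ) ^ (2 * (k + 1 : ℂ) + ((q : ℂ) - p) - 1) *
              (Complex.Gamma (lam k - ((q : ℂ) + (k + 1)) + 1) *
                Complex.Gamma (sig k + tau k - lam k - p + (k + 1))) /
              (Complex.Gamma (sig k - p + (k + 1)) * Complex.Gamma (tau k - p + (k + 1)))) ∧
    (∀ lam sig : Fin p → ℂ,
      (∀ k : Fin p, 2 * ((q : ℝ) + (k + 1)) - 1 < (lam k).re ∧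
        2 * ((p : ℝ) - (k + 1)) < (sig k - lam k).re) →
      IntegrableOn (SectionOfWedge.integrandQuat (q := q) lam sig)
          (SectionOfWedge.domQuat p q) volume ∧
        ∫ x in SectionOfWedge.domQuat p q, SectionOfWedge.integrandQuat lam sig x =
          ∏ k : Fin p,
            (2 : ℂ) ^ (4 * ((p : ℂ) - (k + 1) + 1) - sig k) *
              (Real.pi : ℂ) ^ (4 * (k + 1 : ℂ) + 2 * ((q : ℂ) - p) - 2) *
              (Complex.Gamma (lam k - 2 * ((q : ℂ) + (k + 1)) + 1) *
                Complex.Gamma (sig k - lam k - 2 * ((p : ℂ) - (k + 1)))) /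
              (Complex.Gamma (sig k / 2 - 2 * ((p : ℂ) - (k + 1))) *
                Complex.Gamma (sig k / 2 - 2 * ((p : ℂ) - (k + 1)) - 1))) :=
  ⟨SectionOfWedge.integral_real p q hpq, SectionOfWedge.integral_complex p q hpq,
    SectionOfWedge.integral_quat p q hpq⟩
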